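/- Let $J_m=(q^m;q^m)_\infty$ and $(a;q)_n=\prod_{k=0}^{n-1}(1-aq^k)$. For a positive definite matrix $A\in\mathbb{Q}^{r\times r}$, a vector $B\in\mathbb{Q}^r$, a scalar $C$ and $q=e^{2\pi i\tau}$, $\operatorname{Im}\tau>0$, let $$f_{A,B,C}(q)=\sum_{n\in\mathbb{N}^r}\frac{q^{\frac12 n^{\mathrm T}An+n^{\mathrm T}B+C}}{(q;q)_{n_1}\cdots(q;q)_{n_r}}.$$ Call a function $f$ on the upper half plane modular of weight $k$ if it is holomorphic, satisfies $f(\gamma\tau)=\varepsilon(\gamma)(c\tau+d)^kf(\tau)$ for all $\gamma=\begin{pmatrix}a&b\\c&d\end{pmatrix}$ in some subgroup of finite index of $\mathrm{SL}_2(\mathbb{Z})$, with roots of unity $\varepsilon(\gamma)$ of bounded order, and is meromorphic at all cusps. Call $(A,B,C)$ a modular triple if $f_{A,B,C}(e^{2\pi i\tau})$ is modular of some weight $k\in\mathbb{R}$. Zagier's duality conjecture says that, for $A$ positive definite and $A,B,C$ rational, if $(A,B,C)$ is a modular triple, then so is its dual $(A^{-1},A^{-1}B,\tfrac12B^{\mathrm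 T}A^{-1}B-\tfrac r{24}-C)$. (1) For $|q|<1$ (and $q\ne0$ in the second identity), $$\sum_{i,j,k\ge0}\frac{q^{3i^2+3j^2+4k^2+2ij+4ik+4jk+2i+2j}}{(q^4;q^4)_i(q^4;q^4)_j(q^4;q^4)_k}=\frac13\frac{J_1^2J_4}{J_2}+\frac23\frac{J_2^2J_3J_{12}}{J_1J_4^2J_6},$$ $$\sum_{i,j,k\ge0}\frac{q^{3i^2+3j^2+4k^2+2ij+4ik+4jk+4i+4j+4k}}{(q^4;q^4)_i(q^4;q^4)_j(q^4;q^4)_k}=-\frac13q^{-1}\frac{J_1^2J_4}{J_2}+\frac13q^{-1}\frac{J_2^2J_3J_{12}}{J_1J_4^2J_6}.$$ (2) The functions $g_1=q^{1/6}J_1^2J_4/J_2$ and $g_0=q^{1/6}J_2^2J_3J_{12}/(J_1J_4^2J_6)$ are modular of weights $1$ and $0$, respectively. With $$A=\begin{pmatrix}3/2&1/2&1\\1/2&3/2&1\\1&1&2\end{pmatrix},\quad B_1=(\tfrac12,\tfrac12,0)^{\mathrm T},\quad B_2=(1,1,1)^{\mathrm T},$$ we have $f_{A,B_1,1/24}(q^4)=\frac13g_1+\frac23g_0$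 and $f_{A,B_2,7/24}(q^4)=-\frac13g_1+\frac13g_0$. (3) For $i=1,2$, all $C\in\mathbb{R}$ and all $k\in\mathbb{R}$, $f_{A,B_i,C}$ is not modular of weight $k$. (4) Let $$A^\star=A^{-1}=\begin{pmatrix}1&0&-1/2\\0&1&-1/2\\-1/2&-1/2&1\end{pmatrix},\quad B_1^\star=(\tfrac12,\tfrac12,-\tfrac12)^{\mathrm T},\quad B_2^\star=(\tfrac12,\tfrac12,0)^{\mathrm T}.$$ For $i=1,2$ the dual of $(A^\star,B_i^\star,\frac1{12})$ is $(A,B_i,C_i)$ with $C_1=\frac1{24}$ and $C_2=\frac7{24}$; the series $f_{A^\star,B_i^\star,1/12}$ converges and is modular of weight $0$, and $A^\star$ is positive definite. Hence $(A^\star,B_1^\star,\frac1{12})$ and $(A^\star,B_2^\star,\frac1{12})$ are counterexamples to Zagier's duality conjecture, and the conjecture is false. -/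

import Mathlib

open scoped UpperHalfPlane MatrixGroups Manifold

noncomputable section

/-- The finite `q`-shifted factorial `(a;q)_n = ∏_{k<n} (1 - a q^k)`. -/
def qPoch (a q : ℂ) (n : ℕ) : ℂ :=
  ∏ k ∈ Finset.range n, (1 - a * q ^ k)

/-- The infinite `q`-shifted factorial `(a;q)_∞ = ∏_{k≥0} (1 - a q^k)`, for `|q| < 1`. -/
def qPochInf (a q : ℂ) : ℂ :=
  ∏' k : ℕ, (1 - a * q ^ k)

/-- `J_m = (q^m;q^m)_∞`. -/
def qJ (m : ℕ) (q : ℂ) : ℂ :=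
  qPochInf (q ^ m) (q ^ m)

/-- `e(τ) = exp(2πiτ)`. The power `q^c` of `q = e(τ)` is `e(c τ)`. -/
def eExp (τ : ℂ) : ℂ :=
  Complex.exp (2 * Real.pi * Complex.I * τ)

/-- The exponent `½ nᵀAn + nᵀB + C`. -/
def nahmExponent {r : ℕ} (A : Matrix (Fin r) (Fin r) ℚ) (B : Fin r → ℚ) (C : ℝ)
    (n : Fin r → ℕ) : ℝ :=
  (1 / 2) * ∑ i, ∑ j, (n i : ℝ) * (A i j : ℝ) * (n j : ℝ) + ∑ i, (n i : ℝ) * (B i : ℝ) + C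

/-- The term of index `n` of the Nahm sum, with `q = e(τ)`. -/
def nahmTerm {r : ℕ} (A : Matrix (Fin r) (Fin r) ℚ) (B : Fin r → ℚ) (C : ℝ) (τ : ℂ)
    (n : Fin r → ℕ) : ℂ :=
  eExp ((nahmExponent A B C n : ℂ) * τ) / ∏ i, qPoch (eExp τ) (eExp τ) (n i)

/-- The Nahm sum `f_{A,B,C}(q)`, with `q = e(τ)`, as a function of `τ`. -/
def nahmSum {r : ℕ} (A : Matrix (Fin r) (Fin r) ℚ) (B : Fin r → ℚ) (C : ℝ) (τ : ℂ) : ℂ :=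
  ∑' n : Fin r → ℕ, nahmTerm A B C τ n

/-- `f` is a (weakly holomorphic) modular form of weight `k`: it is holomorphic on the upper half
plane, it satisfies `f(γτ) = ε(γ) (cτ+d)^k f(τ)` for all `γ` in some subgroup of finite index of
`SL(2,ℤ)`, where the `ε(γ)` are roots of unity of bounded order, and it is meromorphic (that is,
has at most exponential growth in `Im τ`) at every cusp.
For an integer `k` one can make `ε` trivial by shrinking the subgroup (if `f ≠ 0`); the roots of
unity are there so that half-integral weights are covered, with the principal power. -/
def IsModularForm (k : ℝ) (f : ℍ → ℂ) : Prop :=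
  MDifferentiable 𝓘(ℂ) 𝓘(ℂ) f ∧
  (∃ Γ : Subgroup SL(2, ℤ), Γ.FiniteIndex ∧ ∃ N : ℕ, 0 < N ∧
    ∀ γ ∈ Γ, ∃ ε : ℂ, ε ^ N = 1 ∧
      ∀ τ : ℍ, f (γ • τ) = ε * (UpperHalfPlane.denom γ τ) ^ (k : ℂ) * f τ) ∧
  ∀ γ : SL(2, ℤ), ∃ M : ℝ,
    (fun τ : ℍ => (UpperHalfPlane.denom γ τ) ^ (-k : ℂ) * f (γ • τ))
      =O[UpperHalfPlane.atImInfty] fun τ : ℍ => Real.exp (M * τ.im)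

/-- `(A,B,C)` is a modular triple if `f_{A,B,C}` is modular (of some weight). -/
def IsModularTriple {r : ℕ} (A : Matrix (Fin r) (Fin r) ℚ) (B : Fin r → ℚ) (C : ℝ) : Prop :=
  ∃ k : ℝ, IsModularForm k fun τ : ℍ => nahmSum A B C τ

/-- The vector `B⋆ = A⁻¹B`. -/
def dualVector {r : ℕ} (A : Matrix (Fin r) (Fin r) ℚ) (B : Fin r → ℚ) : Fin r → ℚ :=
  Matrix.mulVec A⁻¹ B

/-- The scalar `C⋆ = ½ BᵀA⁻¹B - r/24 - C`. -/
def dualScalar {r : ℕ} (A : Matrix (Fin r) (Fin r) ℚ) (B : Fin r → ℚ) (C : ℚ) : ℚ :=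
  (1 / 2) * dotProduct B (Matrix.mulVec A⁻¹ B) - (r : ℚ) / 24 - C

/-- A counterexample to the duality conjecture: a modular triple `(A,B,C)`, with `A` positive
definite, whose dual `(A⁻¹, A⁻¹B, ½ BᵀA⁻¹B - r/24 - C)` is not a modular triple. -/
def IsDualityCounterexample {r : ℕ} (A : Matrix (Fin r) (Fin r) ℚ) (B : Fin r → ℚ) (C : ℚ) :
    Prop :=
  (A.map (fun x : ℚ => (x : ℝ))).PosDef ∧ IsModularTriple A B C ∧
    ¬ IsModularTriple A⁻¹ (dualVector A B) (dualScalar A B C)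

/-- Zagier's duality conjecture: for positive definite rational `A` and rational `B`, `C`, the dual
of a modular triple is a modular triple. -/
def ZagierDualityConjecture : Prop :=
  ∀ (r : ℕ) (A : Matrix (Fin r) (Fin r) ℚ) (B : Fin r → ℚ) (C : ℚ),
    (A.map (fun x : ℚ => (x : ℝ))).PosDef → IsModularTriple A B C →
      IsModularTriple A⁻¹ (dualVector A B) (dualScalar A B C)

/-- The matrix `A` of the two Nahm sums, the lift of `(3/2, -1/2; -1/2, 3/2)`. -/
def matA : Matrix (Fin 3) (Fin 3) ℚ :=
  !![3/2, 1/2, 1; 1/2, 3/2, 1; 1, 1, 2]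

/-- The matrix `A⋆ = A⁻¹` of the dual Nahm sums. -/
def matAStar : Matrix (Fin 3) (Fin 3) ℚ :=
  !![1, 0, -1/2; 0, 1, -1/2; -1/2, -1/2, 1]

/-- `q^{1/6} J_1² J_4 / J_2` with `q = e(τ)`. -/
def formOne (τ : ℂ) : ℂ :=
  eExp (τ / 6) * (qJ 1 (eExp τ) ^ 2 * qJ 4 (eExp τ) / qJ 2 (eExp τ))

/-- `q^{1/6} J_2² J_3 J_12 / (J_1 J_4² J_6)` with `q = e(τ)`. -/
def formZero (τ : ℂ) : ℂ :=
  eExp (τ / 6) * (qJ 2 (eExp τ) ^ 2 * qJ 3 (eExp τ) * qJ 12 (eExp τ) /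
    (qJ 1 (eExp τ) * qJ 4 (eExp τ) ^ 2 * qJ 6 (eExp τ)))

end

/-!
# A counterexample to the duality conjecture for modular Nahm sums

All `q`-series identities come from one summation, the limiting case `hasSum_heineTerm` of Heine's
`q`-Gauss sum. It contains Euler's expansion, Cauchy's identity, a terminating `q`-Vandermonde sum,
and through these the Jacobi triple product `hasSum_tripleProduct` and Jacobi's identity
`hasSum_jacobi_cube`.

*The sums attached to `A`.* A series with the quadratic form of `A`, with a weight and a linear term
depending on `i - j` only, is `1 / J₄` times a theta series `∑ w(d) q^{3d²+2d}` (`tsum_base_eq`).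
The linear terms in question are not of this form. The rearrangement `hasSum_antisymmetric` trades
such a series, without weight, for one with a linear term of the right form and with the weight
`i - j`. Thus both the theta series `∑ q^{3d²+2d}`, of weight `1/2`, and `∑ (3d+1) q^{3d²+2d}`, of
weight `3/2`, enter; after division by `J₄` this produces a mixture of weights `0` and `1`. The
weighted theta series are derivatives of the quintuple product (`quintuple_derivative`).

*The sums attached to `A⋆`.* The same rearrangement, Euler's expansion and Heine's sum yield a
series over `d ∈ ℤ` with weight `d` (`hasSum_dual_theta`). By quasi-periodicity the even and the odd
`d` give two weighted theta series. Here the contributions of weight `3/2` are multiples of `J₂³` in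
`p = q^{1/2}` and cancel, so that two eta quotients of weight `0` remain (`tsum_dual_zero`,
`tsum_dual_one`).

*Modularity.* The class `EtaLike` records what the identity `η²⁴ = Δ` and the modularity of `Δ` say
about rescaled eta functions (`etaLike_etaScale`): the 24th power transforms under `Γ(24)`, and the
growth at each cusp is found from a factorization `(r 0; 0 s) γ = σ (A B; 0 D)`. The function itself
then transforms with a multiplier that is locally constant, being a 24th root of unity. A sum of two
functions of weight `0` is modular, because each is invariant under the kernel of its multiplier.

*Failure of modularity.* After `q ↦ q⁴` the sums attached to `A` are `α g₁ + β g₀` up to a power of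
`q`, with `|α| = 1/3`, and their own expansion at `i∞` has leading coefficient `1`. Let `τ` tend to
`i∞` along the imaginary axis and apply a matrix `(1 0; c 1)` under which everything transforms. The
part of weight `1` dominates and has size `|α| |cτ + 1| e^{-π y / 3}`, where `y = Im τ`, while
modularity of weight `k` predicts the size `|cτ + 1|^k e^{-8π C y}` with coefficient `1`. A
comparison forces the exponents to agree, and then `1/3 = 1` (`not_isModularForm_of_mixed_weight`).
-/

noncomputable section

open Filter Topology Finset

lemma HasSum.of_eq {ι : Type*} {f g : ι → ℂ} {a : ℂ} (h : HasSum g a) (e : ∀ i, f i = g i) :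
    HasSum f a :=
  (funext e : f = g) ▸ h

/-! ### Finite and infinite `q`-shifted factorials -/

lemma one_sub_mul_pow_ne_zero {a q : ℂ} (ha : ‖a‖ < 1) (hq : ‖q‖ < 1) (k : ℕ) :
    1 - a * q ^ k ≠ 0 := by
  intro h
  have h1 : ‖a * q ^ k‖ = 1 := by rw [← sub_eq_zero.mp h]; simp
  have h2 : ‖a * q ^ k‖ ≤ ‖a‖ := by
    rw [norm_mul, norm_pow]
    exact mul_le_of_le_one_right (norm_nonneg _) (pow_le_one₀ (norm_nonneg _) hq.le)
  linarith

lemma qPoch_succ (a q : ℂ) (n : ℕ) : qPoch a q (n + 1) = qPoch a q n * (1 - a * q ^ n) := by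
  simp [qPoch, prod_range_succ]

lemma qPoch_self_succ (q : ℂ) (n : ℕ) :
    qPoch q q (n + 1) = qPoch q q n * (1 - q ^ (n + 1)) := by
  rw [qPoch_succ, pow_succ']

lemma qPoch_ne_zero {a q : ℂ} (ha : ‖a‖ < 1) (hq : ‖q‖ < 1) (n : ℕ) : qPoch a q n ≠ 0 :=
  prod_ne_zero_iff.mpr fun k _ => one_sub_mul_pow_ne_zero ha hq k

lemma qPoch_self_add (q : ℂ) (d n : ℕ) :
    qPoch q q (d + n) = qPoch q q d * qPoch (q ^ (d + 1)) q n := by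
  simp only [qPoch, prod_range_add]
  congr 1
  exact prod_congr rfl fun k _ => by ring

lemma summable_mul_pow (a : ℂ) {q : ℂ} (hq : ‖q‖ < 1) : Summable fun k : ℕ => ‖-(a * q ^ k)‖ := by
  simp only [norm_neg, norm_mul, norm_pow]
  exact (summable_geometric_of_lt_one (norm_nonneg _) hq).mul_left _

lemma multipliable_qPochInf (a : ℂ) {q : ℂ} (hq : ‖q‖ < 1) :
    Multipliable fun k : ℕ => 1 - a * q ^ k := by
  simpa [sub_eq_add_neg] using multipliable_one_add_of_summable (summable_mul_pow a hq)

lemma qPochInf_ne_zero {a q : ℂ} (ha : ‖a‖ < 1) (hq : ‖q‖ < 1) : qPochInf a q ≠ 0 := by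
  have := tprod_one_add_ne_zero_of_summable (f := fun k : ℕ => -(a * q ^ k))
    (fun k => by simpa [sub_eq_add_neg] using one_sub_mul_pow_ne_zero ha hq k)
    (summable_mul_pow a hq)
  simpa [qPochInf, sub_eq_add_neg] using this

lemma tendsto_qPoch (a : ℂ) {q : ℂ} (hq : ‖q‖ < 1) :
    Tendsto (qPoch a q) atTop (𝓝 (qPochInf a q)) :=
  (multipliable_qPochInf a hq).hasProd.tendsto_prod_nat

lemma qPochInf_zero_left (q : ℂ) : qPochInf 0 q = 1 := by simp [qPochInf]

lemma qPochInf_eq_mul (a : ℂ) {q : ℂ} (hq : ‖q‖ < 1) (n : ℕ) :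
    qPochInf a q = qPoch a q n * qPochInf (a * q ^ n) q := by
  refine tendsto_nhds_unique ((tendsto_add_atTop_iff_nat n).mpr (tendsto_qPoch a hq)) ?_
  have : ∀ m, qPoch a q (m + n) = qPoch a q n * qPoch (a * q ^ n) q m := by
    intro m
    rw [add_comm]
    simp only [qPoch, prod_range_add]
    congr 1
    exact prod_congr rfl fun k _ => by ring
  simp_rw [this]
  exact (tendsto_qPoch _ hq).const_mul _

lemma qPochInf_succ (a : ℂ) {q : ℂ} (hq : ‖q‖ < 1) :
    qPochInf a q = (1 - a) * qPochInf (a * q) q := by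
  simpa [qPoch] using qPochInf_eq_mul a hq 1

lemma qPochInf_one {q : ℂ} (hq : ‖q‖ < 1) : qPochInf 1 q = 0 := by
  rw [qPochInf_succ 1 hq]; simp

lemma norm_pow_lt_one {q : ℂ} (hq : ‖q‖ < 1) {m : ℕ} (hm : m ≠ 0) : ‖q ^ m‖ < 1 := by
  rw [norm_pow]; exact pow_lt_one₀ (norm_nonneg _) hq hm

lemma qPochInf_mul_neg (a : ℂ) {q : ℂ} (hq : ‖q‖ < 1) :
    qPochInf a q * qPochInf (-a) q = qPochInf (a ^ 2) (q ^ 2) := by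
  rw [qPochInf, qPochInf, qPochInf,
    ← (multipliable_qPochInf a hq).tprod_mul (multipliable_qPochInf (-a) hq)]
  exact tprod_congr fun k => by ring

/-- Splitting the factors of `(a;q)_∞` by the residue of the index modulo `m`. -/
lemma qPochInf_eq_prod (a : ℂ) {q : ℂ} (hq : ‖q‖ < 1) {m : ℕ} (hm : m ≠ 0) :
    qPochInf a q = ∏ r ∈ range m, qPochInf (a * q ^ r) (q ^ m) := by
  have hqm := norm_pow_lt_one hq hm
  have h1 : Tendsto (fun n => qPoch a q (n * m)) atTop (𝓝 (qPochInf a q)) :=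
    (tendsto_qPoch a hq).comp (tendsto_id.atTop_mul_const' (Nat.pos_of_ne_zero hm))
  have h2 : Tendsto (fun n => ∏ r ∈ range m, qPoch (a * q ^ r) (q ^ m) n) atTop
      (𝓝 (∏ r ∈ range m, qPochInf (a * q ^ r) (q ^ m))) :=
    tendsto_finsetProd _ fun r _ => tendsto_qPoch _ hqm
  refine tendsto_nhds_unique h1 (h2.congr fun n => ?_)
  induction n with
  | zero => simp [qPoch]
  | succ n ih =>
    simp_rw [qPoch_succ, prod_mul_distrib, ih, Nat.succ_mul]
    simp only [qPoch, prod_range_add]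
    congr 1
    exact prod_congr rfl fun r _ => by ring

/-- A bound for `1/(q;q)_n` that is uniform in `n` and in the disc `‖q‖ ≤ r`, as dominated
convergence for `q → 0` requires. -/
lemma norm_inv_qPoch_le {r : ℝ} (hr0 : 0 ≤ r) (hr : r < 1) {q : ℂ} (hq : ‖q‖ ≤ r) (n : ℕ) :
    ‖(qPoch q q n)⁻¹‖ ≤ Real.exp ((1 - r)⁻¹ * (1 - r)⁻¹) := by
  have hr' : 0 < 1 - r := by linarith
  have key : ∀ k : ℕ, ‖(1 - q * q ^ k)⁻¹‖ ≤ Real.exp (r ^ k * (1 - r)⁻¹) := by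
    intro k
    have h0 : ‖q * q ^ k‖ ≤ r ^ (k + 1) := by
      rw [← pow_succ', norm_pow]; exact pow_le_pow_left₀ (norm_nonneg _) hq _
    have h2 : r ^ (k + 1) ≤ r := by
      rw [pow_succ]; exact mul_le_of_le_one_left hr0 (pow_le_one₀ hr0 hr.le)
    have h3 : r ^ (k + 1) ≤ r ^ k := pow_le_pow_of_le_one hr0 hr.le (Nat.le_succ k)
    have h1 : 1 - r ^ (k + 1) ≤ ‖1 - q * q ^ k‖ := by
      have := norm_sub_norm_le (1 : ℂ) (q * q ^ k)
      rw [norm_one] at this; linarith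
    rw [norm_inv]
    have h4 : 0 < 1 - r ^ (k + 1) := by linarith
    calc ‖1 - q * q ^ k‖⁻¹ ≤ (1 - r ^ (k + 1))⁻¹ := inv_anti₀ h4 h1
      _ ≤ r ^ k * (1 - r)⁻¹ + 1 := by
        rw [inv_le_iff_one_le_mul₀ h4]
        have h5 : (1 - r) * (1 - r)⁻¹ = 1 := mul_inv_cancel₀ hr'.ne'
        have h6 : r ^ k ≤ r ^ k * (1 - r)⁻¹ * (1 - r ^ (k + 1)) := by
          have : r ^ k * (1 - r)⁻¹ * (1 - r) ≤ r ^ k * (1 - r)⁻¹ * (1 - r ^ (k + 1)) := by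
            have : 0 ≤ r ^ k * (1 - r)⁻¹ := by positivity
            exact mul_le_mul_of_nonneg_left (by linarith) this
          rw [mul_assoc, mul_comm _ (1 - r), h5, mul_one] at this
          exact this
        nlinarith
      _ ≤ _ := Real.add_one_le_exp _
  rw [qPoch, ← prod_inv_distrib, norm_prod]
  calc ∏ k ∈ range n, ‖(1 - q * q ^ k)⁻¹‖ ≤ ∏ k ∈ range n, Real.exp (r ^ k * (1 - r)⁻¹) :=
        prod_le_prod (fun _ _ => norm_nonneg _) fun k _ => key k
    _ = Real.exp ((∑ k ∈ range n, r ^ k) * (1 - r)⁻¹) := by rw [← Real.exp_sum, sum_mul]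
    _ ≤ _ := by
      apply Real.exp_le_exp.mpr
      refine mul_le_mul_of_nonneg_right ?_ (inv_nonneg.mpr hr'.le)
      rw [← tsum_geometric_of_lt_one hr0 hr]
      exact (summable_geometric_of_lt_one hr0 hr).sum_le_tsum _ fun k _ => by positivity

lemma exists_norm_inv_qPoch_le {q : ℂ} (hq : ‖q‖ < 1) :
    ∃ K : ℝ, 0 < K ∧ ∀ n, ‖(qPoch q q n)⁻¹‖ ≤ K :=
  ⟨_, Real.exp_pos _, norm_inv_qPoch_le (norm_nonneg q) hq le_rfl⟩

/-! ### The limiting case of Heine's summation -/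

/-- The general term of the series `₁φ₁`, in the polynomial normalization
`(-1)^j q^{j(j-1)/2} ∏_{l<j} (x - c q^l) / ((q;q)_j (c;q)_j)`. -/
def heineTerm (c q x : ℂ) (j : ℕ) : ℂ :=
  (-1) ^ j * q ^ (j.choose 2) * (∏ l ∈ range j, (x - c * q ^ l)) / (qPoch q q j * qPoch c q j)

lemma heineTerm_zero (c q x : ℂ) : heineTerm c q x 0 = 1 := by simp [heineTerm, qPoch]

lemma heineTerm_succ {c q : ℂ} (hc : ‖c‖ < 1) (hq : ‖q‖ < 1) (x : ℂ) (j : ℕ) :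
    heineTerm c q x (j + 1) =
      heineTerm c q x j * (-(q ^ j * (x - c * q ^ j)) / ((1 - q ^ (j + 1)) * (1 - c * q ^ j))) := by
  have h1 := qPoch_ne_zero hq hq j
  have h2 := qPoch_ne_zero hc hq j
  have h3 := one_sub_mul_pow_ne_zero hc hq j
  have h4 := one_sub_mul_pow_ne_zero hq hq j
  rw [← pow_succ'] at h4
  have hch : (j + 1).choose 2 = j + j.choose 2 := by
    rw [Nat.choose_succ_succ' j 1, Nat.choose_one_right]
  rw [heineTerm, heineTerm, qPoch_self_succ, qPoch_succ, prod_range_succ, hch]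
  field_simp
  ring

/-- The factor `q^{j(j-1)/2}` makes the series converge for every `x`, locally uniformly in `x`. -/
lemma norm_heineTerm_le {c q x : ℂ} (hc : ‖c‖ < 1) (hq : ‖q‖ < 1) {X : ℝ} (hx : ‖x‖ ≤ X) (j : ℕ) :
    ‖heineTerm c q x j‖ ≤
      ((X + 1) / ((1 - ‖q‖) * (1 - ‖c‖))) ^ j * ‖q‖ ^ (j.choose 2) := by
  have hX : 0 ≤ X := (norm_nonneg x).trans hx
  have hc' : 0 < 1 - ‖c‖ := by linarith
  have hq' : 0 < 1 - ‖q‖ := by linarith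
  induction j with
  | zero => simp [heineTerm_zero]
  | succ j ih =>
    have hch : (j + 1).choose 2 = j + j.choose 2 := by
      rw [Nat.choose_succ_succ' j 1, Nat.choose_one_right]
    rw [heineTerm_succ hc hq, norm_mul, hch]
    have hqj : ‖q‖ ^ j ≤ 1 := pow_le_one₀ (norm_nonneg _) hq.le
    have e1 : 1 - ‖c‖ ≤ ‖1 - c * q ^ j‖ := by
      have := norm_sub_norm_le (1 : ℂ) (c * q ^ j)
      rw [norm_one, norm_mul, norm_pow] at this
      nlinarith [norm_nonneg c]
    have e2 : 1 - ‖q‖ ≤ ‖1 - q ^ (j + 1)‖ := by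
      have := norm_sub_norm_le (1 : ℂ) (q ^ (j + 1))
      rw [norm_one, norm_pow, pow_succ] at this
      nlinarith [norm_nonneg q]
    have e3 : ‖x - c * q ^ j‖ ≤ X + 1 := by
      have := norm_sub_le x (c * q ^ j)
      rw [norm_mul, norm_pow] at this
      nlinarith [norm_nonneg c]
    have e4 : ‖-(q ^ j * (x - c * q ^ j)) / ((1 - q ^ (j + 1)) * (1 - c * q ^ j))‖ ≤
        (X + 1) / ((1 - ‖q‖) * (1 - ‖c‖)) * ‖q‖ ^ j := by
      rw [norm_div, norm_neg, norm_mul, norm_mul, norm_pow, mul_comm (‖q‖ ^ j), mul_div_right_comm]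
      gcongr
    calc _ ≤ ((X + 1) / ((1 - ‖q‖) * (1 - ‖c‖))) ^ j * ‖q‖ ^ (j.choose 2) *
          ((X + 1) / ((1 - ‖q‖) * (1 - ‖c‖)) * ‖q‖ ^ j) :=
          mul_le_mul ih e4 (norm_nonneg _) (by positivity)
      _ = _ := by rw [pow_succ, pow_add]; ring

lemma summable_pow_mul_pow_choose (K : ℝ) {r : ℝ} (hr0 : 0 ≤ r) (hr : r < 1) :
    Summable fun j : ℕ => K ^ j * r ^ (j.choose 2) := by
  have ht : Tendsto (fun j : ℕ => |K| * r ^ j) atTop (𝓝 0) := by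
    simpa using (tendsto_pow_atTop_nhds_zero_of_lt_one hr0 hr).const_mul |K|
  refine summable_of_ratio_norm_eventually_le (r := 1 / 2) (by norm_num) ?_
  filter_upwards [ht.eventually_le_const (by norm_num : (0 : ℝ) < 1 / 2)] with j hj
  have hch : (j + 1).choose 2 = j + j.choose 2 := by
    rw [Nat.choose_succ_succ' j 1, Nat.choose_one_right]
  have : K ^ (j + 1) * r ^ ((j + 1).choose 2) = (K * r ^ j) * (K ^ j * r ^ (j.choose 2)) := by
    rw [hch, pow_succ, pow_add]; ring
  rw [this, norm_mul]
  refine mul_le_mul_of_nonneg_right ?_ (norm_nonneg _)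
  rw [norm_mul, Real.norm_eq_abs, Real.norm_of_nonneg (pow_nonneg hr0 j)]
  exact hj

lemma summable_heineTerm {c q : ℂ} (hc : ‖c‖ < 1) (hq : ‖q‖ < 1) (x : ℂ) :
    Summable (heineTerm c q x) :=
  Summable.of_norm_bounded (summable_pow_mul_pow_choose _ (norm_nonneg q) hq)
    (norm_heineTerm_le hc hq le_rfl)

/-- The functional equation relating the arguments `x` and `x q`, in the form of a telescoping
sum. -/
lemma sum_heineTerm_sub {c q : ℂ} (hc : ‖c‖ < 1) (hq : ‖q‖ < 1) (x : ℂ) (n : ℕ) :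
    ∑ j ∈ range (n + 1), (heineTerm c q x j - (1 - x) * heineTerm c q (x * q) j) =
      x * q ^ n * heineTerm c q x n := by
  have key : ∀ n, heineTerm c q (x * q) (n + 1) = heineTerm c q x n *
      (-(q ^ n * (q * x - c) * q ^ n) / ((1 - q ^ (n + 1)) * (1 - c * q ^ n))) := by
    intro n
    have h1 := qPoch_ne_zero hq hq n
    have h2 := qPoch_ne_zero hc hq n
    have h3 := one_sub_mul_pow_ne_zero hc hq n
    have h4 := one_sub_mul_pow_ne_zero hq hq n
    rw [← pow_succ'] at h4
    have hch : (n + 1).choose 2 = n + n.choose 2 := by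
      rw [Nat.choose_succ_succ' n 1, Nat.choose_one_right]
    have hp : ∏ l ∈ range (n + 1), (x * q - c * q ^ l) =
        (q * x - c) * q ^ n * ∏ l ∈ range n, (x - c * q ^ l) := by
      rw [prod_range_succ', mul_comm]
      have : ∀ l ∈ range n, (x * q - c * q ^ (l + 1)) = q * (x - c * q ^ l) := fun l _ => by ring
      rw [prod_congr rfl this, prod_mul_distrib, prod_const, card_range]
      ring
    rw [heineTerm, heineTerm, qPoch_self_succ, qPoch_succ, hp, hch]
    field_simp
    ring
  induction n with
  | zero => simp [heineTerm_zero]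
  | succ n ih =>
    have h3 := one_sub_mul_pow_ne_zero hc hq n
    have h4 := one_sub_mul_pow_ne_zero hq hq n
    rw [← pow_succ'] at h4
    rw [sum_range_succ, ih, key, heineTerm_succ hc hq]
    obtain ⟨D, hD⟩ : ∃ D, D = 1 - c * q ^ n := ⟨_, rfl⟩
    obtain ⟨E, hE⟩ : ∃ E, E = 1 - q ^ (n + 1) := ⟨_, rfl⟩
    rw [← hD] at h3 ⊢
    rw [← hE] at h4 ⊢
    field_simp
    rw [hD, hE]
    ring

lemma tsum_heineTerm_eq {c q : ℂ} (hc : ‖c‖ < 1) (hq : ‖q‖ < 1) (x : ℂ) :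
    ∑' j, heineTerm c q x j = (1 - x) * ∑' j, heineTerm c q (x * q) j := by
  have hs := summable_heineTerm hc hq x
  have hs' := (summable_heineTerm hc hq (x * q)).mul_left (1 - x)
  rw [← tsum_mul_left, ← sub_eq_zero, ← hs.tsum_sub hs']
  have h1 := ((hs.sub hs').hasSum.tendsto_sum_nat).comp (tendsto_add_atTop_nat 1)
  have h2 : Tendsto (fun n => x * q ^ n * heineTerm c q x n) atTop (𝓝 0) := by
    simpa using ((tendsto_pow_atTop_nhds_zero_of_norm_lt_one hq).const_mul x).mul
      hs.tendsto_atTop_zero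
  exact tendsto_nhds_unique h1 (h2.congr fun n => (sum_heineTerm_sub hc hq x n).symm)

/-- Iterating the functional equation moves the argument `x` to `0`. -/
lemma tsum_heineTerm_eq_mul {c q : ℂ} (hc : ‖c‖ < 1) (hq : ‖q‖ < 1) (x : ℂ) :
    ∑' j, heineTerm c q x j = qPochInf x q * ∑' j, heineTerm c q 0 j := by
  have h1 : ∀ n, ∑' j, heineTerm c q x j = qPoch x q n * ∑' j, heineTerm c q (x * q ^ n) j := by
    intro n
    induction n with
    | zero => simp [qPoch]
    | succ n ih => rw [ih, tsum_heineTerm_eq hc hq, qPoch_succ, pow_succ]; ring_nf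
  have hx : Tendsto (fun n => x * q ^ n) atTop (𝓝 0) := by
    simpa using (tendsto_pow_atTop_nhds_zero_of_norm_lt_one hq).const_mul x
  have h2 : Tendsto (fun n => ∑' j, heineTerm c q (x * q ^ n) j) atTop
      (𝓝 (∑' j, heineTerm c q 0 j)) := by
    refine tendsto_tsum_of_dominated_convergence
      (summable_pow_mul_pow_choose ((‖x‖ + 1) / ((1 - ‖q‖) * (1 - ‖c‖))) (norm_nonneg q) hq)
      (fun j => ?_) (Eventually.of_forall fun n j => norm_heineTerm_le hc hq ?_ j)
    · have : Continuous fun y => heineTerm c q y j := by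
        unfold heineTerm; fun_prop
      exact (this.tendsto 0).comp hx
    · rw [norm_mul, norm_pow]
      exact mul_le_of_le_one_right (norm_nonneg _) (pow_le_one₀ (norm_nonneg _) hq.le)
  exact tendsto_nhds_unique (tendsto_const_nhds.congr h1) ((tendsto_qPoch x hq).mul h2)

/-- The limiting case `b → ∞` of Heine's `q`-Gauss sum. It contains Euler's expansion (`c = 0`),
Cauchy's identity (`x = 0`) and a `q`-Vandermonde sum (`x = c q^n`). -/
theorem hasSum_heineTerm {c q : ℂ} (hc : ‖c‖ < 1) (hq : ‖q‖ < 1) (x : ℂ) :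
    HasSum (heineTerm c q x) (qPochInf x q / qPochInf c q) := by
  have h1 := tsum_heineTerm_eq_mul hc hq c
  -- at `x = c` only the term of index `0` survives, which gives the value at `x = 0`
  have h2 : ∑' j, heineTerm c q c j = 1 := by
    rw [tsum_eq_single 0, heineTerm_zero]
    intro j hj
    have : ∏ l ∈ range j, (c - c * q ^ l) = 0 :=
      prod_eq_zero (mem_range.mpr (Nat.pos_of_ne_zero hj)) (by simp)
    simp [heineTerm, this]
  have h3 := qPochInf_ne_zero hc hq
  have h4 : ∑' j, heineTerm c q 0 j = (qPochInf c q)⁻¹ := by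
    rw [h2] at h1; exact eq_inv_of_mul_eq_one_right h1.symm
  have := (summable_heineTerm hc hq x).hasSum
  rwa [tsum_heineTerm_eq_mul hc hq x, h4, ← div_eq_mul_inv] at this

/-- Euler's expansion of `(x;q)_∞`. -/
theorem hasSum_euler {q : ℂ} (hq : ‖q‖ < 1) (x : ℂ) :
    HasSum (fun j : ℕ => (-1) ^ j * q ^ (j.choose 2) * x ^ j / qPoch q q j) (qPochInf x q) := by
  have := hasSum_heineTerm (c := 0) (by simp) hq x
  rw [qPochInf_zero_left, div_one] at this
  refine this.of_eq fun j => ?_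
  simp [heineTerm, qPoch]

lemma sq_eq_choose_two (n : ℕ) : n ^ 2 = 2 * n.choose 2 + n := by
  induction n with
  | zero => rfl
  | succ n ih =>
    rw [Nat.choose_succ_succ' n 1, Nat.choose_one_right]
    nlinarith

lemma qPochInf_self_eq {q : ℂ} (hq : ‖q‖ < 1) (d : ℕ) :
    qPochInf q q = qPoch q q d * qPochInf (q ^ (d + 1)) q := by
  rw [pow_succ', qPochInf_eq_mul q hq d]

/-- Cauchy's identity for Durfee rectangles. -/
theorem hasSum_cauchy {q : ℂ} (hq : ‖q‖ < 1) (d : ℕ) :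
    HasSum (fun n : ℕ => q ^ (n ^ 2 + n * d) / (qPoch q q (n + d) * qPoch q q n))
      (qPochInf q q)⁻¹ := by
  have hc := norm_pow_lt_one hq (Nat.succ_ne_zero d)
  have h := (hasSum_heineTerm hc hq 0).mul_left (qPoch q q d)⁻¹
  have h0 := qPoch_ne_zero hq hq d
  rw [qPochInf_zero_left, one_div, ← mul_inv, ← qPochInf_self_eq hq] at h
  refine h.of_eq fun n => ?_
  have h1 := qPoch_ne_zero hq hq n
  have h2 := qPoch_ne_zero hc hq n
  have hp : ∏ l ∈ range n, (0 - q ^ (d + 1) * q ^ l) =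
      (-1) ^ n * (q ^ ((d + 1) * n) * q ^ n.choose 2) := by
    have : ∀ l ∈ range n, (0 - q ^ (d + 1) * q ^ l) = (-1) * (q ^ (d + 1) * q ^ l) :=
      fun l _ => by ring
    rw [prod_congr rfl this, prod_mul_distrib, prod_mul_distrib, prod_const, prod_const,
      card_range, prod_pow_eq_pow_sum, sum_range_id, ← Nat.choose_two_right, pow_mul]
  rw [heineTerm, hp, add_comm n d, qPoch_self_add]
  have h3 : ((-1 : ℂ) ^ n) * (-1) ^ n = 1 := by rw [← mul_pow]; simp
  have h4 : q ^ (n ^ 2 + n * d) = q ^ n.choose 2 * (q ^ ((d + 1) * n) * q ^ n.choose 2) := by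
    rw [← pow_add, ← pow_add, sq_eq_choose_two]; congr 1; ring
  rw [h4]
  simp only [Nat.succ_eq_add_one]
  field_simp
  linear_combination (-(q ^ n.choose 2 * (q ^ ((d + 1) * n) * q ^ n.choose 2))) * h3

/-- A terminating `q`-Vandermonde sum: the Bailey-type step that lowers the number of
summations by one. -/
theorem sum_antidiagonal_vandermonde {q : ℂ} (hq : ‖q‖ < 1) (d n : ℕ) :
    ∑ p ∈ antidiagonal n,
        q ^ (p.1 ^ 2 + p.1 * d) / (qPoch q q (p.1 + d) * qPoch q q p.1 * qPoch q q p.2) =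
      (qPoch q q (n + d) * qPoch q q n)⁻¹ := by
  have hc := norm_pow_lt_one hq (Nat.succ_ne_zero d)
  have h := hasSum_heineTerm hc hq (q ^ (d + 1) * q ^ n)
  have h0 := qPoch_ne_zero hq hq d
  have hn := qPoch_ne_zero hq hq n
  have hcn := qPoch_ne_zero hc hq n
  have hinf : qPochInf (q ^ (d + 1) * q ^ n) q ≠ 0 := by
    rw [← pow_add]; exact qPochInf_ne_zero (norm_pow_lt_one hq (by lia)) hq
  rw [qPochInf_eq_mul (q ^ d.succ) hq n] at h
  have hs : ∑' j, heineTerm (q ^ (d + 1)) q (q ^ (d + 1) * q ^ n) j =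
      ∑ j ∈ range (n + 1), heineTerm (q ^ (d + 1)) q (q ^ (d + 1) * q ^ n) j := by
    refine tsum_eq_sum fun j hj => ?_
    have : ∏ l ∈ range j, (q ^ (d + 1) * q ^ n - q ^ (d + 1) * q ^ l) = 0 :=
      prod_eq_zero (i := n) (mem_range.mpr (by simpa using hj)) (by simp)
    simp [heineTerm, this]
  rw [Nat.sum_antidiagonal_eq_sum_range_succ_mk]
  have h5 : (qPoch q q (n + d) * qPoch q q n)⁻¹ = (qPoch q q d * qPoch q q n)⁻¹ *
      ∑ j ∈ range (n + 1), heineTerm (q ^ (d + 1)) q (q ^ (d + 1) * q ^ n) j := by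
    rw [← hs, h.tsum_eq, add_comm n d, qPoch_self_add]
    simp only [Nat.succ_eq_add_one]
    field_simp
  rw [h5, mul_sum]
  refine sum_congr rfl fun v hv => ?_
  have hvn : v ≤ n := by simpa [Nat.lt_succ_iff] using hv
  have h1 := qPoch_ne_zero hq hq v
  have h2 := qPoch_ne_zero hc hq v
  have h3 := qPoch_ne_zero hq hq (n - v)
  have hp : (∏ l ∈ range v, (q ^ (d + 1) * q ^ n - q ^ (d + 1) * q ^ l)) * qPoch q q (n - v) =
      (-1) ^ v * (q ^ ((d + 1) * v) * q ^ v.choose 2) * qPoch q q n := by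
    clear hv h1 h2 h3
    induction v with
    | zero => simp
    | succ v ih =>
      have hv : n - v = (n - (v + 1)) + 1 := by lia
      have ih := ih (by lia)
      have e : qPoch q q (n - v) = qPoch q q (n - (v + 1)) * (1 - q ^ (n - v)) := by
        conv_lhs => rw [hv, qPoch_self_succ, ← hv]
      have hch : (v + 1).choose 2 = v + v.choose 2 := by
        rw [Nat.choose_succ_succ' v 1, Nat.choose_one_right]
      have hq' : q ^ n = q ^ v * q ^ (n - v) := by rw [← pow_add]; congr 1; lia
      rw [e] at ih
      rw [prod_range_succ, hch]
      have e2 : (q ^ (d + 1) * q ^ n - q ^ (d + 1) * q ^ v) =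
          -(q ^ (d + 1) * q ^ v) * (1 - q ^ (n - v)) := by rw [hq']; ring
      rw [e2, Nat.mul_succ, pow_add q _ (d + 1), pow_add q v, pow_succ (-1 : ℂ)]
      linear_combination (-(q ^ (d + 1) * q ^ v)) * ih
  rw [heineTerm, add_comm v d, qPoch_self_add]
  have h3' : ((-1 : ℂ) ^ v) * (-1) ^ v = 1 := by rw [← mul_pow]; simp
  have h4 : q ^ (v ^ 2 + v * d) = q ^ v.choose 2 * (q ^ ((d + 1) * v) * q ^ v.choose 2) := by
    rw [← pow_add, ← pow_add, sq_eq_choose_two]; congr 1; ring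
  rw [h4, eq_comm, div_eq_mul_inv, div_eq_mul_inv]
  have hp' := (eq_mul_inv_iff_mul_eq₀ h3).mpr hp
  rw [hp']
  simp only [Nat.succ_eq_add_one] at *
  field_simp
  linear_combination (q ^ v.choose 2 * (q ^ ((d + 1) * v) * q ^ v.choose 2)) * h3'

/-! ### Rearranging multiple series -/

/-- Pairs of natural numbers, indexed by their difference and their minimum. -/
def diffMinEquiv : ℤ × ℕ ≃ ℕ × ℕ where
  toFun p := (p.2 + p.1.toNat, p.2 + (-p.1).toNat)
  invFun p := ((p.1 : ℤ) - p.2, min p.1 p.2)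
  left_inv p := by ext <;> (simp only; lia)
  right_inv p := by ext <;> simp <;> lia

lemma HasSum.by_difference {f : ℕ × ℕ → ℂ} {s : ℂ} (hf : HasSum f s) {g : ℤ → ℂ}
    (hg : ∀ d : ℤ, HasSum (fun v : ℕ => f (v + d.toNat, v + (-d).toNat)) (g d)) : HasSum g s :=
  HasSum.prod_fiberwise (diffMinEquiv.hasSum_iff.mpr hf) hg

/-- A triple series, summed first over the triples with a given difference of the first two
indices. -/
lemma HasSum.by_difference₃ {f : ℕ × ℕ × ℕ → ℂ} {s : ℂ} (hf : HasSum f s) {g : ℤ → ℂ}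
    (hg : ∀ d : ℤ,
      HasSum (fun p : ℕ × ℕ => f (p.1 + d.toNat, p.1 + (-d).toNat, p.2)) (g d)) : HasSum g s := by
  have h : HasSum (fun t : ℤ × ℕ × ℕ => f (t.2.1 + t.1.toNat, t.2.1 + (-t.1).toNat, t.2.2)) s :=
    (((Equiv.prodAssoc ℤ ℕ ℕ).symm.trans (diffMinEquiv.prodCongr (Equiv.refl ℕ))).trans
      (Equiv.prodAssoc ℕ ℕ ℕ)).hasSum_iff.mpr hf
  exact HasSum.prod_fiberwise h hg

lemma HasSum.by_antidiagonal {f : ℕ × ℕ → ℂ} {s : ℂ} (hf : HasSum f s) :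
    HasSum (fun n => ∑ p ∈ antidiagonal n, f p) s := by
  refine (Finset.HasAntidiagonal.sigmaAntidiagonalEquivProd.hasSum_iff.mpr hf).sigma fun n => ?_
  have := hasSum_fintype (fun p : antidiagonal n => f p)
  rwa [Finset.sum_coe_sort (antidiagonal n) f] at this

/-- A convergent series is zero if a permutation of the indices changes the signs of its terms. -/
lemma HasSum.eq_zero_of_odd {ι : Type*} {f : ι → ℂ} {s : ℂ} (hf : HasSum f s) (σ : ι ≃ ι)
    (h : ∀ t, f (σ t) = -f t) : s = 0 := by
  have h1 : HasSum (fun t => -f t) s := (σ.hasSum_iff.mpr hf).of_eq fun t => (h t).symm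
  exact self_eq_neg.mp (h1.unique hf.neg)

/-- Exchange of the first two indices of a triple. -/
def swapFirstTwo : ℕ × ℕ × ℕ ≃ ℕ × ℕ × ℕ where
  toFun t := (t.2.1, t.1, t.2.2)
  invFun t := (t.2.1, t.1, t.2.2)
  left_inv _ := rfl
  right_inv _ := rfl

lemma summable_succ_mul_pow {r : ℝ} (hr0 : 0 ≤ r) (hr : r < 1) :
    Summable fun n : ℕ => ((n : ℝ) + 1) * r ^ n := by
  have h1 := summable_pow_mul_geometric_of_norm_lt_one 1 (r := r) (by rwa [Real.norm_of_nonneg hr0])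
  have h2 := summable_geometric_of_lt_one hr0 hr
  exact (h1.add h2).congr fun n => by simp; ring

lemma summable_triple_bound {r : ℝ} (hr0 : 0 ≤ r) (hr : r < 1) :
    Summable fun t : ℕ × ℕ × ℕ =>
      (((t.1 : ℝ) + 1) * ((t.2.1 : ℝ) + 1)) * r ^ (t.1 + t.2.1 + t.2.2) := by
  have h1 := summable_succ_mul_pow hr0 hr
  have h2 := summable_geometric_of_lt_one hr0 hr
  have h3 := h1.mul_of_nonneg h2 (fun n => by positivity) (fun n => by positivity)
  have h4 := h1.mul_of_nonneg h3 (fun n => by positivity) (fun n => by positivity)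
  exact h4.congr fun t => by simp only [pow_add]; ring

lemma summable_mul_zpow {q : ℂ} (hq0 : q ≠ 0) (hq : ‖q‖ < 1) {K : ℝ} {w : ℕ × ℕ × ℕ → ℂ}
    (hw : ∀ t, ‖w t‖ ≤ K * (((t.1 : ℝ) + 1) * ((t.2.1 : ℝ) + 1))) {e : ℕ × ℕ × ℕ → ℤ} (L : ℤ)
    (he : ∀ i j k : ℕ, (i : ℤ) + j + k - L ≤ e (i, j, k)) :
    Summable fun t => w t * q ^ e t := by
  have hn : 0 < ‖q‖ := norm_pos_iff.mpr hq0
  refine Summable.of_norm_bounded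
    ((summable_triple_bound hn.le hq).mul_left (K * ‖q‖ ^ (-L))) fun t => ?_
  rw [norm_mul, norm_zpow]
  have h1 : ‖q‖ ^ e t ≤ ‖q‖ ^ (-L) * ‖q‖ ^ (t.1 + t.2.1 + t.2.2) := by
    rw [← zpow_natCast, ← zpow_add₀ hn.ne']
    refine zpow_le_zpow_right_of_le_one₀ hn hq.le ?_
    have := he t.1 t.2.1 t.2.2
    push_cast
    simp only [Prod.mk.eta] at this
    linarith
  calc ‖w t‖ * ‖q‖ ^ e t ≤ (K * (((t.1 : ℝ) + 1) * ((t.2.1 : ℝ) + 1))) *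
        (‖q‖ ^ (-L) * ‖q‖ ^ (t.1 + t.2.1 + t.2.2)) :=
        mul_le_mul (hw t) h1 (by positivity) ((norm_nonneg _).trans (hw t))
    _ = _ := by ring

/-- The reciprocal of `(Q;Q)_i (Q;Q)_j (Q;Q)_k`. -/
def invPoch (Q : ℂ) (t : ℕ × ℕ × ℕ) : ℂ :=
  (qPoch Q Q t.1 * qPoch Q Q t.2.1 * qPoch Q Q t.2.2)⁻¹

lemma exists_norm_invPoch_le {Q : ℂ} (hQ : ‖Q‖ < 1) :
    ∃ K : ℝ, ∀ t, ‖invPoch Q t‖ ≤ K * (((t.1 : ℝ) + 1) * ((t.2.1 : ℝ) + 1)) ∧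
      ‖((t.1 : ℂ) - t.2.1) * invPoch Q t‖ ≤ K * (((t.1 : ℝ) + 1) * ((t.2.1 : ℝ) + 1)) := by
  obtain ⟨K, hK, h⟩ := exists_norm_inv_qPoch_le hQ
  have key : ∀ t, ‖invPoch Q t‖ ≤ K * K * K := fun t => by
    rw [invPoch, mul_inv, mul_inv, norm_mul, norm_mul]
    gcongr <;> exact h _
  refine ⟨K * K * K, fun t => ⟨(key t).trans ?_, ?_⟩⟩
  · refine le_mul_of_one_le_right (by positivity) ?_
    have h1 : (0 : ℝ) ≤ t.1 := Nat.cast_nonneg _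
    have h2 : (0 : ℝ) ≤ t.2.1 := Nat.cast_nonneg _
    nlinarith
  · rw [norm_mul, mul_comm]
    refine mul_le_mul (key t) ?_ (norm_nonneg _) (by positivity)
    refine (norm_sub_le _ _).trans ?_
    simp only [Complex.norm_natCast]
    have h1 : (0 : ℝ) ≤ t.1 := Nat.cast_nonneg _
    have h2 : (0 : ℝ) ≤ t.2.1 := Nat.cast_nonneg _
    nlinarith

/-- All triple series below have exponents that grow at least linearly, so that they converge
absolutely, also with the weight `i - j`. -/
lemma summable_invPoch_mul_zpow {q Q : ℂ} (hq0 : q ≠ 0) (hq : ‖q‖ < 1) (hQ : ‖Q‖ < 1)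
    {e : ℕ × ℕ × ℕ → ℤ} (L : ℤ) (he : ∀ i j k : ℕ, (i : ℤ) + j + k - L ≤ e (i, j, k)) :
    Summable (fun t => invPoch Q t * q ^ e t) ∧
      Summable fun t => ((t.1 : ℂ) - t.2.1) * invPoch Q t * q ^ e t := by
  obtain ⟨K, hK⟩ := exists_norm_invPoch_le hQ
  exact ⟨summable_mul_zpow hq0 hq (fun t => (hK t).1) L he,
    summable_mul_zpow hq0 hq (fun t => (hK t).2) L he⟩

lemma HasSum.mul_prod {ι κ : Type*} {f : ι → ℂ} {g : κ → ℂ} {s t : ℂ} (hf : HasSum f s)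
    (hg : HasSum g t) :
    HasSum (fun x : ι × κ => f x.1 * g x.2) (s * t) :=
  hf.mul hg (summable_mul_of_summable_norm (f := f) (g := g) hf.summable.norm hg.summable.norm)

/-! ### The triple product and its derivative -/

/-- Cauchy's identity, as the sum over the pairs of natural numbers with difference `d`. -/
lemma hasSum_cauchy_nat {p : ℂ} (hp : ‖p‖ < 1) (d : ℕ) :
    HasSum (fun v : ℕ => p ^ ((v + d) ^ 2 + v ^ 2) /
      (qPoch (p ^ 2) (p ^ 2) (v + d) * qPoch (p ^ 2) (p ^ 2) v))
      (p ^ (d ^ 2) / qPochInf (p ^ 2) (p ^ 2)) := by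
  refine ((hasSum_cauchy (norm_pow_lt_one hp two_ne_zero) d).mul_left (p ^ (d ^ 2))).of_eq
    fun v => ?_
  rw [← pow_mul, ← mul_div_assoc, ← pow_add]
  congr 2; ring

lemma hasSum_cauchy_int {p : ℂ} (hp : ‖p‖ < 1) (d : ℤ) :
    HasSum (fun v : ℕ => p ^ ((v + d.toNat) ^ 2 + (v + (-d).toNat) ^ 2) /
      (qPoch (p ^ 2) (p ^ 2) (v + d.toNat) * qPoch (p ^ 2) (p ^ 2) (v + (-d).toNat)))
      (p ^ (d ^ 2) / qPochInf (p ^ 2) (p ^ 2)) := by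
  obtain ⟨n, rfl | rfl⟩ := d.eq_nat_or_neg
  · simpa using! hasSum_cauchy_nat hp n
  · refine HasSum.of_eq (by simpa using! hasSum_cauchy_nat hp n) fun v => ?_
    simp only [neg_neg, Int.toNat_natCast, Int.toNat_neg_natCast, add_zero]
    rw [add_comm, mul_comm (qPoch _ _ v)]

lemma pow_sq_mul_pow_eq {p z : ℂ} (j : ℕ) :
    (-1) ^ j * (p ^ 2) ^ (j.choose 2) * (-(z * p)) ^ j = p ^ (j ^ 2) * z ^ j := by
  have h3 : ((-1 : ℂ) ^ j) * (-1) ^ j = 1 := by rw [← mul_pow]; simp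
  rw [neg_pow (z * p), sq_eq_choose_two, pow_add, pow_mul, mul_pow]
  linear_combination (((p ^ 2) ^ (j.choose 2)) * z ^ j * p ^ j) * h3

/-- The Jacobi triple product: the product of two Euler expansions, summed along the lines of
constant difference by Cauchy's identity. -/
theorem hasSum_tripleProduct {p z : ℂ} (hp0 : p ≠ 0) (hp : ‖p‖ < 1) (hz : z ≠ 0) :
    HasSum (fun d : ℤ => p ^ (d ^ 2) * z ^ d)
      (qPochInf (p ^ 2) (p ^ 2) * qPochInf (-(z * p)) (p ^ 2) *
        qPochInf (-(z⁻¹ * p)) (p ^ 2)) := by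
  have hQ := norm_pow_lt_one hp two_ne_zero
  have h1 := hasSum_euler hQ (-(z * p))
  have h2 := hasSum_euler hQ (-(z⁻¹ * p))
  simp_rw [pow_sq_mul_pow_eq] at h1 h2
  have h3 := h1.mul_prod h2
  have h4 := h3.by_difference (g := fun d : ℤ => z ^ d * (p ^ (d ^ 2) / qPochInf (p ^ 2) (p ^ 2)))
    fun d => by
    refine ((hasSum_cauchy_int hp d).mul_left (z ^ d)).of_eq fun v => ?_
    have e : z ^ d = z ^ (v + d.toNat) * z⁻¹ ^ (v + (-d).toNat) := by
      rw [inv_pow, ← zpow_natCast, ← zpow_natCast, ← zpow_neg, ← zpow_add₀ hz]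
      congr 1; push_cast; lia
    rw [e, pow_add]; simp only; ring
  have h5 := qPochInf_ne_zero hQ hQ
  have h6 := h4.mul_left (qPochInf (p ^ 2) (p ^ 2))
  rw [← mul_assoc] at h6
  exact h6.of_eq fun d => by field_simp

lemma summable_natCast_mul_heineTerm {q : ℂ} (hq : ‖q‖ < 1) (x : ℂ) :
    Summable fun i : ℕ => (i : ℂ) * heineTerm 0 q x i := by
  refine Summable.of_norm_bounded (summable_pow_mul_pow_choose
    (2 * ((‖x‖ + 1) / ((1 - ‖q‖) * (1 - ‖(0 : ℂ)‖)))) (norm_nonneg q) hq) fun i => ?_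
  rw [norm_mul, mul_pow, mul_assoc, Complex.norm_natCast]
  refine mul_le_mul ?_ (norm_heineTerm_le (by simp) hq le_rfl i) (norm_nonneg _) (by positivity)
  exact_mod_cast Nat.lt_two_pow_self.le

/-- The derivative of `(x;q)_∞` at its zero `x = 1`, term by term. -/
lemma hasSum_natCast_mul_heineTerm_one {q : ℂ} (hq : ‖q‖ < 1) :
    HasSum (fun i : ℕ => (i : ℂ) * heineTerm 0 q 1 i) (-qPochInf q q) := by
  set a : ℕ → ℂ := heineTerm 0 q 1 with ha
  have hs : Summable fun i : ℕ => (i : ℂ) * a i := summable_natCast_mul_heineTerm hq 1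
  have hb : ∀ i : ℕ, heineTerm 0 q q i = q ^ i * a i := fun i => by
    simp only [ha, heineTerm, zero_mul, sub_zero, prod_const, card_range, one_pow]; ring
  have hs' : Summable fun i : ℕ => (i : ℂ) * (q ^ i * a i) :=
    (summable_natCast_mul_heineTerm hq q).congr fun i => by rw [hb]
  have he : HasSum (fun i : ℕ => q ^ i * a i) (qPochInf q q) := by
    have := hasSum_heineTerm (c := 0) (by simp) hq q
    rw [qPochInf_zero_left, div_one] at this
    exact this.of_eq fun i => (hb i).symm
  have hrec : ∀ i : ℕ, a (i + 1) = q ^ (i + 1) * a (i + 1) - q ^ i * a i := fun i => by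
    have h4 := one_sub_mul_pow_ne_zero hq hq i
    rw [← pow_succ'] at h4
    have := heineTerm_succ (c := 0) (by simp) hq 1 i
    simp only [zero_mul, sub_zero, mul_one, ← ha] at this
    rw [mul_div_assoc', eq_div_iff h4] at this
    linear_combination this
  have h1 := (hasSum_nat_add_iff' 1).mpr hs.hasSum
  have h2 := (hasSum_nat_add_iff' 1).mpr hs'.hasSum
  have h3 := h2.sub (hs'.hasSum.add he)
  simp only [sum_range_one, Nat.cast_zero, zero_mul, sub_zero] at h1 h3
  have h5 := h1.unique (h3.of_eq fun i => by
    have := hrec i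
    push_cast
    linear_combination ((i : ℂ) + 1) * this)
  have h6 := hs.hasSum
  rw [h5] at h6
  convert! h6 using 1
  ring

/-- Jacobi's identity for the cube of `(p²;p²)_∞`. It is the derivative of the triple product at a
zero; the proof repeats that of the triple product, with the derivative of one Euler expansion. -/
theorem hasSum_jacobi_cube {p : ℂ} (hp0 : p ≠ 0) (hp : ‖p‖ < 1) :
    HasSum (fun d : ℤ => (d : ℂ) * ((-1) ^ d * p ^ (d ^ 2 - d)))
      (-qPochInf (p ^ 2) (p ^ 2) ^ 3) := by
  have hQ := norm_pow_lt_one hp two_ne_zero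
  set Q := p ^ 2 with hQdef
  have hA := hasSum_heineTerm (c := 0) (by simp) hQ 1
  have hB := hasSum_heineTerm (c := 0) (by simp) hQ Q
  rw [qPochInf_zero_left, div_one] at hA hB
  rw [qPochInf_one hQ] at hA
  have hA' := hasSum_natCast_mul_heineTerm_one hQ
  have hB' := (summable_natCast_mul_heineTerm hQ Q).hasSum
  have h1 := hA'.mul_prod hB
  have h2 := hA.mul_prod hB'
  have h3 := h1.sub h2
  rw [zero_mul, sub_zero] at h3
  have hterm : ∀ (x : ℂ) (i : ℕ), heineTerm 0 Q x i =
      (-1) ^ i * Q ^ i.choose 2 * x ^ i / qPoch Q Q i := fun x i => by simp [heineTerm, qPoch]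
  have h4 := h3.by_difference (g := fun d : ℤ => ((d : ℂ) * ((-1) ^ d * p ^ (-d))) *
      (p ^ (d ^ 2) / qPochInf (p ^ 2) (p ^ 2))) fun d => by
    refine ((hasSum_cauchy_int hp d).mul_left _).of_eq fun v => ?_
    have ed : (d : ℂ) = ((v + d.toNat : ℕ) : ℂ) - ((v + (-d).toNat : ℕ) : ℂ) := by
      have : d = ((v + d.toNat : ℕ) : ℤ) - ((v + (-d).toNat : ℕ) : ℤ) := by push_cast; lia
      exact_mod_cast congrArg (Int.cast : ℤ → ℂ) this
    have e1 : ((-1 : ℂ)) ^ d = (-1) ^ (v + d.toNat) * (-1) ^ (v + (-d).toNat) := by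
      have : (-1 : ℂ) ^ (v + (-d).toNat) = (-1) ^ (-((v + (-d).toNat : ℕ) : ℤ)) := by
        rw [zpow_neg, zpow_natCast, ← inv_pow]; norm_num
      rw [this, ← zpow_natCast, ← zpow_add₀ (by norm_num)]
      congr 1; push_cast; lia
    have e2 : p ^ (-d) * p ^ ((v + d.toNat) ^ 2 + (v + (-d).toNat) ^ 2) =
        Q ^ (v + d.toNat).choose 2 * (Q ^ (v + (-d).toNat).choose 2 * Q ^ (v + (-d).toNat)) := by
      rw [hQdef, ← pow_mul, ← pow_mul, ← pow_mul, ← pow_add, ← pow_add, ← zpow_natCast,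
        ← zpow_natCast, ← zpow_add₀ hp0, sq_eq_choose_two, sq_eq_choose_two (v + (-d).toNat)]
      congr 1; push_cast; lia
    simp only [hterm]
    rw [ed, e1]
    linear_combination -(((v + d.toNat : ℕ) : ℂ) - ((v + (-d).toNat : ℕ) : ℂ)) *
      ((-1) ^ (v + d.toNat) * (-1) ^ (v + (-d).toNat)) /
      (qPoch Q Q (v + d.toNat) * qPoch Q Q (v + (-d).toNat)) * e2
  have h5 := qPochInf_ne_zero hQ hQ
  have h6 := h4.mul_left (qPochInf Q Q)
  have h7 : -qPochInf Q Q ^ 3 = qPochInf Q Q * (-qPochInf Q Q * qPochInf Q Q) := by ring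
  rw [h7]
  refine h6.of_eq fun d => ?_
  rw [sub_eq_add_neg (d ^ 2), zpow_add₀ hp0, ← hQdef]
  field_simp

/-! ### Theta series as products -/

lemma qPochInf_self_split {x : ℂ} (hx : ‖x‖ < 1) :
    qPochInf x x = qPochInf x (x ^ 2) * qPochInf (x ^ 2) (x ^ 2) := by
  rw [qPochInf_eq_prod x hx two_ne_zero]
  simp [prod_range_succ, sq]

lemma qPochInf_neg_self {x : ℂ} (hx : ‖x‖ < 1) :
    qPochInf (-x) x * qPochInf x x = qPochInf (x ^ 2) (x ^ 2) := by
  rw [mul_comm, qPochInf_mul_neg x hx]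

lemma qJ_ne_zero {q : ℂ} (hq : ‖q‖ < 1) {m : ℕ} (hm : m ≠ 0) : qJ m q ≠ 0 :=
  qPochInf_ne_zero (norm_pow_lt_one hq hm) (norm_pow_lt_one hq hm)

lemma qJ_pow (m n : ℕ) (q : ℂ) : qJ m (q ^ n) = qJ (n * m) q := by
  simp [qJ, pow_mul]

lemma qPochInf_odd {q : ℂ} (hq : ‖q‖ < 1) : qPochInf q (q ^ 2) = qJ 1 q / qJ 2 q := by
  rw [eq_div_iff (qJ_ne_zero hq two_ne_zero), qJ, qJ, pow_one, ← qPochInf_self_split hq]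

lemma qPochInf_neg_odd {q : ℂ} (hq : ‖q‖ < 1) :
    qPochInf (-q) (q ^ 2) = qJ 2 q ^ 2 / (qJ 1 q * qJ 4 q) := by
  have hq2 := norm_pow_lt_one hq two_ne_zero
  have h1 := qPochInf_mul_neg q hq2
  rw [qPochInf_odd hq, qPochInf_odd hq2, qJ_pow, qJ_pow] at h1
  have := qJ_ne_zero hq one_ne_zero
  have := qJ_ne_zero hq two_ne_zero
  have := qJ_ne_zero hq (m := 4) (by norm_num)
  norm_num at h1
  field_simp at h1 ⊢
  linear_combination h1

lemma qPochInf_neg_even {q : ℂ} (hq : ‖q‖ < 1) :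
    qPochInf (-q ^ 2) (q ^ 2) = qJ 4 q / qJ 2 q := by
  rw [eq_div_iff (qJ_ne_zero hq two_ne_zero)]
  have := qPochInf_neg_self (norm_pow_lt_one hq two_ne_zero)
  rw [← pow_mul] at this
  exact this

lemma hasSum_theta_neg {q : ℂ} (hq0 : q ≠ 0) (hq : ‖q‖ < 1) :
    HasSum (fun n : ℤ => (-1) ^ n * q ^ (n ^ 2)) (qJ 1 q ^ 2 / qJ 2 q) := by
  have h := hasSum_tripleProduct hq0 hq (z := -1) (by norm_num)
  have h2 := qJ_ne_zero hq two_ne_zero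
  have e : -((-1 : ℂ)⁻¹ * q) = q := by norm_num
  rw [e, neg_one_mul, neg_neg, qPochInf_odd hq, ← qJ] at h
  have e2 : qJ 2 q * (qJ 1 q / qJ 2 q) * (qJ 1 q / qJ 2 q) = qJ 1 q ^ 2 / qJ 2 q := by
    field_simp
  rw [e2] at h
  exact h.of_eq fun n => mul_comm _ _

/-- The triple product `(q⁶;q⁶)_∞ (-q;q⁶)_∞ (-q⁵;q⁶)_∞`. -/
lemma hasSum_theta_one_five {q : ℂ} (hq0 : q ≠ 0) (hq : ‖q‖ < 1) :
    HasSum (fun n : ℤ => q ^ (3 * n ^ 2 + 2 * n))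
      (qJ 2 q ^ 2 * qJ 3 q * qJ 12 q / (qJ 1 q * qJ 4 q * qJ 6 q)) := by
  have hq3 := norm_pow_lt_one hq (m := 3) (by norm_num)
  have h := hasSum_tripleProduct (pow_ne_zero 3 hq0) hq3 (z := q ^ 2) (pow_ne_zero 2 hq0)
  have e1 : q ^ 2 * q ^ 3 = q ^ 5 := by ring
  have e2 : (q ^ 2)⁻¹ * q ^ 3 = q := by field_simp
  have e3 : (q ^ 3) ^ 2 = q ^ 6 := by ring
  rw [e1, e2, e3] at h
  have h3 := qPochInf_eq_prod (-q) (norm_pow_lt_one hq two_ne_zero) (m := 3) (by norm_num)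
  rw [qPochInf_neg_odd hq] at h3
  simp only [prod_range_succ, prod_range_zero, one_mul, pow_zero, mul_one, pow_one] at h3
  have e4 : -q * q ^ 2 = -q ^ 3 := by ring
  have e5 : -q * (q ^ 2) ^ 2 = -q ^ 5 := by ring
  have e6 : (q ^ 2) ^ 3 = (q ^ 3) ^ 2 := by ring
  rw [e4, e5, e6, qPochInf_neg_odd hq3, qJ_pow, qJ_pow, qJ_pow, e3] at h3
  norm_num at h3
  have n1 := qJ_ne_zero hq one_ne_zero
  have n2 := qJ_ne_zero hq two_ne_zero
  have n3 := qJ_ne_zero hq (m := 3) (by norm_num)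
  have n4 := qJ_ne_zero hq (m := 4) (by norm_num)
  have n6 := qJ_ne_zero hq (m := 6) (by norm_num)
  have n12 := qJ_ne_zero hq (m := 12) (by norm_num)
  have e7 : qPochInf (q ^ 6) (q ^ 6) * qPochInf (-q ^ 5) (q ^ 6) * qPochInf (-q) (q ^ 6) =
      qJ 2 q ^ 2 * qJ 3 q * qJ 12 q / (qJ 1 q * qJ 4 q * qJ 6 q) := by
    rw [← qJ]
    field_simp at h3 ⊢
    linear_combination -h3
  rw [e7] at h
  refine h.of_eq fun n => ?_
  rw [← zpow_natCast, ← zpow_natCast, ← zpow_mul, ← zpow_mul, ← zpow_add₀ hq0]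
  congr 1

/-- The triple product `(q⁶;q⁶)_∞ (-q²;q⁶)_∞ (-q⁴;q⁶)_∞`. -/
lemma hasSum_theta_two_four {q : ℂ} (hq0 : q ≠ 0) (hq : ‖q‖ < 1) :
    HasSum (fun n : ℤ => q ^ (3 * n ^ 2 + n)) (qJ 4 q * qJ 6 q ^ 2 / (qJ 2 q * qJ 12 q)) := by
  have hq3 := norm_pow_lt_one hq (m := 3) (by norm_num)
  have h := hasSum_tripleProduct (pow_ne_zero 3 hq0) hq3 (z := q) hq0
  have e1 : q * q ^ 3 = q ^ 4 := by ring
  have e2 : q⁻¹ * q ^ 3 = q ^ 2 := by field_simp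
  have e3 : (q ^ 3) ^ 2 = q ^ 6 := by ring
  rw [e1, e2, e3] at h
  have h3 := qPochInf_eq_prod (-q ^ 2) (norm_pow_lt_one hq two_ne_zero) (m := 3) (by norm_num)
  rw [qPochInf_neg_even hq] at h3
  simp only [prod_range_succ, prod_range_zero, one_mul, pow_zero, mul_one, pow_one] at h3
  have e4 : -q ^ 2 * q ^ 2 = -q ^ 4 := by ring
  have e5 : -q ^ 2 * (q ^ 2) ^ 2 = -(q ^ 3) ^ 2 := by ring
  have e6 : (q ^ 2) ^ 3 = (q ^ 3) ^ 2 := by ring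
  rw [e4, e5, e6, qPochInf_neg_even hq3, qJ_pow, qJ_pow, e3] at h3
  norm_num at h3
  have n2 := qJ_ne_zero hq two_ne_zero
  have n6 := qJ_ne_zero hq (m := 6) (by norm_num)
  have n12 := qJ_ne_zero hq (m := 12) (by norm_num)
  have e7 : qPochInf (q ^ 6) (q ^ 6) * qPochInf (-q ^ 4) (q ^ 6) * qPochInf (-q ^ 2) (q ^ 6) =
      qJ 4 q * qJ 6 q ^ 2 / (qJ 2 q * qJ 12 q) := by
    rw [← qJ]
    field_simp at h3 ⊢
    linear_combination -h3
  rw [e7] at h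
  refine h.of_eq fun n => ?_
  rw [← zpow_natCast, ← zpow_mul, ← zpow_add₀ hq0]
  congr 1

/-- Euler's pentagonal number theorem, in base `q⁴`. -/
lemma hasSum_pentagonal {q : ℂ} (hq0 : q ≠ 0) (hq : ‖q‖ < 1) :
    HasSum (fun n : ℤ => (-1) ^ n * q ^ (6 * n ^ 2 + 2 * n)) (qJ 4 q) := by
  have hq6 := norm_pow_lt_one hq (m := 6) (by norm_num)
  have h := hasSum_tripleProduct (pow_ne_zero 6 hq0) hq6 (z := -q ^ 2)
    (neg_ne_zero.mpr (pow_ne_zero 2 hq0))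
  have e1 : -(-q ^ 2 * q ^ 6) = q ^ 8 := by ring
  have e2 : -((-q ^ 2)⁻¹ * q ^ 6) = q ^ 4 := by field_simp
  have e3 : (q ^ 6) ^ 2 = q ^ 12 := by ring
  rw [e1, e2, e3] at h
  have h3 := qPochInf_eq_prod (q ^ 4) (norm_pow_lt_one hq (m := 4) (by norm_num)) (m := 3)
    (by norm_num)
  simp only [prod_range_succ, prod_range_zero, one_mul, pow_zero, mul_one, pow_one] at h3
  have e4 : q ^ 4 * q ^ 4 = q ^ 8 := by ring
  have e5 : q ^ 4 * (q ^ 4) ^ 2 = q ^ 12 := by ring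
  have e6 : (q ^ 4) ^ 3 = q ^ 12 := by ring
  rw [e4, e5, e6] at h3
  have e7 : qPochInf (q ^ 12) (q ^ 12) * qPochInf (q ^ 8) (q ^ 12) * qPochInf (q ^ 4) (q ^ 12) =
      qJ 4 q := by
    rw [qJ, h3]; ring
  rw [e7] at h
  refine h.of_eq fun n => ?_
  rw [neg_eq_neg_one_mul (q ^ 2), mul_zpow, ← zpow_natCast, ← zpow_natCast, ← zpow_mul, ← zpow_mul,
    mul_left_comm, ← zpow_add₀ hq0]
  congr 2

/-! ### Two theta series of weight `3/2` -/

lemma neg_one_zpow_add_two_mul (n c : ℤ) : (-1 : ℂ) ^ (n + 2 * c) = (-1) ^ n := by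
  rw [zpow_add₀ (by norm_num), zpow_mul]; norm_num

lemma neg_one_zpow_neg (n : ℤ) : (-1 : ℂ) ^ (-n) = (-1) ^ n := by
  rw [zpow_neg, ← inv_zpow]; norm_num

lemma summable_int_zpow {q : ℂ} (hq0 : q ≠ 0) (hq : ‖q‖ < 1) {w : ℤ → ℂ} {K : ℝ}
    (hw : ∀ n, ‖w n‖ ≤ K * (|(n : ℝ)| + 1)) {e : ℤ → ℤ} (L : ℤ) (he : ∀ n, |n| - L ≤ e n) :
    Summable fun n : ℤ => w n * q ^ e n := by
  have hn : 0 < ‖q‖ := norm_pos_iff.mpr hq0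
  have hs : Summable fun n : ℤ => (|(n : ℝ)| + 1) * ‖q‖ ^ |n| := by
    have h := summable_succ_mul_pow hn.le hq
    refine Summable.of_nat_of_neg (h.congr fun n => ?_) (h.congr fun n => ?_) <;> simp
  refine Summable.of_norm_bounded (hs.mul_left (K * ‖q‖ ^ (-L))) fun n => ?_
  rw [norm_mul, norm_zpow]
  have h1 : ‖q‖ ^ e n ≤ ‖q‖ ^ (-L) * ‖q‖ ^ |n| := by
    rw [← zpow_add₀ hn.ne']
    refine zpow_le_zpow_right_of_le_one₀ hn hq.le ?_
    have := he n
    linarith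
  calc ‖w n‖ * ‖q‖ ^ e n ≤ (K * (|(n : ℝ)| + 1)) * (‖q‖ ^ (-L) * ‖q‖ ^ |n|) :=
        mul_le_mul (hw n) h1 (by positivity) ((norm_nonneg _).trans (hw n))
    _ = _ := by ring

lemma summable_linear_mul_zpow {q : ℂ} (hq0 : q ≠ 0) (hq : ‖q‖ < 1) (a b : ℤ) {e : ℤ → ℤ} (L : ℤ)
    (he : ∀ n, |n| - L ≤ e n) : Summable fun n : ℤ => ((a : ℂ) * n + b) * q ^ e n := by
  refine summable_int_zpow hq0 hq (K := |(a : ℝ)| + |(b : ℝ)|) (fun n => ?_) L he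
  have h1 : ‖(a : ℂ) * n + b‖ ≤ |(a : ℝ)| * |(n : ℝ)| + |(b : ℝ)| := by
    refine (norm_add_le _ _).trans ?_
    simp [Complex.norm_intCast]
  nlinarith [abs_nonneg (a : ℝ), abs_nonneg (b : ℝ), abs_nonneg (n : ℝ)]

/-- Pairs `(a, m)` of integers, by the residue `j` modulo `3` of `a + 2m = 3k + j`:
`a = k + j - 2l`, `m = l + k`. -/
def residueThreeEquiv : Fin 3 × ℤ × ℤ ≃ ℤ × ℤ where
  toFun t := (t.2.1 + t.1.val - 2 * t.2.2, t.2.2 + t.2.1)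
  invFun p := (⟨((p.1 + 2 * p.2) % 3).toNat, by lia⟩, (p.1 + 2 * p.2) / 3,
    p.2 - (p.1 + 2 * p.2) / 3)
  left_inv t := by
    obtain ⟨⟨j, hj⟩, k, l⟩ := t
    simp only [Prod.mk.injEq, Fin.mk.injEq]
    refine ⟨?_, ?_, ?_⟩ <;> lia
  right_inv p := by
    obtain ⟨a, m⟩ := p
    simp only [Prod.mk.injEq]
    refine ⟨?_, ?_⟩ <;> lia

/-- The derivative of the quintuple product, at the point `z = q^s`: a product of two theta series
is expanded along the residues modulo `3` of `a + 2m`. -/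
lemma quintuple_derivative {q : ℂ} (hq0 : q ≠ 0) (hq : ‖q‖ < 1) (s : ℤ) {A A' B B' K₀ K₁ : ℂ}
    (hA : HasSum (fun a : ℤ => (-1) ^ a * q ^ (a ^ 2 - a + s * a)) A)
    (hA' : HasSum (fun a : ℤ => (a : ℂ) * ((-1) ^ a * q ^ (a ^ 2 - a + s * a))) A')
    (hB : HasSum (fun m : ℤ => (-1) ^ m * q ^ (2 * m ^ 2 + 2 * s * m)) B)
    (hB' : HasSum (fun m : ℤ => (m : ℂ) * ((-1) ^ m * q ^ (2 * m ^ 2 + 2 * s * m))) B')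
    (hK₀ : HasSum (fun k : ℤ => (3 * k : ℂ) * q ^ (3 * k ^ 2 - k + 3 * s * k)) K₀)
    (hK₁ : HasSum (fun k : ℤ => (3 * k + 1 : ℂ) * q ^ (3 * k ^ 2 + k + s * (3 * k + 1))) K₁) :
    A' * B + 2 * (A * B') = qJ 4 q * (K₀ - K₁) := by
  have hL := (hA'.mul_prod hB).add ((hA.mul_prod hB').mul_left 2)
  -- on the pair `(a, m)` the left-hand side carries the weight `a + 2m`
  have hR := residueThreeEquiv.hasSum_iff.mpr hL
  have hD := hasSum_pentagonal hq0 hq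
  have hD' : HasSum (fun l : ℤ => (-1) ^ l * q ^ (6 * l ^ 2 - 2 * l)) (qJ 4 q) := by
    refine ((Equiv.neg ℤ).hasSum_iff.mpr hD).of_eq fun l => ?_
    simp only [Function.comp, Equiv.neg_apply, neg_one_zpow_neg]
    congr 2; ring
  have hs2 : Summable fun l : ℤ => (-1 : ℂ) ^ l * q ^ (6 * l ^ 2 - 6 * l) := by
    refine summable_int_zpow hq0 hq (K := 1) (fun n => ?_) 9 fun n => ?_
    · simp
    · cases abs_cases n <;> nlinarith
  -- the residue `2` does not contribute: its theta series in `l` is odd under `l ↦ 1 - l`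
  have hZ : HasSum (fun l : ℤ => (-1 : ℂ) ^ l * q ^ (6 * l ^ 2 - 6 * l)) 0 := by
    have := hs2.hasSum.eq_zero_of_odd (Equiv.subLeft 1) fun l => by
      simp only [Equiv.subLeft_apply]
      have e1 : 6 * (1 - l) ^ 2 - 6 * (1 - l) = 6 * l ^ 2 - 6 * l := by ring
      have e2 : (1 - l) = (l + 1) + 2 * (-l) := by ring
      rw [e1, e2, neg_one_zpow_add_two_mul, zpow_add₀ (by norm_num)]
      norm_num
    exact this ▸ hs2.hasSum
  have hs3 : Summable fun k : ℤ => ((3 : ℤ) * k + (2 : ℤ) : ℂ) *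
      q ^ (3 * k ^ 2 + 3 * k + 2 + s * (3 * k + 2)) := by
    refine summable_linear_mul_zpow hq0 hq 3 2 ((3 + 3 * s) ^ 2 - 1 - 2 * s) fun k => ?_
    cases abs_cases k <;> nlinarith [sq_nonneg ((3 + 3 * s) + k), sq_nonneg (3 + 3 * s), sq_nonneg k]
  have hterm : ∀ j k l a m : ℤ, a = k + j - 2 * l → m = l + k →
      (a : ℂ) * ((-1) ^ a * q ^ (a ^ 2 - a + s * a)) * ((-1) ^ m * q ^ (2 * m ^ 2 + 2 * s * m)) +
        2 * ((-1) ^ a * q ^ (a ^ 2 - a + s * a) *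
          ((m : ℂ) * ((-1) ^ m * q ^ (2 * m ^ 2 + 2 * s * m)))) =
      (3 * k + j : ℂ) * ((-1) ^ (l + j) * q ^ (3 * k ^ 2 + 2 * k * j - k + s * (3 * k + j) +
        (6 * l ^ 2 + 2 * l - 4 * j * l + j ^ 2 - j))) := fun j k l a m ha hm => by
    have e1 : (3 * k + j : ℂ) = a + 2 * m := by rw [ha, hm]; push_cast; ring
    have e2 : l + j = (a + m) + 2 * (l - k) := by rw [ha, hm]; ring
    have e3 : 3 * k ^ 2 + 2 * k * j - k + s * (3 * k + j) +
        (6 * l ^ 2 + 2 * l - 4 * j * l + j ^ 2 - j) =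
        a ^ 2 - a + s * a + (2 * m ^ 2 + 2 * s * m) := by rw [ha, hm]; ring
    rw [e1, e2, e3, neg_one_zpow_add_two_mul, zpow_add₀ hq0 (a ^ 2 - a + s * a),
      zpow_add₀ (by norm_num : (-1 : ℂ) ≠ 0)]
    ring
  let v : Fin 3 → ℂ := ![K₀ * qJ 4 q, K₁ * -qJ 4 q, (∑' k : ℤ, ((3 : ℤ) * k + (2 : ℤ) : ℂ) *
      q ^ (3 * k ^ 2 + 3 * k + 2 + s * (3 * k + 2))) * 0]
  have hfib := HasSum.prod_fiberwise hR (g := v) fun j => by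
    fin_cases j
    · refine (hK₀.mul_prod hD).of_eq fun t => ?_
      refine (hterm 0 t.1 t.2 (residueThreeEquiv (0, t)).1 (residueThreeEquiv (0, t)).2
        rfl rfl).trans ?_
      have e3 : 3 * t.1 ^ 2 + 2 * t.1 * 0 - t.1 + s * (3 * t.1 + 0) +
          (6 * t.2 ^ 2 + 2 * t.2 - 4 * 0 * t.2 + 0 ^ 2 - 0) =
            (3 * t.1 ^ 2 - t.1 + 3 * s * t.1) + (6 * t.2 ^ 2 + 2 * t.2) := by
        ring
      rw [e3, zpow_add₀ hq0, zpow_add₀ (by norm_num : (-1 : ℂ) ≠ 0)]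
      push_cast; simp; ring
    · refine (hK₁.mul_prod hD'.neg).of_eq fun t => ?_
      refine (hterm 1 t.1 t.2 (residueThreeEquiv (1, t)).1 (residueThreeEquiv (1, t)).2
        rfl rfl).trans ?_
      have e3 : 3 * t.1 ^ 2 + 2 * t.1 * 1 - t.1 + s * (3 * t.1 + 1) +
          (6 * t.2 ^ 2 + 2 * t.2 - 4 * 1 * t.2 + 1 ^ 2 - 1) =
            (3 * t.1 ^ 2 + t.1 + s * (3 * t.1 + 1)) + (6 * t.2 ^ 2 - 2 * t.2) := by
        ring
      rw [e3, zpow_add₀ hq0, zpow_add₀ (by norm_num : (-1 : ℂ) ≠ 0)]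
      push_cast; rw [zpow_one]; ring
    · refine (hs3.hasSum.mul_prod hZ).of_eq fun t => ?_
      refine (hterm 2 t.1 t.2 (residueThreeEquiv (2, t)).1 (residueThreeEquiv (2, t)).2
        rfl rfl).trans ?_
      have e3 : 3 * t.1 ^ 2 + 2 * t.1 * 2 - t.1 + s * (3 * t.1 + 2) +
          (6 * t.2 ^ 2 + 2 * t.2 - 4 * 2 * t.2 + 2 ^ 2 - 2) =
            (3 * t.1 ^ 2 + 3 * t.1 + 2 + s * (3 * t.1 + 2)) + (6 * t.2 ^ 2 - 6 * t.2) := by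
        ring
      rw [e3, zpow_add₀ hq0, zpow_add₀ (by norm_num : (-1 : ℂ) ≠ 0)]
      push_cast; norm_num; ring
  have h := hfib.unique (hasSum_fintype v)
  rw [h]
  simp only [v, Fin.sum_univ_three, Matrix.cons_val_zero, Matrix.cons_val_one, Matrix.cons_val]
  ring

/-- The derivative of the quintuple product for `s = 1`. Since `B = 0`, only Jacobi's cube and
`∑ (-1)^n q^{n²}` enter. -/
theorem hasSum_weighted_one_five {q : ℂ} (hq0 : q ≠ 0) (hq : ‖q‖ < 1) :
    HasSum (fun n : ℤ => (3 * n + 1 : ℂ) * q ^ (3 * n ^ 2 + 2 * n))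
      (qJ 1 q ^ 2 * qJ 4 q ^ 2 / qJ 2 q) := by
  have hq2 := norm_pow_lt_one hq two_ne_zero
  have hA := hasSum_theta_neg hq0 hq
  have hA' : HasSum (fun a : ℤ => (a : ℂ) * ((-1) ^ a * q ^ (a ^ 2 - a + 1 * a))) _ :=
    Summable.hasSum <| by
      refine (summable_int_zpow hq0 hq (w := fun a => (a : ℂ) * (-1) ^ a) (K := 1) (fun n => ?_)
        (e := fun a => a ^ 2 - a + 1 * a) 1 fun n => ?_).congr fun a => by ring
      · simp [Complex.norm_intCast]
      · cases abs_cases n <;> nlinarith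
  have hs2 : Summable fun m : ℤ => (-1 : ℂ) ^ m * q ^ (2 * m ^ 2 + 2 * 1 * m) := by
    refine summable_int_zpow hq0 hq (K := 1) (fun n => ?_) 5 fun n => ?_
    · simp
    · cases abs_cases n <;> nlinarith
  have hB : HasSum (fun m : ℤ => (-1 : ℂ) ^ m * q ^ (2 * m ^ 2 + 2 * 1 * m)) 0 := by
    have := hs2.hasSum.eq_zero_of_odd (Equiv.subLeft (-1)) fun l => by
      simp only [Equiv.subLeft_apply]
      have e1 : 2 * (-1 - l) ^ 2 + 2 * 1 * (-1 - l) = 2 * l ^ 2 + 2 * 1 * l := by ring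
      have e2 : (-1 - l) = (l + 1) + 2 * (-l - 1) := by ring
      rw [e1, e2, neg_one_zpow_add_two_mul, zpow_add₀ (by norm_num)]
      norm_num
    exact this ▸ hs2.hasSum
  have hB' : HasSum (fun m : ℤ => (m : ℂ) * ((-1) ^ m * q ^ (2 * m ^ 2 + 2 * 1 * m)))
      (qJ 4 q ^ 3) := by
    have h := (hasSum_jacobi_cube (pow_ne_zero 2 hq0) hq2).neg
    rw [neg_neg, ← pow_mul] at h
    refine ((Equiv.neg ℤ).hasSum_iff.mpr h).of_eq fun l => ?_
    simp only [Function.comp, Equiv.neg_apply, neg_one_zpow_neg]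
    have e : q ^ (2 * l ^ 2 + 2 * 1 * l) = (q ^ 2) ^ ((-l) ^ 2 - -l) := by
      rw [← zpow_natCast, ← zpow_mul]
      congr 1; push_cast; ring
    rw [e]
    push_cast; ring
  have hK : Summable fun k : ℤ => ((3 : ℤ) * k + (0 : ℤ) : ℂ) * q ^ (3 * k ^ 2 - k + 3 * 1 * k) := by
    refine summable_linear_mul_zpow hq0 hq 3 0 3 fun k => ?_
    cases abs_cases k <;> nlinarith
  have hK' : Summable fun k : ℤ =>
      ((3 : ℤ) * k + (1 : ℤ) : ℂ) * q ^ (3 * k ^ 2 + k + 1 * (3 * k + 1)) := by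
    refine summable_linear_mul_zpow hq0 hq 3 1 3 fun k => ?_
    cases abs_cases k <;> nlinarith
  have h0 := hK.hasSum.of_eq (f := fun k : ℤ => (3 * k : ℂ) * q ^ (3 * k ^ 2 - k + 3 * 1 * k))
    fun k => by simp
  have h1 := hK'.hasSum.of_eq
    (f := fun k : ℤ => (3 * k + 1 : ℂ) * q ^ (3 * k ^ 2 + k + 1 * (3 * k + 1))) fun k => by simp
  have key := quintuple_derivative hq0 hq 1 (hA.of_eq fun a => by congr 2; ring) hA' hB hB' h0 h1
  have hsum := (h0.sub ((Equiv.subLeft (-1)).hasSum_iff.mpr h1)).mul_left (1 / 2 : ℂ)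
  have n2 := qJ_ne_zero hq two_ne_zero
  have n4 := qJ_ne_zero hq (m := 4) (by norm_num)
  have hval : (1 / 2 : ℂ) * (∑' k : ℤ, ((3 : ℤ) * k + (0 : ℤ) : ℂ) * q ^ (3 * k ^ 2 - k + 3 * 1 * k)
      - ∑' k : ℤ, ((3 : ℤ) * k + (1 : ℤ) : ℂ) * q ^ (3 * k ^ 2 + k + 1 * (3 * k + 1))) =
      qJ 1 q ^ 2 * qJ 4 q ^ 2 / qJ 2 q := by
    have : qJ 4 q * ((1 / 2 : ℂ) *
      (∑' k : ℤ, ((3 : ℤ) * k + (0 : ℤ) : ℂ) * q ^ (3 * k ^ 2 - k + 3 * 1 * k)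
      - ∑' k : ℤ, ((3 : ℤ) * k + (1 : ℤ) : ℂ) * q ^ (3 * k ^ 2 + k + 1 * (3 * k + 1)))) =
      qJ 4 q * (qJ 1 q ^ 2 * qJ 4 q ^ 2 / qJ 2 q) := by
      linear_combination (-1 / 2 : ℂ) * key
    exact mul_left_cancel₀ n4 this
  rw [hval] at hsum
  refine hsum.of_eq fun k => ?_
  simp only [Function.comp, Equiv.subLeft_apply]
  have e1 : 3 * (-1 - k) ^ 2 + (-1 - k) + 1 * (3 * (-1 - k) + 1) = 3 * k ^ 2 + 2 * k := by ring
  have e2 : 3 * k ^ 2 - k + 3 * 1 * k = 3 * k ^ 2 + 2 * k := by ring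
  rw [e1, e2]
  push_cast
  ring

/-- Gordon's identity, in base `q²`: the derivative of the quintuple product for `s = 0`. Now
`A = 0`, and `A'` is Jacobi's cube. -/
theorem hasSum_gordon {q : ℂ} (hq0 : q ≠ 0) (hq : ‖q‖ < 1) :
    HasSum (fun n : ℤ => (6 * n + 1 : ℂ) * q ^ (3 * n ^ 2 + n)) (qJ 2 q ^ 5 / qJ 4 q ^ 2) := by
  have hq2 := norm_pow_lt_one hq two_ne_zero
  have hs2 : Summable fun m : ℤ => (-1 : ℂ) ^ m * q ^ (m ^ 2 - m + 0 * m) := by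
    refine summable_int_zpow hq0 hq (K := 1) (fun n => ?_) 5 fun n => ?_
    · simp
    · cases abs_cases n <;> nlinarith
  have hA : HasSum (fun m : ℤ => (-1 : ℂ) ^ m * q ^ (m ^ 2 - m + 0 * m)) 0 := by
    have := hs2.hasSum.eq_zero_of_odd (Equiv.subLeft 1) fun l => by
      simp only [Equiv.subLeft_apply]
      have e1 : (1 - l) ^ 2 - (1 - l) + 0 * (1 - l) = l ^ 2 - l + 0 * l := by ring
      have e2 : (1 - l) = (l + 1) + 2 * (-l) := by ring
      rw [e1, e2, neg_one_zpow_add_two_mul, zpow_add₀ (by norm_num)]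
      norm_num
    exact this ▸ hs2.hasSum
  have hA' : HasSum (fun a : ℤ => (a : ℂ) * ((-1) ^ a * q ^ (a ^ 2 - a + 0 * a)))
      (-qJ 2 q ^ 3) := (hasSum_jacobi_cube hq0 hq).of_eq fun a => by congr 3; ring
  have hB : HasSum (fun m : ℤ => (-1 : ℂ) ^ m * q ^ (2 * m ^ 2 + 2 * 0 * m))
      (qJ 2 q ^ 2 / qJ 4 q) := by
    have h := hasSum_theta_neg (pow_ne_zero 2 hq0) hq2
    rw [qJ_pow, qJ_pow] at h
    refine h.of_eq fun m => ?_
    rw [← zpow_natCast, ← zpow_mul]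
    congr 2; push_cast; ring
  have hB' : HasSum (fun m : ℤ => (m : ℂ) * ((-1) ^ m * q ^ (2 * m ^ 2 + 2 * 0 * m))) _ :=
    Summable.hasSum <| by
      refine (summable_int_zpow hq0 hq (w := fun a => (a : ℂ) * (-1) ^ a) (K := 1) (fun n => ?_)
        (e := fun m => 2 * m ^ 2 + 2 * 0 * m) 1 fun n => ?_).congr fun a => by ring
      · simp [Complex.norm_intCast]
      · cases abs_cases n <;> nlinarith
  have hK : Summable fun k : ℤ => ((3 : ℤ) * k + (0 : ℤ) : ℂ) * q ^ (3 * k ^ 2 - k + 3 * 0 * k) := by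
    refine summable_linear_mul_zpow hq0 hq 3 0 3 fun k => ?_
    cases abs_cases k <;> nlinarith
  have hK' : Summable fun k : ℤ =>
      ((3 : ℤ) * k + (1 : ℤ) : ℂ) * q ^ (3 * k ^ 2 + k + 0 * (3 * k + 1)) := by
    refine summable_linear_mul_zpow hq0 hq 3 1 3 fun k => ?_
    cases abs_cases k <;> nlinarith
  have h0 := hK.hasSum.of_eq (f := fun k : ℤ => (3 * k : ℂ) * q ^ (3 * k ^ 2 - k + 3 * 0 * k))
    fun k => by simp
  have h1 := hK'.hasSum.of_eq
    (f := fun k : ℤ => (3 * k + 1 : ℂ) * q ^ (3 * k ^ 2 + k + 0 * (3 * k + 1))) fun k => by simp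
  have key := quintuple_derivative hq0 hq 0 hA hA' hB hB' h0 h1
  have hsum := h1.sub ((Equiv.neg ℤ).hasSum_iff.mpr h0)
  have n4 := qJ_ne_zero hq (m := 4) (by norm_num)
  have hval : (∑' k : ℤ, ((3 : ℤ) * k + (1 : ℤ) : ℂ) * q ^ (3 * k ^ 2 + k + 0 * (3 * k + 1))) -
      ∑' k : ℤ, ((3 : ℤ) * k + (0 : ℤ) : ℂ) * q ^ (3 * k ^ 2 - k + 3 * 0 * k) =
      qJ 2 q ^ 5 / qJ 4 q ^ 2 := by
    refine mul_left_cancel₀ n4 ?_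
    have : qJ 4 q * (qJ 2 q ^ 5 / qJ 4 q ^ 2) = qJ 2 q ^ 3 * (qJ 2 q ^ 2 / qJ 4 q) := by
      field_simp
    rw [this]
    linear_combination key
  rw [hval] at hsum
  refine hsum.of_eq fun k => ?_
  simp only [Function.comp, Equiv.neg_apply]
  have e1 : 3 * (-k) ^ 2 - (-k) + 3 * 0 * (-k) = 3 * k ^ 2 + k := by ring
  have e2 : 3 * k ^ 2 + k + 0 * (3 * k + 1) = 3 * k ^ 2 + k := by ring
  rw [e1, e2]
  push_cast
  ring

/-! ### The reduction of a triple sum to a theta series -/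

/-- The exponent `(2k+i+j)² + 2i² + 2j² = 3i² + 3j² + 4k² + 2ij + 4ik + 4jk`, the quadratic form of
`A` in base `q⁴`. -/
def baseExp (t : ℕ × ℕ × ℕ) : ℕ :=
  (2 * t.2.2 + t.1 + t.2.1) ^ 2 + 2 * t.1 ^ 2 + 2 * t.2.1 ^ 2

/-- The part of the triple series with `i - j = e`. Its sum over the antidiagonals of the two free
indices is a `q`-Vandermonde sum, and the sum over the antidiagonals is Cauchy's. -/
lemma hasSum_base_nat {q : ℂ} (hq : ‖q‖ < 1) (e : ℕ)
    (hs : Summable fun p : ℕ × ℕ =>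
      invPoch (q ^ 4) (p.1 + e, p.1, p.2) * q ^ baseExp (p.1 + e, p.1, p.2)) :
    HasSum (fun p : ℕ × ℕ =>
      invPoch (q ^ 4) (p.1 + e, p.1, p.2) * q ^ baseExp (p.1 + e, p.1, p.2))
      (q ^ (3 * e ^ 2) / qPochInf (q ^ 4) (q ^ 4)) := by
  have hQ := norm_pow_lt_one hq (m := 4) (by norm_num)
  have h := hs.hasSum.by_antidiagonal
  have h2 := (hasSum_cauchy hQ e).mul_left (q ^ (3 * e ^ 2))
  have h3 : ∀ n, ∑ p ∈ antidiagonal n,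
      invPoch (q ^ 4) (p.1 + e, p.1, p.2) * q ^ baseExp (p.1 + e, p.1, p.2) =
      q ^ (3 * e ^ 2) * ((q ^ 4) ^ (n ^ 2 + n * e) /
        (qPoch (q ^ 4) (q ^ 4) (n + e) * qPoch (q ^ 4) (q ^ 4) n)) := by
    intro n
    rw [div_eq_mul_inv, ← sum_antidiagonal_vandermonde hQ e n, mul_sum, mul_sum]
    refine sum_congr rfl fun p hp => ?_
    obtain rfl : p.1 + p.2 = n := mem_antidiagonal.mp hp
    rw [invPoch, div_eq_mul_inv, ← pow_mul, ← pow_mul, baseExp]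
    simp only
    have e1 : (2 * p.2 + (p.1 + e) + p.1) ^ 2 + 2 * (p.1 + e) ^ 2 + 2 * p.1 ^ 2 =
      3 * e ^ 2 + 4 * ((p.1 + p.2) ^ 2 + (p.1 + p.2) * e) + 4 * (p.1 ^ 2 + p.1 * e) := by ring
    rw [e1, pow_add, pow_add]
    ring
  have h4 := h.unique (h2.of_eq h3)
  have := hs.hasSum
  rwa [h4, ← div_eq_mul_inv] at this

lemma baseExp_swap (i j k : ℕ) : baseExp (i, j, k) = baseExp (j, i, k) := by
  simp only [baseExp]; ring

lemma invPoch_swap (Q : ℂ) (i j k : ℕ) : invPoch Q (i, j, k) = invPoch Q (j, i, k) := by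
  simp only [invPoch]; ring_nf

lemma le_baseExp (i j k : ℕ) : (i : ℤ) + j + k ≤ (baseExp (i, j, k) : ℤ) := by
  simp only [baseExp]
  push_cast
  nlinarith [Int.natCast_nonneg i, Int.natCast_nonneg j, Int.natCast_nonneg k,
    mul_nonneg (Int.natCast_nonneg i) (Int.natCast_nonneg j),
    mul_nonneg (Int.natCast_nonneg i) (Int.natCast_nonneg k),
    mul_nonneg (Int.natCast_nonneg j) (Int.natCast_nonneg k),
    Int.le_self_sq (i : ℤ), Int.le_self_sq (j : ℤ), Int.le_self_sq (k : ℤ)]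

lemma hasSum_base_int {q : ℂ} (hq0 : q ≠ 0) (hq : ‖q‖ < 1) (d : ℤ) :
    HasSum (fun p : ℕ × ℕ => invPoch (q ^ 4) (p.1 + d.toNat, p.1 + (-d).toNat, p.2) *
      q ^ baseExp (p.1 + d.toNat, p.1 + (-d).toNat, p.2))
      (q ^ (3 * d ^ 2) / qPochInf (q ^ 4) (q ^ 4)) := by
  have hQ := norm_pow_lt_one hq (m := 4) (by norm_num)
  have hs := (summable_invPoch_mul_zpow hq0 hq hQ (e := fun t => (baseExp t : ℤ)) 0 fun i j k => by
    have := le_baseExp i j k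
    linarith).1
  simp only [zpow_natCast] at hs
  have key : ∀ e : ℕ, HasSum (fun p : ℕ × ℕ =>
      invPoch (q ^ 4) (p.1 + e, p.1, p.2) * q ^ baseExp (p.1 + e, p.1, p.2))
      (q ^ (3 * (e : ℤ) ^ 2) / qPochInf (q ^ 4) (q ^ 4)) := fun e => by
    have := hasSum_base_nat hq e (hs.comp_injective
      (i := fun p : ℕ × ℕ => (p.1 + e, p.1, p.2)) fun p p' h => by
        simp only [Prod.mk.injEq] at h; ext <;> simp [h])
    have e1 : q ^ (3 * (e : ℤ) ^ 2) = q ^ (3 * e ^ 2) := by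
      rw [← zpow_natCast]; push_cast; rfl
    rwa [e1]
  obtain ⟨e, rfl | rfl⟩ := d.eq_nat_or_neg
  · simpa using! key e
  · refine HasSum.of_eq (by simpa using! key e) fun p => ?_
    simp only [neg_neg, Int.toNat_natCast, Int.toNat_neg_natCast, add_zero]
    rw [baseExp_swap, invPoch_swap]

/-- The triple sums with a weight and a linear term depending on `i - j` only reduce to
theta series. -/
lemma tsum_base_eq {q : ℂ} (hq0 : q ≠ 0) (hq : ‖q‖ < 1) (w : ℤ → ℂ)
    (hs : Summable fun t : ℕ × ℕ × ℕ => w ((t.1 : ℤ) - t.2.1) *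
      (invPoch (q ^ 4) t * q ^ ((baseExp t : ℤ) + 2 * ((t.1 : ℤ) - t.2.1)))) {s : ℂ}
    (hw : HasSum (fun d : ℤ => w d * q ^ (3 * d ^ 2 + 2 * d)) s) :
    HasSum (fun t : ℕ × ℕ × ℕ => w ((t.1 : ℤ) - t.2.1) *
      (invPoch (q ^ 4) t * q ^ ((baseExp t : ℤ) + 2 * ((t.1 : ℤ) - t.2.1)))) (s / qJ 4 q) := by
  have h := hs.hasSum.by_difference₃
    (g := fun d : ℤ => (w d * q ^ (2 * d)) * (q ^ (3 * d ^ 2) / qPochInf (q ^ 4) (q ^ 4)))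
    fun d => by
      refine ((hasSum_base_int hq0 hq d).mul_left _).of_eq fun p => ?_
      have : ((p.1 + d.toNat : ℕ) : ℤ) - ((p.1 + (-d).toNat : ℕ) : ℤ) = d := by push_cast; lia
      simp only [this]
      rw [zpow_add₀ hq0, zpow_natCast]
      ring
  have h2 := (hw.div_const (qJ 4 q)).unique (h.of_eq fun d => by
    rw [zpow_add₀ hq0, qJ]; ring)
  rw [h2]
  exact hs.hasSum

/-! ### An antisymmetric rearrangement -/

/-- An unweighted triple series equals one with the weight `i - j`. With `c_i = p^{i²} / (Q;Q)_i`
and `Q = p²`, one has `p^{(i-1)²} / (Q;Q)_i = p c_i + c_{i-1}`. The first summand drops out, because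
`(i - j) c_i c_j` is antisymmetric. In the second one `i` is replaced by `i + 1`, which turns the
weight into `(i - j) + 1`, and the part with `i - j` drops out again. -/
theorem hasSum_antisymmetric {p Q : ℂ} (hp0 : p ≠ 0) (hQ : ‖Q‖ < 1) (hpQ : Q = p ^ 2)
    (W : ℕ → ℕ → ℂ)
    (h1 : Summable fun t : ℕ × ℕ × ℕ => ((t.1 : ℂ) - t.2.1) * invPoch Q t *
      (p ^ (t.1 ^ 2 + t.2.1 ^ 2) * W (t.1 + t.2.1) t.2.2))
    (h2 : Summable fun t : ℕ × ℕ × ℕ => ((t.1 : ℂ) - t.2.1) * invPoch Q t *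
      (p ^ (t.1 ^ 2 + t.2.1 ^ 2) * W (t.1 + t.2.1 + 1) t.2.2)) {s : ℂ}
    (h3 : HasSum (fun t : ℕ × ℕ × ℕ => invPoch Q t *
      (p ^ (t.1 ^ 2 + t.2.1 ^ 2) * W (t.1 + t.2.1 + 1) t.2.2)) s) :
    HasSum (fun t : ℕ × ℕ × ℕ => ((t.1 : ℂ) - t.2.1) * invPoch Q t *
      (p ^ (((t.1 : ℤ) - 1) ^ 2 + (t.2.1 : ℤ) ^ 2) * W (t.1 + t.2.1) t.2.2)) s := by
  have odd : ∀ (V : ℕ → ℕ → ℂ) (t : ℕ × ℕ × ℕ),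
      ((((swapFirstTwo t).1 : ℂ) - (swapFirstTwo t).2.1) * invPoch Q (swapFirstTwo t) *
        (p ^ ((swapFirstTwo t).1 ^ 2 + (swapFirstTwo t).2.1 ^ 2) *
          V ((swapFirstTwo t).1 + (swapFirstTwo t).2.1) (swapFirstTwo t).2.2)) =
      -(((t.1 : ℂ) - t.2.1) * invPoch Q t *
        (p ^ (t.1 ^ 2 + t.2.1 ^ 2) * V (t.1 + t.2.1) t.2.2)) := by
    rintro V ⟨i, j, k⟩
    simp only [swapFirstTwo, Equiv.coe_fn_mk]
    rw [invPoch_swap, add_comm (j ^ 2), add_comm j]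
    ring
  have z1 := h1.hasSum
  rw [z1.eq_zero_of_odd swapFirstTwo (odd W)] at z1
  have z2 := h2.hasSum
  rw [z2.eq_zero_of_odd swapFirstTwo (odd fun M k => W (M + 1) k)] at z2
  have h4 := z2.add h3
  rw [zero_add] at h4
  -- the terms coming from `c_{u-1}`, indexed by `u = i + 1`
  let shift : ℕ × ℕ × ℕ → ℕ × ℕ × ℕ := fun t => (t.1 + 1, t.2.1, t.2.2)
  have hinj : Function.Injective shift := fun t t' h => by
    simp only [shift, Prod.mk.injEq, add_left_inj] at h; ext <;> simp [h]
  let g : ℕ × ℕ × ℕ → ℂ := fun t => ((t.1 : ℂ) - t.2.1) *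
    ((1 - Q ^ t.1) * invPoch Q t) * (p ^ (((t.1 : ℤ) - 1) ^ 2 + (t.2.1 : ℤ) ^ 2) *
      W (t.1 + t.2.1) t.2.2)
  have hg : HasSum g s := by
    refine (hinj.hasSum_iff fun t ht => ?_).mp (h4.of_eq fun t => ?_)
    · have : t.1 = 0 := by
        by_contra h0
        exact ht ⟨(t.1 - 1, t.2.1, t.2.2), by
          simp only [shift]; ext <;> simp; lia⟩
      simp [g, this]
    · have hn := one_sub_mul_pow_ne_zero hQ hQ t.1
      rw [← pow_succ'] at hn
      have e1 : (1 - Q ^ (t.1 + 1)) * invPoch Q (shift t) = invPoch Q t := by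
        simp only [invPoch, shift, qPoch_self_succ, mul_inv]
        field_simp
      have e2 : (((t.1 + 1 : ℕ) : ℤ) - 1) ^ 2 + (t.2.1 : ℤ) ^ 2 =
          ((t.1 ^ 2 + t.2.1 ^ 2 : ℕ) : ℤ) := by push_cast; ring
      simp only [Function.comp_apply, g]
      have e3 : (shift t).1 = t.1 + 1 := rfl
      have e4 : (shift t).2.1 = t.2.1 := rfl
      have e5 : (shift t).2.2 = t.2.2 := rfl
      rw [e3, e1, e4, e5, e2, zpow_natCast, add_right_comm t.1 1]
      push_cast
      ring
  have h5 := (z1.mul_left p).add hg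
  rw [mul_zero, zero_add] at h5
  refine h5.of_eq fun t => ?_
  simp only [g]
  have e1 : p * p ^ (t.1 ^ 2 + t.2.1 ^ 2) =
      Q ^ t.1 * p ^ (((t.1 : ℤ) - 1) ^ 2 + (t.2.1 : ℤ) ^ 2) := by
    rw [hpQ, ← pow_mul, ← zpow_natCast, ← zpow_natCast, ← zpow_add₀ hp0]
    nth_rewrite 1 [← zpow_one p]
    rw [← zpow_add₀ hp0]
    congr 1; push_cast; ring
  linear_combination -(((t.1 : ℂ) - t.2.1) * invPoch Q t * W (t.1 + t.2.1) t.2.2) * e1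

/-! ### The two triple sums attached to `A` -/

lemma hasSum_linear_one_five {q : ℂ} (hq0 : q ≠ 0) (hq : ‖q‖ < 1) :
    HasSum (fun n : ℤ => (n : ℂ) * q ^ (3 * n ^ 2 + 2 * n))
      ((qJ 1 q ^ 2 * qJ 4 q ^ 2 / qJ 2 q -
        qJ 2 q ^ 2 * qJ 3 q * qJ 12 q / (qJ 1 q * qJ 4 q * qJ 6 q)) / 3) :=
  (((hasSum_weighted_one_five hq0 hq).sub (hasSum_theta_one_five hq0 hq)).div_const 3).of_eq
    fun n => by ring

lemma hasSum_linear_two_four {q : ℂ} (hq0 : q ≠ 0) (hq : ‖q‖ < 1) :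
    HasSum (fun n : ℤ => (n : ℂ) * q ^ (3 * n ^ 2 + n))
      ((qJ 2 q ^ 5 / qJ 4 q ^ 2 - qJ 4 q * qJ 6 q ^ 2 / (qJ 2 q * qJ 12 q)) / 6) :=
  (((hasSum_gordon hq0 hq).sub (hasSum_theta_two_four hq0 hq)).div_const 6).of_eq
    fun n => by ring

/-- The second triple series, multiplied by `q`. The antisymmetric rearrangement turns it into the
series with exponent `baseExp + 2 (i - j)` and weight `-(i - j)`. -/
lemma hasSum_base_second {q : ℂ} (hq0 : q ≠ 0) (hq : ‖q‖ < 1) :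
    HasSum (fun t : ℕ × ℕ × ℕ => invPoch (q ^ 4) t *
      q ^ ((2 * t.2.2 + t.1 + t.2.1 + 1) ^ 2 + 2 * t.1 ^ 2 + 2 * t.2.1 ^ 2 + 2 * t.1 + 2 * t.2.1))
      (-((qJ 1 q ^ 2 * qJ 4 q ^ 2 / qJ 2 q -
        qJ 2 q ^ 2 * qJ 3 q * qJ 12 q / (qJ 1 q * qJ 4 q * qJ 6 q)) / 3 / qJ 4 q)) := by
  have hQ := norm_pow_lt_one hq (m := 4) (by norm_num)
  have hT := tsum_base_eq hq0 hq (fun d => (d : ℂ))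
    ((summable_invPoch_mul_zpow hq0 hq hQ
      (e := fun t => (baseExp t : ℤ) + 2 * ((t.1 : ℤ) - t.2.1)) 2 fun i j k => by
        simp only [baseExp]; push_cast
        nlinarith [Int.natCast_nonneg i, Int.natCast_nonneg j, Int.natCast_nonneg k,
          mul_nonneg (Int.natCast_nonneg i) (Int.natCast_nonneg j),
          mul_nonneg (Int.natCast_nonneg i) (Int.natCast_nonneg k),
          mul_nonneg (Int.natCast_nonneg j) (Int.natCast_nonneg k),
          Int.le_self_sq (k : ℤ), sq_nonneg ((i : ℤ) - 1), sq_nonneg ((j : ℤ) - 1)]).2.congr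
      fun t => by push_cast; ring) (hasSum_linear_one_five hq0 hq)
  -- chosen so that `W (i + j + 1) k` carries the part of the exponent other than `2 i² + 2 j²`
  let W : ℕ → ℕ → ℂ := fun M k => q ^ ((2 * (k : ℤ) + M) ^ 2 + 2 * M - 2)
  have e1 : ∀ (m n : ℕ) (z : ℤ), (q ^ 2) ^ (m ^ 2 + n ^ 2) * q ^ z =
      q ^ (2 * (m : ℤ) ^ 2 + 2 * (n : ℤ) ^ 2 + z) := fun m n z => by
    rw [← pow_mul, ← zpow_natCast, ← zpow_add₀ hq0]; congr 1; push_cast; ring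
  have h1 : Summable fun t : ℕ × ℕ × ℕ => ((t.1 : ℂ) - t.2.1) * invPoch (q ^ 4) t *
      ((q ^ 2) ^ (t.1 ^ 2 + t.2.1 ^ 2) * W (t.1 + t.2.1) t.2.2) := by
    simp only [W, e1]
    refine (summable_invPoch_mul_zpow hq0 hq hQ 2 fun i j k => ?_).2
    push_cast
    nlinarith [Int.natCast_nonneg i, Int.natCast_nonneg j, Int.natCast_nonneg k,
          mul_nonneg (Int.natCast_nonneg i) (Int.natCast_nonneg j),
          mul_nonneg (Int.natCast_nonneg i) (Int.natCast_nonneg k),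
          mul_nonneg (Int.natCast_nonneg j) (Int.natCast_nonneg k),
          Int.le_self_sq (k : ℤ)]
  have hb : ∀ i j k : ℕ, (i : ℤ) + j + k - 2 ≤ 2 * (i : ℤ) ^ 2 + 2 * (j : ℤ) ^ 2 +
      ((2 * (k : ℤ) + (i + j + 1 : ℕ)) ^ 2 + 2 * (i + j + 1 : ℕ) - 2) := fun i j k => by
    push_cast
    nlinarith [Int.natCast_nonneg i, Int.natCast_nonneg j, Int.natCast_nonneg k,
          mul_nonneg (Int.natCast_nonneg i) (Int.natCast_nonneg j),
          mul_nonneg (Int.natCast_nonneg i) (Int.natCast_nonneg k),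
          mul_nonneg (Int.natCast_nonneg j) (Int.natCast_nonneg k),
          Int.le_self_sq (k : ℤ)]
  have h2 : Summable fun t : ℕ × ℕ × ℕ => ((t.1 : ℂ) - t.2.1) * invPoch (q ^ 4) t *
      ((q ^ 2) ^ (t.1 ^ 2 + t.2.1 ^ 2) * W (t.1 + t.2.1 + 1) t.2.2) := by
    simp only [W, e1]
    exact (summable_invPoch_mul_zpow hq0 hq hQ 2 hb).2
  have h3 : Summable fun t : ℕ × ℕ × ℕ => invPoch (q ^ 4) t *
      ((q ^ 2) ^ (t.1 ^ 2 + t.2.1 ^ 2) * W (t.1 + t.2.1 + 1) t.2.2) := by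
    simp only [W, e1]
    exact (summable_invPoch_mul_zpow hq0 hq hQ 2 hb).1
  have h := hasSum_antisymmetric (pow_ne_zero 2 hq0) hQ (by ring) W h1 h2 h3.hasSum
  have h4 := (swapFirstTwo.hasSum_iff.mpr h).unique (hT.neg.of_eq fun t => by
    obtain ⟨i, j, k⟩ := t
    simp only [Function.comp_apply, swapFirstTwo, Equiv.coe_fn_mk, W]
    rw [invPoch_swap]
    have e2 : (q ^ 2) ^ (((j : ℤ) - 1) ^ 2 + (i : ℤ) ^ 2) *
        q ^ ((2 * (k : ℤ) + (j + i : ℕ)) ^ 2 + 2 * (j + i : ℕ) - 2) =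
        q ^ ((baseExp (i, j, k) : ℤ) + 2 * ((i : ℤ) - j)) := by
      rw [← zpow_natCast, ← zpow_mul, ← zpow_add₀ hq0, baseExp]; congr 1; push_cast; ring
    rw [e2]
    push_cast
    ring)
  have h5 := h3.hasSum
  rw [h4] at h5
  refine h5.of_eq fun t => ?_
  simp only [W, e1]
  have e2 : (((2 * t.2.2 + t.1 + t.2.1 + 1) ^ 2 + 2 * t.1 ^ 2 + 2 * t.2.1 ^ 2 + 2 * t.1 +
      2 * t.2.1 : ℕ) : ℤ) = 2 * (t.1 : ℤ) ^ 2 + 2 * (t.2.1 : ℤ) ^ 2 +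
        ((2 * (t.2.2 : ℤ) + (t.1 + t.2.1 + 1 : ℕ)) ^ 2 + 2 * (t.1 + t.2.1 + 1 : ℕ) - 2) := by
    push_cast; ring
  rw [← e2, zpow_natCast]

/-- The first triple series is the series with exponent `baseExp + 2 (i - j)`, without weight, less
a shift of the second triple series. -/
lemma hasSum_base_first {q : ℂ} (hq0 : q ≠ 0) (hq : ‖q‖ < 1) :
    HasSum (fun t : ℕ × ℕ × ℕ => invPoch (q ^ 4) t *
      q ^ ((2 * t.2.2 + t.1 + t.2.1) ^ 2 + 2 * t.1 ^ 2 + 2 * t.2.1 ^ 2 + 2 * t.1 + 2 * t.2.1))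
      (qJ 2 q ^ 2 * qJ 3 q * qJ 12 q / (qJ 1 q * qJ 4 q * qJ 6 q) / qJ 4 q +
        (qJ 1 q ^ 2 * qJ 4 q ^ 2 / qJ 2 q -
        qJ 2 q ^ 2 * qJ 3 q * qJ 12 q / (qJ 1 q * qJ 4 q * qJ 6 q)) / 3 / qJ 4 q) := by
  have hQ := norm_pow_lt_one hq (m := 4) (by norm_num)
  have hT := tsum_base_eq hq0 hq (fun _ => 1)
    ((summable_invPoch_mul_zpow hq0 hq hQ
      (e := fun t => (baseExp t : ℤ) + 2 * ((t.1 : ℤ) - t.2.1)) 2 fun i j k => by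
        simp only [baseExp]; push_cast
        nlinarith [Int.natCast_nonneg i, Int.natCast_nonneg j, Int.natCast_nonneg k,
          mul_nonneg (Int.natCast_nonneg i) (Int.natCast_nonneg j),
          mul_nonneg (Int.natCast_nonneg i) (Int.natCast_nonneg k),
          mul_nonneg (Int.natCast_nonneg j) (Int.natCast_nonneg k),
          Int.le_self_sq (k : ℤ), sq_nonneg ((i : ℤ) - 1), sq_nonneg ((j : ℤ) - 1)]).1.congr
      fun t => by ring) ((hasSum_theta_one_five hq0 hq).of_eq fun n => one_mul _)
  -- split `q^{-2j}/(Q;Q)_j = q^{2j}/(Q;Q)_j + q^{-2j}/(Q;Q)_{j-1}`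
  let shift : ℕ × ℕ × ℕ → ℕ × ℕ × ℕ := fun t => (t.1, t.2.1 + 1, t.2.2)
  have hinj : Function.Injective shift := fun t t' h => by
    simp only [shift, Prod.mk.injEq, add_left_inj] at h; ext <;> simp [h]
  let g : ℕ × ℕ × ℕ → ℂ := fun t => ((1 - (q ^ 4) ^ t.2.1) * invPoch (q ^ 4) t) *
    q ^ ((baseExp t : ℤ) + 2 * ((t.1 : ℤ) - t.2.1))
  have hg : HasSum g (-((qJ 1 q ^ 2 * qJ 4 q ^ 2 / qJ 2 q -
      qJ 2 q ^ 2 * qJ 3 q * qJ 12 q / (qJ 1 q * qJ 4 q * qJ 6 q)) / 3 / qJ 4 q)) := by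
    refine (hinj.hasSum_iff fun t ht => ?_).mp ((hasSum_base_second hq0 hq).of_eq fun t => ?_)
    · have : t.2.1 = 0 := by
        by_contra h0
        exact ht ⟨(t.1, t.2.1 - 1, t.2.2), by
          simp only [shift]; ext <;> simp; lia⟩
      simp [g, this]
    · have hn := one_sub_mul_pow_ne_zero hQ hQ t.2.1
      rw [← pow_succ'] at hn
      have e1 : (1 - (q ^ 4) ^ (t.2.1 + 1)) * invPoch (q ^ 4) (shift t) = invPoch (q ^ 4) t := by
        simp only [invPoch, shift, qPoch_self_succ, mul_inv]
        field_simp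
      have e4 : (shift t).2.1 = t.2.1 + 1 := rfl
      simp only [Function.comp_apply, g]
      rw [e4, e1]
      congr 1
      rw [← zpow_natCast]
      congr 1
      simp only [shift, baseExp]
      push_cast; ring
  have h := hT.sub hg
  rw [sub_neg_eq_add] at h
  refine h.of_eq fun t => ?_
  simp only [g]
  have e2 : q ^ ((2 * t.2.2 + t.1 + t.2.1) ^ 2 + 2 * t.1 ^ 2 + 2 * t.2.1 ^ 2 + 2 * t.1 +
      2 * t.2.1) = (q ^ 4) ^ t.2.1 * q ^ ((baseExp t : ℤ) + 2 * ((t.1 : ℤ) - t.2.1)) := by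
    rw [← pow_mul, ← zpow_natCast, ← zpow_natCast, ← zpow_add₀ hq0, baseExp]
    congr 1; push_cast; ring
  rw [e2]
  ring

theorem hasSum_first {q : ℂ} (hq : ‖q‖ < 1) :
    HasSum
      (fun p : ℕ × ℕ × ℕ =>
        q ^ (3 * p.1 ^ 2 + 3 * p.2.1 ^ 2 + 4 * p.2.2 ^ 2 + 2 * p.1 * p.2.1 + 4 * p.1 * p.2.2
            + 4 * p.2.1 * p.2.2 + 2 * p.1 + 2 * p.2.1) /
          (qPoch (q ^ 4) (q ^ 4) p.1 * qPoch (q ^ 4) (q ^ 4) p.2.1 *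
            qPoch (q ^ 4) (q ^ 4) p.2.2))
      (1 / 3 * (qJ 1 q ^ 2 * qJ 4 q / qJ 2 q) +
        2 / 3 * (qJ 2 q ^ 2 * qJ 3 q * qJ 12 q / (qJ 1 q * qJ 4 q ^ 2 * qJ 6 q))) := by
  rcases eq_or_ne q 0 with rfl | hq0
  · have hJ : ∀ m, m ≠ 0 → qJ m 0 = 1 := fun m hm => by
      simp [qJ, hm, qPochInf_zero_left]
    have hv : (1 / 3 * (qJ 1 0 ^ 2 * qJ 4 0 / qJ 2 0) +
        2 / 3 * (qJ 2 0 ^ 2 * qJ 3 0 * qJ 12 0 / (qJ 1 0 * qJ 4 0 ^ 2 * qJ 6 0))) = 1 := by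
      rw [hJ 1 (by norm_num), hJ 2 (by norm_num), hJ 3 (by norm_num), hJ 4 (by norm_num),
        hJ 6 (by norm_num), hJ 12 (by norm_num)]
      norm_num
    rw [hv]
    have h := hasSum_single (f := fun p : ℕ × ℕ × ℕ =>
        (0 : ℂ) ^ (3 * p.1 ^ 2 + 3 * p.2.1 ^ 2 + 4 * p.2.2 ^ 2 + 2 * p.1 * p.2.1 + 4 * p.1 * p.2.2
            + 4 * p.2.1 * p.2.2 + 2 * p.1 + 2 * p.2.1) /
          (qPoch (0 ^ 4) (0 ^ 4) p.1 * qPoch (0 ^ 4) (0 ^ 4) p.2.1 *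
            qPoch (0 ^ 4) (0 ^ 4) p.2.2)) (0, 0, 0) ?_
    · simpa [qPoch] using h
    · rintro ⟨i, j, k⟩ h
      have : 3 * i ^ 2 + 3 * j ^ 2 + 4 * k ^ 2 + 2 * i * j + 4 * i * k + 4 * j * k + 2 * i + 2 * j
          ≠ 0 := by
        contrapose! h
        have h1 : i = 0 := by nlinarith
        have h2 : j = 0 := by nlinarith
        have h3 : k ^ 2 = 0 := by nlinarith
        simp_all
      simp only [zero_pow this, zero_div]
  · have n1 := qJ_ne_zero hq one_ne_zero
    have n2 := qJ_ne_zero hq two_ne_zero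
    have n4 := qJ_ne_zero hq (m := 4) (by norm_num)
    have n6 := qJ_ne_zero hq (m := 6) (by norm_num)
    have hv : (1 / 3 * (qJ 1 q ^ 2 * qJ 4 q / qJ 2 q) +
        2 / 3 * (qJ 2 q ^ 2 * qJ 3 q * qJ 12 q / (qJ 1 q * qJ 4 q ^ 2 * qJ 6 q))) =
        qJ 2 q ^ 2 * qJ 3 q * qJ 12 q / (qJ 1 q * qJ 4 q * qJ 6 q) / qJ 4 q +
        (qJ 1 q ^ 2 * qJ 4 q ^ 2 / qJ 2 q -
        qJ 2 q ^ 2 * qJ 3 q * qJ 12 q / (qJ 1 q * qJ 4 q * qJ 6 q)) / 3 / qJ 4 q := by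
      field_simp; ring
    rw [hv]
    refine (hasSum_base_first hq0 hq).of_eq fun t => ?_
    rw [invPoch, div_eq_inv_mul]
    congr 2; ring

theorem hasSum_second {q : ℂ} (hq : ‖q‖ < 1) (hq0 : q ≠ 0) :
    HasSum
      (fun p : ℕ × ℕ × ℕ =>
        q ^ (3 * p.1 ^ 2 + 3 * p.2.1 ^ 2 + 4 * p.2.2 ^ 2 + 2 * p.1 * p.2.1 + 4 * p.1 * p.2.2
            + 4 * p.2.1 * p.2.2 + 4 * p.1 + 4 * p.2.1 + 4 * p.2.2) /
          (qPoch (q ^ 4) (q ^ 4) p.1 * qPoch (q ^ 4) (q ^ 4) p.2.1 *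
            qPoch (q ^ 4) (q ^ 4) p.2.2))
      (-(1 / 3) * q⁻¹ * (qJ 1 q ^ 2 * qJ 4 q / qJ 2 q) +
        1 / 3 * q⁻¹ *
          (qJ 2 q ^ 2 * qJ 3 q * qJ 12 q / (qJ 1 q * qJ 4 q ^ 2 * qJ 6 q))) := by
  have n1 := qJ_ne_zero hq one_ne_zero
  have n2 := qJ_ne_zero hq two_ne_zero
  have n4 := qJ_ne_zero hq (m := 4) (by norm_num)
  have n6 := qJ_ne_zero hq (m := 6) (by norm_num)
  have hv : (-(1 / 3) * q⁻¹ * (qJ 1 q ^ 2 * qJ 4 q / qJ 2 q) + 1 / 3 * q⁻¹ *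
      (qJ 2 q ^ 2 * qJ 3 q * qJ 12 q / (qJ 1 q * qJ 4 q ^ 2 * qJ 6 q))) =
      q⁻¹ * (-((qJ 1 q ^ 2 * qJ 4 q ^ 2 / qJ 2 q -
        qJ 2 q ^ 2 * qJ 3 q * qJ 12 q / (qJ 1 q * qJ 4 q * qJ 6 q)) / 3 / qJ 4 q)) := by
    field_simp; ring
  rw [hv]
  refine ((hasSum_base_second hq0 hq).mul_left q⁻¹).of_eq fun t => ?_
  have e : (2 * t.2.2 + t.1 + t.2.1 + 1) ^ 2 + 2 * t.1 ^ 2 + 2 * t.2.1 ^ 2 + 2 * t.1 + 2 * t.2.1 =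
      (3 * t.1 ^ 2 + 3 * t.2.1 ^ 2 + 4 * t.2.2 ^ 2 + 2 * t.1 * t.2.1 + 4 * t.1 * t.2.2
            + 4 * t.2.1 * t.2.2 + 4 * t.1 + 4 * t.2.1 + 4 * t.2.2) + 1 := by ring
  rw [e, pow_add q _ 1, pow_one, invPoch, div_eq_inv_mul]
  field_simp
  ring

/-! ### The two triple sums attached to `A⋆` -/

lemma qPoch_succ_left (a q : ℂ) (n : ℕ) : qPoch a q (n + 1) = (1 - a) * qPoch (a * q) q n := by
  simp only [qPoch, prod_range_succ', pow_zero, mul_one]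
  rw [mul_comm]
  congr 1
  exact prod_congr rfl fun k _ => by ring

/-- The numerator of a term of Heine's sum, with the product reversed. -/
lemma pow_mul_qPoch_reversed {Q : ℂ} (hQ0 : Q ≠ 0) (s : ℂ) (e v : ℕ) :
    Q ^ (v ^ 2 + v * e) * qPoch (-(s / Q ^ v)) Q v =
      (-1) ^ v * Q ^ (v.choose 2) * ∏ l ∈ range v, (-(s * Q ^ e) - Q ^ (e + 1) * Q ^ l) := by
  induction v with
  | zero => simp [qPoch]
  | succ v ih =>
    have hch : (v + 1).choose 2 = v + v.choose 2 := by
      rw [Nat.choose_succ_succ' v 1, Nat.choose_one_right]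
    have e1 : -(s / Q ^ (v + 1)) * Q = -(s / Q ^ v) := by rw [pow_succ]; field_simp
    have e2 : (v + 1) ^ 2 + (v + 1) * e = (v ^ 2 + v * e) + (2 * v + 1 + e) := by ring
    rw [qPoch_succ_left, e1, prod_range_succ, hch, e2, pow_add, pow_succ (-1 : ℂ)]
    have e3 : Q ^ (2 * v + 1 + e) * (1 - -(s / Q ^ (v + 1))) =
        -(Q ^ v * (-(s * Q ^ e) - Q ^ (e + 1) * Q ^ v)) := by
      field_simp
      ring
    rw [pow_add Q v]
    linear_combination (Q ^ (2 * v + 1 + e) * (1 - -(s / Q ^ (v + 1)))) * ih +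
      ((-1) ^ v * Q ^ (v.choose 2) *
        ∏ l ∈ range v, (-(s * Q ^ e) - Q ^ (e + 1) * Q ^ l)) * e3

/-- The part of the triple series with `i - j = e`, where `v` is the smaller of `i` and `j`: the sum
over `k` is Euler's, and then the sum over `v` is Heine's. -/
lemma hasSum_fiber {p : ℂ} (hp0 : p ≠ 0) (hp : ‖p‖ < 1) (s : ℂ) (e : ℕ)
    (hs : Summable fun x : ℕ × ℕ => invPoch (p ^ 2) (x.1 + e, x.1, x.2) *
      (p ^ (2 * x.1 ^ 2 + 2 * x.1 * e) * (p ^ (x.2 ^ 2) * (s / (p * (p ^ 2) ^ x.1)) ^ x.2))) :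
    HasSum (fun x : ℕ × ℕ => invPoch (p ^ 2) (x.1 + e, x.1, x.2) *
      (p ^ (2 * x.1 ^ 2 + 2 * x.1 * e) * (p ^ (x.2 ^ 2) * (s / (p * (p ^ 2) ^ x.1)) ^ x.2)))
      (qPochInf (-s) (p ^ 2) * qPochInf (-(s * (p ^ 2) ^ e)) (p ^ 2) /
        qPochInf (p ^ 2) (p ^ 2)) := by
  have hQ := norm_pow_lt_one hp two_ne_zero
  have hQ0 : p ^ 2 ≠ 0 := pow_ne_zero 2 hp0
  have hQe := norm_pow_lt_one hQ (m := e + 1) (by lia)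
  have h1 := hs.hasSum.prod_fiberwise fun v => by
    have h := hasSum_euler hQ (-(s / (p * (p ^ 2) ^ v) * p))
    simp_rw [pow_sq_mul_pow_eq] at h
    refine (h.mul_left ((qPoch (p ^ 2) (p ^ 2) (v + e) * qPoch (p ^ 2) (p ^ 2) v)⁻¹ *
      p ^ (2 * v ^ 2 + 2 * v * e))).of_eq fun k => ?_
    simp only [invPoch]
    rw [mul_inv _ (qPoch (p ^ 2) (p ^ 2) k), div_eq_mul_inv]
    ring
  have h2 := (hasSum_heineTerm hQe hQ (-(s * (p ^ 2) ^ e))).mul_left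
    (qPochInf (-s) (p ^ 2) / qPoch (p ^ 2) (p ^ 2) e)
  have h3 := h1.unique (h2.of_eq fun v => by
    have e1 : -(s / (p * (p ^ 2) ^ v) * p) = -(s / (p ^ 2) ^ v) := by field_simp
    have e2 : -(s / (p ^ 2) ^ v) * (p ^ 2) ^ v = -s := by field_simp
    have e3 := pow_mul_qPoch_reversed hQ0 s e v
    rw [← pow_mul] at e3
    have e4 : 2 * (v ^ 2 + v * e) = 2 * v ^ 2 + 2 * v * e := by ring
    rw [e4] at e3
    rw [e1, qPochInf_eq_mul _ hQ v, e2, heineTerm, ← e3, add_comm v e, qPoch_self_add, mul_inv,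
      mul_inv]
    ring)
  have hv : qPochInf (-s) (p ^ 2) / qPoch (p ^ 2) (p ^ 2) e *
      (qPochInf (-(s * (p ^ 2) ^ e)) (p ^ 2) / qPochInf ((p ^ 2) ^ (e + 1)) (p ^ 2)) =
      qPochInf (-s) (p ^ 2) * qPochInf (-(s * (p ^ 2) ^ e)) (p ^ 2) /
        qPochInf (p ^ 2) (p ^ 2) := by
    rw [qPochInf_self_eq hQ e, div_mul_div_comm]
  rw [← hv, ← h3]
  exact hs.hasSum

/-- The product `(-p^{c-d};p²)_∞ (-p^{c+d};p²)_∞`. -/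
def thetaFactor (p : ℂ) (c d : ℤ) : ℂ :=
  qPochInf (-p ^ (c - d)) (p ^ 2) * qPochInf (-p ^ (c + d)) (p ^ 2)

lemma thetaFactor_neg (p : ℂ) (c d : ℤ) : thetaFactor p c (-d) = thetaFactor p c d := by
  rw [thetaFactor, thetaFactor, mul_comm, sub_neg_eq_add, ← sub_eq_add_neg]

/-- The exponent `i² + j² + k² - (i+j)k + i + j + (b-1)k` of `p = q^{1/2}` in the series attached to
`A⋆`; the two linear terms correspond to `b = 0` and `b = 1`. -/
def dualExp (b : ℕ) (t : ℕ × ℕ × ℕ) : ℤ :=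
  (t.1 : ℤ) ^ 2 + (t.2.1 : ℤ) ^ 2 + (t.2.2 : ℤ) ^ 2 - (t.1 + t.2.1) * t.2.2 + t.1 + t.2.1 +
    ((b : ℤ) - 1) * t.2.2

lemma le_dualExp (b i j k : ℕ) : (i : ℤ) + j + k - 2 ≤ dualExp b (i, j, k) := by
  simp only [dualExp]
  nlinarith [sq_nonneg (2 * (i : ℤ) - k), sq_nonneg (2 * (j : ℤ) - k), sq_nonneg ((k : ℤ) - 2),
    mul_nonneg (Int.natCast_nonneg b) (Int.natCast_nonneg k)]

lemma summable_dual {p : ℂ} (hp0 : p ≠ 0) (hp : ‖p‖ < 1) (b : ℕ) :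
    Summable fun t : ℕ × ℕ × ℕ => invPoch (p ^ 2) t * p ^ dualExp b t :=
  (summable_invPoch_mul_zpow hp0 hp (norm_pow_lt_one hp two_ne_zero) 2 (le_dualExp b)).1

/-- The triple sum as a series over `ℤ` with the weight `d`, by the antisymmetric rearrangement. -/
theorem hasSum_dual_theta {p : ℂ} (hp0 : p ≠ 0) (hp : ‖p‖ < 1) (b : ℕ) :
    HasSum (fun d : ℤ => (d : ℂ) * (p ^ (d ^ 2 - d) * thetaFactor p (1 + b) d))
      (qJ 2 p * ∑' t : ℕ × ℕ × ℕ, invPoch (p ^ 2) t * p ^ dualExp b t) := by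
  have hQ := norm_pow_lt_one hp two_ne_zero
  have hJ : qPochInf (p ^ 2) (p ^ 2) ≠ 0 := qJ_ne_zero hp two_ne_zero
  -- chosen so that `W (i + j + 1) k` carries the part of `dualExp` other than `i² + j²`
  let W : ℕ → ℕ → ℂ := fun M k =>
    p ^ ((k : ℤ) ^ 2 - k * ((M : ℤ) - 1) + M - 1 + ((b : ℤ) - 1) * k)
  have e1 : ∀ (m n : ℕ) (z : ℤ), p ^ (m ^ 2 + n ^ 2) * p ^ z =
      p ^ ((m : ℤ) ^ 2 + (n : ℤ) ^ 2 + z) := fun m n z => by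
    rw [← zpow_natCast, ← zpow_add₀ hp0]; push_cast; rfl
  have h1 : Summable fun t : ℕ × ℕ × ℕ => ((t.1 : ℂ) - t.2.1) * invPoch (p ^ 2) t *
      (p ^ (t.1 ^ 2 + t.2.1 ^ 2) * W (t.1 + t.2.1) t.2.2) := by
    simp only [W, e1]
    refine (summable_invPoch_mul_zpow hp0 hp hQ 3 fun i j k => ?_).2
    have := le_dualExp b i j k
    simp only [dualExp] at this
    push_cast
    linarith [Int.natCast_nonneg k]
  have hb : ∀ t : ℕ × ℕ × ℕ, p ^ (t.1 ^ 2 + t.2.1 ^ 2) * W (t.1 + t.2.1 + 1) t.2.2 =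
      p ^ dualExp b t := fun t => by
    simp only [W, e1, dualExp]
    congr 1; push_cast; ring
  have h := hasSum_antisymmetric hp0 hQ rfl W h1 (by
      simp only [hb]; exact (summable_invPoch_mul_zpow hp0 hp hQ 2 (le_dualExp b)).2)
    ((summable_dual hp0 hp b).hasSum.of_eq fun t => by rw [hb])
  have hs : Summable fun t : ℕ × ℕ × ℕ => invPoch (p ^ 2) t *
      p ^ ((t.1 : ℤ) ^ 2 + (t.2.1 : ℤ) ^ 2 + (t.2.2 : ℤ) ^ 2 - (t.1 + t.2.1) * t.2.2 + b * t.2.2) :=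
    (summable_invPoch_mul_zpow hp0 hp hQ 4 fun i j k => by
      simp only
      nlinarith [sq_nonneg (2 * (i : ℤ) - k - 1), sq_nonneg (2 * (j : ℤ) - k - 1),
        sq_nonneg ((k : ℤ) - 2), mul_nonneg (Int.natCast_nonneg b) (Int.natCast_nonneg k)]).1
  have key : ∀ e : ℕ, HasSum (fun x : ℕ × ℕ => invPoch (p ^ 2) (x.1 + e, x.1, x.2) *
      p ^ (2 * (x.1 : ℤ) ^ 2 + 2 * x.1 * e + (x.2 : ℤ) ^ 2 - (2 * x.1 + e) * x.2 + b * x.2))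
      (thetaFactor p (1 + b) e / qPochInf (p ^ 2) (p ^ 2)) := fun e => by
    have e2 : ∀ x : ℕ × ℕ,
        p ^ (2 * (x.1 : ℤ) ^ 2 + 2 * x.1 * e + (x.2 : ℤ) ^ 2 - (2 * x.1 + e) * x.2 + b * x.2) =
        p ^ (2 * x.1 ^ 2 + 2 * x.1 * e) *
          (p ^ (x.2 ^ 2) * (p ^ (1 + b - e : ℤ) / (p * (p ^ 2) ^ x.1)) ^ x.2) := fun x => by
      have e3 : p ^ (1 + b - e : ℤ) / (p * (p ^ 2) ^ x.1) = p ^ ((b : ℤ) - e - 2 * x.1) := by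
        rw [← pow_mul, ← pow_succ', ← zpow_natCast, ← zpow_sub₀ hp0]
        congr 1; push_cast; ring
      rw [e3, ← zpow_natCast, ← zpow_natCast, ← zpow_natCast, ← zpow_mul, ← zpow_add₀ hp0,
        ← zpow_add₀ hp0]
      congr 1; push_cast; ring
    have e4 : thetaFactor p (1 + b) e / qPochInf (p ^ 2) (p ^ 2) =
        qPochInf (-p ^ (1 + b - e : ℤ)) (p ^ 2) *
          qPochInf (-(p ^ (1 + b - e : ℤ) * (p ^ 2) ^ e)) (p ^ 2) / qPochInf (p ^ 2) (p ^ 2) := by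
      have : p ^ (1 + b - e : ℤ) * (p ^ 2) ^ e = p ^ (1 + b + e : ℤ) := by
        rw [← pow_mul, ← zpow_natCast, ← zpow_add₀ hp0]
        congr 1; push_cast; ring
      rw [this, thetaFactor]
    rw [e4]
    refine (hasSum_fiber hp0 hp (p ^ (1 + b - e : ℤ)) e ?_).of_eq fun x => by rw [e2]
    refine ((hs.comp_injective (i := fun x : ℕ × ℕ => (x.1 + e, x.1, x.2)) fun p p' h => by
        simp only [Prod.mk.injEq] at h; ext <;> simp [h]).mul_left (p ^ (-(e : ℤ) ^ 2))).congr
      fun x => ?_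
    rw [← e2, Function.comp_apply, mul_left_comm, ← zpow_add₀ hp0]
    congr 2; push_cast; ring
  have h5 := h.by_difference₃
    (g := fun d : ℤ => (d : ℂ) * (p ^ (d ^ 2 - d) * thetaFactor p (1 + b) d) /
      qPochInf (p ^ 2) (p ^ 2)) fun d => by
    obtain ⟨e, rfl | rfl⟩ := d.eq_nat_or_neg
    · have hk := (key e).mul_left ((e : ℂ) * p ^ ((e : ℤ) ^ 2 - e))
      rw [mul_div_assoc, mul_div_assoc, ← mul_assoc, Int.cast_natCast]
      refine hk.of_eq fun x => ?_
      simp only [Int.toNat_natCast, Int.toNat_neg_natCast, add_zero, W]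
      have e2 : p ^ ((((x.1 + e : ℕ) : ℤ) - 1) ^ 2 + (x.1 : ℤ) ^ 2) *
          p ^ ((x.2 : ℤ) ^ 2 - x.2 * (((x.1 + e + x.1 : ℕ) : ℤ) - 1) + (x.1 + e + x.1 : ℕ) - 1 +
            ((b : ℤ) - 1) * x.2) = p ^ ((e : ℤ) ^ 2 - e) *
          p ^ (2 * (x.1 : ℤ) ^ 2 + 2 * x.1 * e + (x.2 : ℤ) ^ 2 - (2 * x.1 + e) * x.2 + b * x.2) := by
        rw [← zpow_add₀ hp0, ← zpow_add₀ hp0]; congr 1; push_cast; ring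
      rw [e2]
      push_cast
      ring
    · have hk := (key e).mul_left (-(e : ℂ) * p ^ ((e : ℤ) ^ 2 + e))
      rw [mul_div_assoc, mul_div_assoc, ← mul_assoc, thetaFactor_neg, neg_sq, sub_neg_eq_add,
        Int.cast_neg, Int.cast_natCast]
      refine hk.of_eq fun x => ?_
      simp only [neg_neg, Int.toNat_natCast, Int.toNat_neg_natCast, add_zero, W]
      have e2 : p ^ (((x.1 : ℤ) - 1) ^ 2 + ((x.1 + e : ℕ) : ℤ) ^ 2) *
          p ^ ((x.2 : ℤ) ^ 2 - x.2 * (((x.1 + (x.1 + e) : ℕ) : ℤ) - 1) + (x.1 + (x.1 + e) : ℕ) - 1 +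
            ((b : ℤ) - 1) * x.2) = p ^ ((e : ℤ) ^ 2 + e) *
          p ^ (2 * (x.1 : ℤ) ^ 2 + 2 * x.1 * e + (x.2 : ℤ) ^ 2 - (2 * x.1 + e) * x.2 + b * x.2) := by
        rw [← zpow_add₀ hp0, ← zpow_add₀ hp0]; congr 1; push_cast; ring
      rw [e2, invPoch_swap]
      push_cast
      ring
  have h6 := h5.mul_left (qPochInf (p ^ 2) (p ^ 2))
  exact h6.of_eq fun d => by field_simp

lemma HasSum.int_even_odd {f : ℤ → ℂ} {a b : ℂ} (he : HasSum (fun m : ℤ => f (2 * m)) a)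
    (ho : HasSum (fun m : ℤ => f (2 * m + 1)) b) : HasSum f (a + b) := by
  have h := mul_right_injective₀ (two_ne_zero' ℤ)
  replace ho := ((add_left_injective 1).comp h).hasSum_range_iff.2 ho
  refine (h.hasSum_range_iff.2 he).add_isCompl ?_ ho
  simpa [Function.comp_def] using Int.isCompl_even_odd

lemma qPochInf_neg_zpow {p : ℂ} (hp0 : p ≠ 0) (hp : ‖p‖ < 1) (n : ℤ) :
    qPochInf (-p ^ n) (p ^ 2) = (1 + p ^ n) * qPochInf (-p ^ (n + 2)) (p ^ 2) := by
  rw [qPochInf_succ _ (norm_pow_lt_one hp two_ne_zero), sub_neg_eq_add, neg_mul, zpow_add₀ hp0]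
  norm_cast

/-- The quasi-periodicity of `thetaFactor`, by which it is a power of `p` times a constant on each
parity class. -/
lemma thetaFactor_one_add_two {p : ℂ} (hp0 : p ≠ 0) (hp : ‖p‖ < 1) (d : ℤ) :
    thetaFactor p 1 (d + 2) = p ^ (-1 - d) * thetaFactor p 1 d := by
  have h1 := qPochInf_neg_zpow hp0 hp (-1 - d)
  have h2 := qPochInf_neg_zpow hp0 hp (1 + d)
  have h3 : p ^ (-1 - d) * p ^ (1 + d) = 1 := by
    rw [← zpow_add₀ hp0]; ring_nf; simp
  rw [thetaFactor, thetaFactor, show (1 : ℤ) - (d + 2) = -1 - d by ring, h1, h2,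
    show -1 - d + 2 = 1 - d by ring, show (1 : ℤ) + (d + 2) = 1 + d + 2 by ring]
  linear_combination (-(qPochInf (-p ^ (1 - d)) (p ^ 2) * qPochInf (-p ^ (1 + d + 2)) (p ^ 2))) * h3

/-- A function on `ℤ` that is multiplied by `p^{r(m)}` from `m` to `m + 1` is a multiple of
`p^{s(m)}`, where `s` sums `r`. -/
lemma eq_of_zpow_recurrence {p : ℂ} (hp0 : p ≠ 0) {g : ℤ → ℂ} {r : ℤ → ℤ} {s : ℤ → ℤ}
    (hg : ∀ m, g (m + 1) = p ^ r m * g m) (hs : ∀ m, s (m + 1) = r m + s m) (hs0 : s 0 = 0)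
    (m : ℤ) : g m = g 0 * p ^ s m := by
  have hstep : ∀ m, g (m + 1) = g 0 * p ^ s (m + 1) ↔ g m = g 0 * p ^ s m := fun m => by
    rw [hg, hs, zpow_add₀ hp0, mul_left_comm]
    exact mul_right_inj' (zpow_ne_zero _ hp0)
  induction m with
  | zero => simp [hs0]
  | succ i ih => exact (hstep _).mpr ih
  | pred i ih =>
    refine (hstep _).mp ?_
    rwa [sub_add_cancel]

lemma thetaFactor_even {p : ℂ} (hp0 : p ≠ 0) (hp : ‖p‖ < 1) (m : ℤ) :
    thetaFactor p 1 (2 * m) = (qJ 2 p ^ 2 / (qJ 1 p * qJ 4 p)) ^ 2 * p ^ (-m ^ 2) := by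
  have h0 : thetaFactor p 1 (2 * 0) = (qJ 2 p ^ 2 / (qJ 1 p * qJ 4 p)) ^ 2 := by
    simp only [thetaFactor, mul_zero, sub_zero, add_zero, zpow_one, qPochInf_neg_odd hp]
    ring
  rw [← h0]
  refine eq_of_zpow_recurrence hp0 (g := fun m => thetaFactor p 1 (2 * m))
    (r := fun m => -1 - 2 * m) (s := fun m => -m ^ 2) (fun m => ?_) (fun m => by ring) (by simp) m
  rw [mul_add, mul_one, thetaFactor_one_add_two hp0 hp]

lemma thetaFactor_odd {p : ℂ} (hp0 : p ≠ 0) (hp : ‖p‖ < 1) (m : ℤ) :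
    thetaFactor p 1 (2 * m + 1) = 2 * (qJ 4 p / qJ 2 p) ^ 2 * p ^ (-m ^ 2 - m) := by
  have h0 : thetaFactor p 1 (2 * 0 + 1) = 2 * (qJ 4 p / qJ 2 p) ^ 2 := by
    have h := qPochInf_neg_zpow hp0 hp 0
    have h2 := qPochInf_neg_even hp
    have e : qPochInf (-p ^ (0 + 2 : ℤ)) (p ^ 2) = qPochInf (-p ^ 2) (p ^ 2) := by norm_cast
    have e2 : qPochInf (-p ^ (2 : ℤ)) (p ^ 2) = qPochInf (-p ^ 2) (p ^ 2) := by norm_cast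
    simp only [thetaFactor, mul_zero, zero_add, sub_self, one_add_one_eq_two]
    rw [h, e, e2, h2, zpow_zero]
    ring
  rw [← h0]
  refine eq_of_zpow_recurrence hp0 (g := fun m => thetaFactor p 1 (2 * m + 1))
    (r := fun m => -2 - 2 * m) (s := fun m => -m ^ 2 - m) (fun m => ?_) (fun m => by ring)
    (by simp) m
  rw [show 2 * (m + 1) + 1 = (2 * m + 1) + 2 by ring, thetaFactor_one_add_two hp0 hp]
  congr 2; ring

/-- The even `d` and the odd `d` give weighted theta series of weight `3/2`, whose products with the
constants of `thetaFactor` are multiples of `(p²;p²)_∞³` and cancel. Only unweighted theta series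
remain. -/
lemma hasSum_dual_theta_zero {p : ℂ} (hp0 : p ≠ 0) (hp : ‖p‖ < 1) :
    HasSum (fun d : ℤ => (d : ℂ) * (p ^ (d ^ 2 - d) * thetaFactor p 1 d))
      (2 / 3 * ((qJ 2 p ^ 2 / (qJ 1 p * qJ 4 p)) ^ 2 *
        (qJ 2 p ^ 2 * qJ 3 p * qJ 12 p / (qJ 1 p * qJ 4 p * qJ 6 p)) +
        2 * (qJ 4 p / qJ 2 p) ^ 2 * (qJ 4 p * qJ 6 p ^ 2 / (qJ 2 p * qJ 12 p)))) := by
  have n1 := qJ_ne_zero hp one_ne_zero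
  have n2 := qJ_ne_zero hp two_ne_zero
  have n4 := qJ_ne_zero hp (m := 4) (by norm_num)
  have n6 := qJ_ne_zero hp (m := 6) (by norm_num)
  have n12 := qJ_ne_zero hp (m := 12) (by norm_num)
  have he := (Equiv.neg ℤ).hasSum_iff.mpr ((hasSum_linear_one_five hp0 hp).mul_left
    (-2 * (qJ 2 p ^ 2 / (qJ 1 p * qJ 4 p)) ^ 2))
  have ho := (((hasSum_gordon hp0 hp).add ((hasSum_theta_two_four hp0 hp).mul_left 2)).mul_left
    (2 / 3 * (qJ 4 p / qJ 2 p) ^ 2))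
  have h := HasSum.int_even_odd (f := fun d : ℤ => (d : ℂ) * (p ^ (d ^ 2 - d) * thetaFactor p 1 d))
    (he.of_eq fun m => ?_) (ho.of_eq fun m => ?_)
  · convert! h using 1
    field_simp
    ring
  · rw [thetaFactor_even hp0 hp, mul_left_comm (p ^ _), ← zpow_add₀ hp0]
    simp only [Function.comp_apply, Equiv.neg_apply]
    rw [show (2 * m) ^ 2 - 2 * m + -m ^ 2 = 3 * (-m) ^ 2 + 2 * (-m) by ring]
    push_cast
    ring
  · rw [thetaFactor_odd hp0 hp, mul_left_comm (p ^ _), ← zpow_add₀ hp0]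
    rw [show (2 * m + 1) ^ 2 - (2 * m + 1) + (-m ^ 2 - m) = 3 * m ^ 2 + m by ring]
    push_cast
    ring

/-- The terms of weight `3/2` cancel as for `hasSum_dual_theta_zero`. -/
lemma hasSum_dual_theta_one {p : ℂ} (hp0 : p ≠ 0) (hp : ‖p‖ < 1) :
    HasSum (fun d : ℤ => (d : ℂ) * (p ^ (d ^ 2 - d) * thetaFactor p 1 (d - 1)))
      (1 / 3 * ((qJ 2 p ^ 2 / (qJ 1 p * qJ 4 p)) ^ 2 *
        (qJ 2 p ^ 2 * qJ 3 p * qJ 12 p / (qJ 1 p * qJ 4 p * qJ 6 p)) +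
        2 * (qJ 4 p / qJ 2 p) ^ 2 * (qJ 4 p * qJ 6 p ^ 2 / (qJ 2 p * qJ 12 p)))) := by
  have n1 := qJ_ne_zero hp one_ne_zero
  have n2 := qJ_ne_zero hp two_ne_zero
  have n4 := qJ_ne_zero hp (m := 4) (by norm_num)
  have n6 := qJ_ne_zero hp (m := 6) (by norm_num)
  have n12 := qJ_ne_zero hp (m := 12) (by norm_num)
  have ho := (((hasSum_linear_one_five hp0 hp).mul_left 2).add
    (hasSum_theta_one_five hp0 hp)).mul_left ((qJ 2 p ^ 2 / (qJ 1 p * qJ 4 p)) ^ 2)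
  have he := (Equiv.neg ℤ).hasSum_iff.mpr ((hasSum_linear_two_four hp0 hp).mul_left
    (-4 * (qJ 4 p / qJ 2 p) ^ 2))
  have h := HasSum.int_even_odd
    (f := fun d : ℤ => (d : ℂ) * (p ^ (d ^ 2 - d) * thetaFactor p 1 (d - 1)))
    (he.of_eq fun m => ?_) (ho.of_eq fun m => ?_)
  · convert! h using 1
    field_simp
    ring
  · rw [show 2 * m - 1 = 2 * (m - 1) + 1 by ring, thetaFactor_odd hp0 hp, mul_left_comm (p ^ _),
      ← zpow_add₀ hp0]
    simp only [Function.comp_apply, Equiv.neg_apply]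
    rw [show (2 * m) ^ 2 - 2 * m + (-(m - 1) ^ 2 - (m - 1)) = 3 * (-m) ^ 2 + (-m) by ring]
    push_cast
    ring
  · rw [add_sub_cancel_right, thetaFactor_even hp0 hp, mul_left_comm (p ^ _), ← zpow_add₀ hp0]
    rw [show (2 * m + 1) ^ 2 - (2 * m + 1) + -m ^ 2 = 3 * m ^ 2 + 2 * m by ring]
    push_cast
    ring

/-- The value, up to a factor `2` in the first case, of the triple sums attached to `A⋆`, as a
function of `p = q^{1/2}`. -/
def dualValue (p : ℂ) : ℂ :=
  1 / 3 * (qJ 2 p ^ 5 * qJ 3 p * qJ 12 p / (qJ 1 p ^ 3 * qJ 4 p ^ 3 * qJ 6 p)) +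
    2 / 3 * (qJ 4 p ^ 3 * qJ 6 p ^ 2 / (qJ 2 p ^ 4 * qJ 12 p))

lemma dualValue_eq {p : ℂ} (hp : ‖p‖ < 1) :
    1 / 3 * ((qJ 2 p ^ 2 / (qJ 1 p * qJ 4 p)) ^ 2 *
        (qJ 2 p ^ 2 * qJ 3 p * qJ 12 p / (qJ 1 p * qJ 4 p * qJ 6 p)) +
        2 * (qJ 4 p / qJ 2 p) ^ 2 * (qJ 4 p * qJ 6 p ^ 2 / (qJ 2 p * qJ 12 p))) =
      qJ 2 p * dualValue p := by
  have n1 := qJ_ne_zero hp one_ne_zero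
  have n2 := qJ_ne_zero hp two_ne_zero
  have n4 := qJ_ne_zero hp (m := 4) (by norm_num)
  have n6 := qJ_ne_zero hp (m := 6) (by norm_num)
  have n12 := qJ_ne_zero hp (m := 12) (by norm_num)
  rw [dualValue]
  field_simp

theorem tsum_dual_zero {p : ℂ} (hp0 : p ≠ 0) (hp : ‖p‖ < 1) :
    ∑' t : ℕ × ℕ × ℕ, invPoch (p ^ 2) t * p ^ dualExp 0 t = 2 * dualValue p := by
  have n2 := qJ_ne_zero hp two_ne_zero
  have h := (hasSum_dual_theta hp0 hp 0).unique
    ((hasSum_dual_theta_zero hp0 hp).of_eq fun d => by simp)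
  have h2 := dualValue_eq hp
  refine mul_left_cancel₀ n2 ?_
  rw [h]
  linear_combination 2 * h2

theorem tsum_dual_one {p : ℂ} (hp0 : p ≠ 0) (hp : ‖p‖ < 1) :
    ∑' t : ℕ × ℕ × ℕ, invPoch (p ^ 2) t * p ^ dualExp 1 t = dualValue p := by
  have n2 := qJ_ne_zero hp two_ne_zero
  have hA := hasSum_dual_theta hp0 hp 1
  have hB := hasSum_dual_theta_one hp0 hp
  -- adding the odd series `∑ d p^{d²} θ(d) = 0` completes `θ(d)` to `(1 + p^d) θ(d)`
  have key : ∀ d : ℤ, (1 + p ^ d) * thetaFactor p (1 + (1 : ℕ)) d = thetaFactor p 1 (d - 1) := by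
    intro d
    rw [thetaFactor, thetaFactor, add_sub_cancel, qPochInf_neg_zpow hp0 hp d, Nat.cast_one,
      show (1 : ℤ) + 1 - d = 1 - (d - 1) by ring, show (1 : ℤ) + 1 + d = d + 2 by ring]
    ring
  have hC : HasSum (fun d : ℤ => (d : ℂ) * (p ^ (d ^ 2) * thetaFactor p (1 + (1 : ℕ)) d)) _ :=
    (hB.sub hA).of_eq fun d => by
      rw [← key, show p ^ d ^ 2 = p ^ (d ^ 2 - d) * p ^ d by
        rw [← zpow_add₀ hp0, sub_add_cancel]]
      ring
  have h0 := hC.eq_zero_of_odd (Equiv.neg ℤ) fun d => by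
    simp only [Equiv.neg_apply, neg_sq, thetaFactor_neg]
    push_cast
    ring
  rw [dualValue_eq hp] at h0
  exact (mul_left_cancel₀ n2 (sub_eq_zero.mp h0)).symm

/-! ### Eta quotients -/

open UpperHalfPlane Asymptotics in
/-- A nowhere vanishing holomorphic function whose 24th power transforms under `Γ(24)` like a
modular form of weight `12 w` (so that `w` is twice the weight of the function), and which has
exponential growth or decay of a definite rate at every cusp. Eta quotients are of this kind, and
the notion is stable under products and quotients. -/
structure EtaLike (w : ℤ) (f : ℍ → ℂ) : Prop where
  mdifferentiable : MDifferentiable 𝓘(ℂ) 𝓘(ℂ) f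
  ne_zero : ∀ τ, f τ ≠ 0
  pow_smul : ∀ γ ∈ CongruenceSubgroup.Gamma 24, ∀ τ : ℍ,
    f (γ • τ) ^ 24 = denom γ τ ^ (12 * w) * f τ ^ 24
  isTheta : ∀ γ : SL(2, ℤ), ∃ M : ℝ,
    (fun τ : ℍ => denom γ τ ^ (-(12 * w)) * f (γ • τ) ^ 24) =Θ[atImInfty]
      fun τ : ℍ => Real.exp (M * τ.im)

namespace EtaLike

open UpperHalfPlane Asymptotics

lemma one : EtaLike 0 fun _ => 1 where
  mdifferentiable := mdifferentiable_const
  ne_zero _ := one_ne_zero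
  pow_smul γ _ τ := by simp
  isTheta γ := ⟨0, by simp⟩

lemma mul {w w' : ℤ} {f g : ℍ → ℂ} (hf : EtaLike w f) (hg : EtaLike w' g) :
    EtaLike (w + w') fun τ => f τ * g τ where
  mdifferentiable := by
    have h1 := UpperHalfPlane.mdifferentiable_iff.mp hf.mdifferentiable
    have h2 := UpperHalfPlane.mdifferentiable_iff.mp hg.mdifferentiable
    exact UpperHalfPlane.mdifferentiable_iff.mpr (h1.mul h2)
  ne_zero τ := mul_ne_zero (hf.ne_zero τ) (hg.ne_zero τ)
  pow_smul γ hγ τ := by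
    rw [mul_pow, hf.pow_smul γ hγ, hg.pow_smul γ hγ, mul_add, zpow_add₀ (denom_ne_zero _ _)]
    ring
  isTheta γ := by
    obtain ⟨M, hM⟩ := hf.isTheta γ
    obtain ⟨M', hM'⟩ := hg.isTheta γ
    refine ⟨M + M', ?_⟩
    have h := hM.mul hM'
    simp only [← Real.exp_add, ← add_mul] at h
    convert! h using 2 with τ
    rw [mul_pow, mul_add, neg_add, zpow_add₀ (denom_ne_zero _ _)]
    ring

lemma inv {w : ℤ} {f : ℍ → ℂ} (hf : EtaLike w f) : EtaLike (-w) fun τ => (f τ)⁻¹ where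
  mdifferentiable := by
    have h1 := UpperHalfPlane.mdifferentiable_iff.mp hf.mdifferentiable
    exact UpperHalfPlane.mdifferentiable_iff.mpr (h1.inv fun z _ => hf.ne_zero _)
  ne_zero τ := inv_ne_zero (hf.ne_zero τ)
  pow_smul γ hγ τ := by
    rw [inv_pow, hf.pow_smul γ hγ, mul_inv, mul_neg, zpow_neg, inv_pow]
  isTheta γ := by
    obtain ⟨M, hM⟩ := hf.isTheta γ
    refine ⟨-M, ?_⟩
    have h := hM.inv
    simp only [← Real.exp_neg, ← neg_mul] at h
    convert! h using 2 with τ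
    rw [mul_inv, inv_pow, ← zpow_neg]
    congr 2; ring

lemma pow {w : ℤ} {f : ℍ → ℂ} (hf : EtaLike w f) (n : ℕ) : EtaLike (n * w) fun τ => f τ ^ n := by
  induction n with
  | zero => simpa using one
  | succ n ih =>
    have := ih.mul hf
    simp only [← pow_succ] at this
    convert! this using 1
    push_cast; ring

lemma div {w w' : ℤ} {f g : ℍ → ℂ} (hf : EtaLike w f) (hg : EtaLike w' g) :
    EtaLike (w - w') fun τ => f τ / g τ := by
  simpa only [div_eq_mul_inv, sub_eq_add_neg] using hf.mul hg.inv

lemma continuous {w : ℤ} {f : ℍ → ℂ} (hf : EtaLike w f) : Continuous f :=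
  hf.mdifferentiable.continuous

lemma continuous_smul (γ : SL(2, ℤ)) : Continuous fun τ : ℍ => γ • τ :=
  continuous_const_smul (γ : GL (Fin 2) ℝ)

/-- The multiplier is locally constant, being a 24th root of unity. -/
lemma exists_multiplier {k : ℤ} {f : ℍ → ℂ} (hf : EtaLike (2 * k) f) {γ : SL(2, ℤ)}
    (hγ : γ ∈ CongruenceSubgroup.Gamma 24) :
    ∃ ε : ℂ, ε ^ 24 = 1 ∧ ∀ τ : ℍ, f (γ • τ) = ε * denom γ τ ^ k * f τ := by
  let h : ℍ → ℂ := fun τ => f (γ • τ) / (denom γ τ ^ k * f τ)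
  have hne : ∀ τ : ℍ, denom γ τ ^ k * f τ ≠ 0 := fun τ =>
    mul_ne_zero (zpow_ne_zero _ (denom_ne_zero _ _)) (hf.ne_zero τ)
  have h24 : ∀ τ, h τ ^ 24 = 1 := fun τ => by
    have e : denom γ τ ^ (12 * (2 * k)) = (denom γ τ ^ k) ^ 24 := by
      rw [← zpow_natCast, ← zpow_mul]; congr 1; push_cast; ring
    simp only [h]
    rw [div_pow, hf.pow_smul γ hγ, mul_pow, e, div_self]
    exact mul_ne_zero (pow_ne_zero _ (zpow_ne_zero _ (denom_ne_zero _ _)))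
      (pow_ne_zero _ (hf.ne_zero τ))
  have hd : Continuous fun τ : ℍ => denom γ τ := by
    simp only [ModularGroup.denom_apply]
    fun_prop
  have hc : Continuous h := by
    refine (hf.continuous.comp (continuous_smul γ)).div ?_ hne
    exact (hd.zpow₀ k fun τ => Or.inl (denom_ne_zero _ _)).mul hf.continuous
  have hfin : {z : ℂ | z ^ 24 = 1}.Finite := by
    have : {z : ℂ | z ^ 24 = 1} = ((Polynomial.nthRoots 24 (1 : ℂ)).toFinset : Set ℂ) := by
      ext z; simp [Polynomial.mem_nthRoots]
    rw [this]; exact Finset.finite_toSet _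
  refine ⟨h I, h24 I, fun τ => ?_⟩
  have hconst : h τ = h I := isPreconnected_univ.constant_of_mapsTo hfin.isDiscrete
    hc.continuousOn (fun z _ => h24 z) (Set.mem_univ _) (Set.mem_univ _)
  rw [← hconst, mul_assoc]
  exact (div_mul_cancel₀ _ (hne τ)).symm

lemma norm_smul {k : ℤ} {f : ℍ → ℂ} (hf : EtaLike (2 * k) f) {γ : SL(2, ℤ)}
    (hγ : γ ∈ CongruenceSubgroup.Gamma 24) (τ : ℍ) :
    ‖f (γ • τ)‖ = ‖denom γ τ‖ ^ k * ‖f τ‖ := by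
  obtain ⟨ε, hε, h⟩ := hf.exists_multiplier hγ
  rw [h, norm_mul, norm_mul, norm_zpow, Complex.norm_eq_one_of_pow_eq_one hε (by norm_num), one_mul]

lemma isBigO {k : ℤ} {f : ℍ → ℂ} (hf : EtaLike (2 * k) f) (γ : SL(2, ℤ)) : ∃ M : ℝ,
    (fun τ : ℍ => denom γ τ ^ (-k) * f (γ • τ)) =O[atImInfty]
      fun τ : ℍ => Real.exp (M * τ.im) := by
  obtain ⟨M, hM⟩ := hf.isTheta γ
  refine ⟨M / 24, IsBigO.of_pow (n := 24) (by norm_num) ?_⟩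
  convert! hM.1 using 2 with τ τ
  · rw [Pi.pow_apply, mul_pow, ← zpow_natCast, ← zpow_mul]
    congr 2; push_cast; ring
  · rw [Pi.pow_apply, ← Real.exp_nat_mul]; congr 1; push_cast; ring

lemma isModularForm {k : ℤ} {f : ℍ → ℂ} (hf : EtaLike (2 * k) f) : IsModularForm k f := by
  refine ⟨hf.mdifferentiable, ⟨CongruenceSubgroup.Gamma 24, inferInstance, 24, by norm_num,
    fun γ hγ => ?_⟩, fun γ => ?_⟩
  · obtain ⟨ε, hε, h⟩ := hf.exists_multiplier hγ
    refine ⟨ε, hε, fun τ => ?_⟩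
    rw [h, Complex.ofReal_intCast, Complex.cpow_intCast]
  · obtain ⟨M, hM⟩ := hf.isBigO γ
    refine ⟨M, ?_⟩
    convert! hM using 2 with τ
    rw [Complex.ofReal_intCast, ← Int.cast_neg, Complex.cpow_intCast]

/-- A function of weight `0` is invariant under a subgroup of finite index: the kernel of its
multiplier. -/
lemma exists_invariance {f : ℍ → ℂ} (hf : EtaLike 0 f) :
    ∃ Γ : Subgroup SL(2, ℤ), Γ.FiniteIndex ∧ ∀ γ ∈ Γ, ∀ τ : ℍ, f (γ • τ) = f τ := by
  have hf' : EtaLike (2 * 0) f := by simpa using hf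
  have hm : ∀ γ ∈ CongruenceSubgroup.Gamma 24, ∀ τ : ℍ,
      (f (γ • I) / f I) ^ 24 = 1 ∧ f (γ • τ) = f (γ • I) / f I * f τ := fun γ hγ τ => by
    obtain ⟨ε, hε, h⟩ := hf'.exists_multiplier hγ
    have e : f (γ • I) / f I = ε := by
      rw [h, zpow_zero, mul_one, mul_div_cancel_right₀ _ (hf.ne_zero I)]
    rw [e]
    exact ⟨hε, by simpa using h τ⟩
  let χ : CongruenceSubgroup.Gamma 24 →* ℂˣ :=
    { toFun := fun γ => Units.mk0 (f ((γ : SL(2, ℤ)) • I) / f I)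
        (div_ne_zero (hf.ne_zero _) (hf.ne_zero _))
      map_one' := by ext; simp [hf.ne_zero]
      map_mul' := fun γ γ' => by
        ext
        simp only [Subgroup.coe_mul, mul_smul, Units.val_mk0, Units.val_mul]
        rw [(hm γ γ.2 _).2, mul_div_assoc] }
  have hfin : Finite χ.range := by
    have : (χ.range : Set ℂˣ) ⊆ (rootsOfUnity 24 ℂ : Set ℂˣ) := by
      rintro _ ⟨γ, rfl⟩
      simp only [SetLike.mem_coe, mem_rootsOfUnity]
      ext
      simpa [χ] using (hm γ γ.2 I).1
    have : Finite ((rootsOfUnity 24 ℂ : Set ℂˣ) : Type) :=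
      inferInstanceAs (Finite (rootsOfUnity 24 ℂ))
    exact Set.Finite.subset (Set.toFinite _) ‹_›
  refine ⟨χ.ker.map (CongruenceSubgroup.Gamma 24).subtype, ⟨?_⟩, ?_⟩
  · rw [Subgroup.index_map_subtype]
    exact mul_ne_zero Subgroup.FiniteIndex.index_ne_zero Subgroup.FiniteIndex.index_ne_zero
  · rintro _ ⟨γ, hγ, rfl⟩ τ
    have h1 : f ((γ : SL(2, ℤ)) • I) / f I = 1 := by
      simpa [χ, Units.ext_iff] using hγ
    rw [Subgroup.subtype_apply, (hm γ γ.2 τ).2, h1, one_mul]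

/-- Functions with different multipliers may be added in weight `0`: both are invariant under the
intersection of the two subgroups. -/
lemma isModularForm_add {f g : ℍ → ℂ} (hf : EtaLike 0 f) (hg : EtaLike 0 g) (a b : ℂ) :
    IsModularForm 0 fun τ => a * f τ + b * g τ := by
  obtain ⟨Γ, hΓ, h1⟩ := hf.exists_invariance
  obtain ⟨Γ', hΓ', h2⟩ := hg.exists_invariance
  refine ⟨?_, ⟨Γ ⊓ Γ', inferInstance, 1, one_pos, fun γ hγ => ⟨1, one_pow 1, fun τ => ?_⟩⟩,
    fun γ => ?_⟩
  · have h1 := UpperHalfPlane.mdifferentiable_iff.mp hf.mdifferentiable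
    have h2 := UpperHalfPlane.mdifferentiable_iff.mp hg.mdifferentiable
    exact UpperHalfPlane.mdifferentiable_iff.mpr ((h1.const_mul a).add (h2.const_mul b))
  · have e1 := h1 γ hγ.1 τ
    have e2 := h2 γ hγ.2 τ
    simp only [e1, e2, Complex.ofReal_zero, Complex.cpow_zero, one_mul]
  · obtain ⟨M, hM⟩ := EtaLike.isBigO (k := 0) (f := f) (by simpa using hf) γ
    obtain ⟨M', hM'⟩ := EtaLike.isBigO (k := 0) (f := g) (by simpa using hg) γ
    refine ⟨max M M', ?_⟩
    have mono : ∀ x ≤ max M M', (fun τ : ℍ => Real.exp (x * τ.im)) =O[atImInfty]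
        fun τ : ℍ => Real.exp (max M M' * τ.im) := fun x hx => by
      refine IsBigO.of_bound 1 (Eventually.of_forall fun τ => ?_)
      rw [Real.norm_of_nonneg (Real.exp_pos _).le, Real.norm_of_nonneg (Real.exp_pos _).le, one_mul]
      exact Real.exp_le_exp.mpr (mul_le_mul_of_nonneg_right hx τ.im_pos.le)
    have h := ((hM.trans (mono M (le_max_left _ _))).const_mul_left a).add
      ((hM'.trans (mono M' (le_max_right _ _))).const_mul_left b)
    convert! h using 2 with τ
    simp

end EtaLike

open UpperHalfPlane Asymptotics

lemma discriminant_smul (γ : SL(2, ℤ)) (z : ℍ) :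
    ModularForm.discriminant (γ • z) = denom γ z ^ 12 * ModularForm.discriminant z := by
  have h := congrFun (SlashInvariantForm.slash_action_generators_SL2Z
    ModularForm.discriminant_S_invariant ModularForm.discriminant_T_invariant γ) z
  rw [ModularForm.SL_slash_apply] at h
  rw [← h, zpow_neg, mul_comm, mul_assoc]
  have : denom γ z ^ (12 : ℤ) ≠ 0 := zpow_ne_zero _ (denom_ne_zero _ _)
  have e : (denom γ z ^ 12 : ℂ) = denom γ z ^ (12 : ℤ) := by norm_cast
  rw [e, inv_mul_cancel₀ this, mul_one]

lemma discriminant_isTheta :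
    ModularForm.discriminant =Θ[atImInfty] fun τ : ℍ => Real.exp (-2 * Real.pi * τ.im) := by
  refine ⟨?_, ModularForm.exp_isBigO_discriminant⟩
  have h1 : (fun τ : ℍ => Function.Periodic.qParam 1 τ) =O[atImInfty]
      fun τ : ℍ => Real.exp (-2 * Real.pi * τ.im) := by
    refine IsBigO.of_bound 1 (Eventually.of_forall fun τ => ?_)
    rw [one_mul, Real.norm_of_nonneg (Real.exp_pos _).le]
    simp [Function.Periodic.qParam, Complex.norm_exp]
  have h2 := h1.mul (ModularForm.tendsto_atImInfty_tprod_one_sub_eta_q_pow.isBigO_one ℝ)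
  simp only [mul_one] at h2
  exact h2.congr_left fun τ => (ModularForm.discriminant_eq_q_prod τ).symm

/-- The rescaled eta function `τ ↦ η(rτ/s)`. -/
def etaScale (r s : ℕ) (τ : ℂ) : ℂ :=
  ModularForm.eta ((r : ℂ) / s * τ)

/-- The point `(Aτ+B)/D`. -/
def affinePoint (A B D : ℤ) (hA : 0 < A) (hD : 0 < D) (τ : ℍ) : ℍ :=
  ⟨((A : ℝ) * (τ : ℂ) + (B : ℝ)) / (D : ℝ), by
    rw [Complex.div_ofReal_im, Complex.add_im, Complex.im_ofReal_mul, Complex.ofReal_im, add_zero]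
    have h1 : (0 : ℝ) < A := by exact_mod_cast hA
    have h2 : (0 : ℝ) < D := by exact_mod_cast hD
    exact div_pos (mul_pos h1 τ.im_pos) h2⟩

lemma affinePoint_im (A B D : ℤ) (hA : 0 < A) (hD : 0 < D) (τ : ℍ) :
    (affinePoint A B D hA hD τ).im = A * τ.im / D := by
  change (((A : ℝ) * (τ : ℂ) + (B : ℝ)) / (D : ℝ)).im = _
  rw [Complex.div_ofReal_im, Complex.add_im, Complex.im_ofReal_mul, Complex.ofReal_im, add_zero]
  rfl

lemma coe_affinePoint (A B D : ℤ) (hA : 0 < A) (hD : 0 < D) (τ : ℍ) :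
    (affinePoint A B D hA hD τ : ℂ) = (A * τ + B) / D := by
  change ((A : ℝ) * (τ : ℂ) + (B : ℝ)) / (D : ℝ) = _
  push_cast
  rfl

/-- The transformation of `η(rτ/s)` under `γ`, read off from a factorization
`(r 0; 0 s) γ = σ (A B; 0 D)`. -/
lemma etaScale_smul_pow {r s : ℕ} (hr : 0 < r) (hs : 0 < s) {γ σ : SL(2, ℤ)} {A B D : ℤ}
    (hA : 0 < A) (hD : 0 < D) (h00 : r * γ 0 0 = σ 0 0 * A) (h10 : s * γ 1 0 = σ 1 0 * A)
    (h01 : r * γ 0 1 = σ 0 0 * B + σ 0 1 * D) (h11 : s * γ 1 1 = σ 1 0 * B + σ 1 1 * D) (τ : ℍ) :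
    etaScale r s (γ • τ : ℍ) ^ 24 =
      (s / D : ℂ) ^ 12 * denom γ τ ^ 12 *
        ModularForm.discriminant (affinePoint A B D hA hD τ) := by
  have hr' : (r : ℂ) ≠ 0 := by exact_mod_cast hr.ne'
  have hs' : (s : ℂ) ≠ 0 := by exact_mod_cast hs.ne'
  have hD' : (D : ℂ) ≠ 0 := by exact_mod_cast hD.ne'
  have hden := denom_ne_zero γ τ
  have hden2 := denom_ne_zero σ (affinePoint A B D hA hD τ)
  rw [ModularGroup.denom_apply] at hden hden2
  rw [coe_affinePoint] at hden2
  have c00 : (r : ℂ) * (γ 0 0 : ℤ) = (σ 0 0 : ℤ) * A := by exact_mod_cast h00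
  have c10 : (s : ℂ) * (γ 1 0 : ℤ) = (σ 1 0 : ℤ) * A := by exact_mod_cast h10
  have c01 : (r : ℂ) * (γ 0 1 : ℤ) = (σ 0 0 : ℤ) * B + (σ 0 1 : ℤ) * D := by exact_mod_cast h01
  have c11 : (s : ℂ) * (γ 1 1 : ℤ) = (σ 1 0 : ℤ) * B + (σ 1 1 : ℤ) * D := by exact_mod_cast h11
  have e1 : ((σ 1 0 : ℤ) : ℂ) * ((A * τ + B) / D) + (σ 1 1 : ℤ) =
      s / D * ((γ 1 0 : ℤ) * τ + (γ 1 1 : ℤ)) := by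
    field_simp
    linear_combination -(τ : ℂ) * c10 - c11
  have e2 : ((r : ℂ) / s) * (γ • τ : ℍ) = (σ • affinePoint A B D hA hD τ : ℍ) := by
    rw [coe_specialLinearGroup_apply, coe_specialLinearGroup_apply, coe_affinePoint]
    simp only [algebraMap_int_eq, eq_intCast, Complex.ofReal_intCast]
    rw [e1]
    generalize ((γ 1 0 : ℤ) : ℂ) * τ + (γ 1 1 : ℤ) = X at hden
    field_simp
    linear_combination (τ : ℂ) * c00 + c01
  rw [etaScale, e2]
  have h := discriminant_smul σ (affinePoint A B D hA hD τ)
  rw [ModularForm.discriminant] at h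
  rw [h, ModularGroup.denom_apply, coe_affinePoint, e1, ModularGroup.denom_apply]
  ring

/-- The factorization `(r 0; 0 s) γ = σ (A B; 0 D)` with `σ` in `SL₂(ℤ)`: the first column of `σ` is
the primitive vector in the direction of the first column of the left-hand side. -/
lemma exists_upper_factorization {r s : ℕ} (hr : 0 < r) (hs : 0 < s) (γ : SL(2, ℤ)) :
    ∃ (σ : SL(2, ℤ)) (A B D : ℤ), 0 < A ∧ 0 < D ∧ r * γ 0 0 = σ 0 0 * A ∧
      s * γ 1 0 = σ 1 0 * A ∧ r * γ 0 1 = σ 0 0 * B + σ 0 1 * D ∧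
      s * γ 1 1 = σ 1 0 * B + σ 1 1 * D := by
  have hdet := γ.det_coe
  rw [Matrix.det_fin_two] at hdet
  have hrs : (0 : ℤ) < r * s := by positivity
  set p : ℤ := r * γ 0 0 with hp
  set t : ℤ := s * γ 1 0 with ht
  have hg : 0 < Int.gcd p t := by
    rw [Int.gcd_pos_iff]
    by_contra! h
    have : (r : ℤ) * s = 0 := by
      linear_combination (-(r : ℤ) * s) * hdet + s * γ 1 1 * h.1 - r * γ 0 1 * h.2
    lia
  obtain ⟨p', t', hcop, h1, h2⟩ := Int.exists_gcd_one hg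
  obtain ⟨σ, hσ0, hσ1⟩ := (Int.isCoprime_iff_gcd_eq_one.mpr hcop).exists_SL2_col 0
  have hσ := σ.det_coe
  rw [Matrix.det_fin_two] at hσ
  refine ⟨σ, Int.gcd p t, σ 1 1 * (r * γ 0 1) - σ 0 1 * (s * γ 1 1),
    -σ 1 0 * (r * γ 0 1) + σ 0 0 * (s * γ 1 1), by exact_mod_cast hg, ?_, ?_, ?_, ?_, ?_⟩
  · have h : (Int.gcd p t : ℤ) * (-σ 1 0 * (r * γ 0 1) + σ 0 0 * (s * γ 1 1)) = r * s := by
      rw [hσ0, hσ1]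
      linear_combination (r : ℤ) * s * hdet + r * γ 0 1 * h2 - s * γ 1 1 * h1
    have hg' : (0 : ℤ) < Int.gcd p t := by exact_mod_cast hg
    exact pos_of_mul_pos_right (h ▸ hrs) hg'.le
  · rw [hσ0]; exact h1
  · rw [hσ1]; exact h2
  · linear_combination -((r : ℤ) * γ 0 1) * hσ
  · linear_combination -((s : ℤ) * γ 1 1) * hσ

lemma tendsto_affinePoint (A B D : ℤ) (hA : 0 < A) (hD : 0 < D) :
    Tendsto (affinePoint A B D hA hD) atImInfty atImInfty := by
  refine tendsto_comap_iff.mpr ?_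
  have h1 : (0 : ℝ) < A := by exact_mod_cast hA
  have h2 : (0 : ℝ) < D := by exact_mod_cast hD
  have h : Tendsto (fun τ : ℍ => (A / D : ℝ) * τ.im) atImInfty atTop :=
    tendsto_comap.const_mul_atTop (div_pos h1 h2)
  refine h.congr fun τ => ?_
  rw [Function.comp_apply, affinePoint_im]; ring

lemma mem_upperHalfPlaneSet_scale {r s : ℕ} (hr : 0 < r) (hs : 0 < s) {z : ℂ} (hz : 0 < z.im) :
    (r : ℂ) / s * z ∈ UpperHalfPlane.upperHalfPlaneSet := by
  have : (r : ℂ) / s * z = ((r / s : ℝ) : ℂ) * z := by push_cast; rfl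
  rw [this]
  change 0 < (((r / s : ℝ) : ℂ) * z).im
  rw [Complex.im_ofReal_mul]
  positivity

/-- The rescaled eta function is of weight `1/2`; the weight in `EtaLike` is counted in halves. -/
theorem etaLike_etaScale {r s : ℕ} (hr : r ∣ 24) (hs : s ∣ 24) :
    EtaLike 1 fun τ : ℍ => etaScale r s τ where
  mdifferentiable := by
    have hr0 := Nat.pos_of_dvd_of_pos hr (by norm_num)
    have hs0 := Nat.pos_of_dvd_of_pos hs (by norm_num)
    rw [UpperHalfPlane.mdifferentiable_iff]
    refine DifferentiableOn.congr (f := fun z => etaScale r s z) (fun z hz => ?_) fun z hz => ?_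
    · have h := ModularForm.differentiableAt_eta_of_mem_upperHalfPlaneSet
        (mem_upperHalfPlaneSet_scale hr0 hs0 hz)
      exact (h.comp z (by fun_prop)).differentiableWithinAt
    · simp [ofComplex_apply_of_im_pos hz]
  ne_zero τ := ModularForm.eta_ne_zero (mem_upperHalfPlaneSet_scale
    (Nat.pos_of_dvd_of_pos hr (by norm_num)) (Nat.pos_of_dvd_of_pos hs (by norm_num)) τ.im_pos)
  pow_smul γ hγ τ := by
    have hr0 := Nat.pos_of_dvd_of_pos hr (by norm_num)
    have hs0 := Nat.pos_of_dvd_of_pos hs (by norm_num)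
    obtain ⟨-, h01, h10, -⟩ := CongruenceSubgroup.Gamma_mem.mp hγ
    rw [ZMod.intCast_zmod_eq_zero_iff_dvd] at h01 h10
    obtain ⟨b, hb⟩ := ((Int.natCast_dvd_natCast.mpr hs).trans h01)
    obtain ⟨c, hc⟩ := ((Int.natCast_dvd_natCast.mpr hr).trans h10)
    have hdet := γ.det_coe
    rw [Matrix.det_fin_two, hb, hc] at hdet
    -- conjugating `γ` by `(r 0; 0 s)` stays in `SL₂(ℤ)`, as `s ∣ γ 0 1` and `r ∣ γ 1 0`
    let σ : SL(2, ℤ) := ⟨!![γ 0 0, r * b; s * c, γ 1 1], by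
      rw [Matrix.det_fin_two_of]; linear_combination hdet⟩
    have hr1 : (0 : ℤ) < r := by exact_mod_cast hr0
    have hs1 : (0 : ℤ) < s := by exact_mod_cast hs0
    have h := etaScale_smul_pow hr0 hs0 (γ := γ) (σ := σ) (A := r) (B := 0) (D := s) hr1 hs1
      (by simp [σ]; ring) (by simp [σ, hc]; ring) (by simp [σ, hb]; ring) (by simp [σ]; ring) τ
    rw [h, ModularForm.discriminant, coe_affinePoint, etaScale]
    have hs' : (s : ℂ) ≠ 0 := by exact_mod_cast hs0.ne'
    have e : (((r : ℤ) : ℂ) * τ + (0 : ℤ)) / (s : ℤ) = (r : ℂ) / s * τ := by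
      push_cast; field_simp; ring
    have e2 : (s : ℂ) / ((s : ℤ) : ℂ) = 1 := by push_cast; exact div_self hs'
    rw [e, e2]
    norm_cast
    simp
  isTheta γ := by
    have hr0 := Nat.pos_of_dvd_of_pos hr (by norm_num)
    have hs0 := Nat.pos_of_dvd_of_pos hs (by norm_num)
    obtain ⟨σ, A, B, D, hA, hD, h00, h10, h01, h11⟩ := exists_upper_factorization hr0 hs0 γ
    have hs' : (s : ℂ) ≠ 0 := by exact_mod_cast hs0.ne'
    have hD' : (D : ℂ) ≠ 0 := by exact_mod_cast hD.ne'
    refine ⟨-2 * Real.pi * (A / D), ?_⟩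
    have h1 := discriminant_isTheta.1.comp_tendsto (tendsto_affinePoint A B D hA hD)
    have h2 := discriminant_isTheta.2.comp_tendsto (tendsto_affinePoint A B D hA hD)
    have h3 : (fun τ : ℍ => (s / D : ℂ) ^ 12 *
        ModularForm.discriminant (affinePoint A B D hA hD τ)) =Θ[atImInfty]
        fun τ : ℍ => Real.exp (-2 * Real.pi * (A / D) * τ.im) := by
      refine (isTheta_const_mul_left (pow_ne_zero _ (div_ne_zero hs' hD'))).mpr ?_
      have e : (fun τ : ℍ => Real.exp (-2 * Real.pi * (A / D) * τ.im)) =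
          (fun τ : ℍ => Real.exp (-2 * Real.pi * τ.im)) ∘ affinePoint A B D hA hD := by
        ext τ; simp only [Function.comp_apply, affinePoint_im]; congr 1; ring
      rw [e]
      exact ⟨h1, h2⟩
    refine IsTheta.trans (EventuallyEq.isTheta (Eventually.of_forall fun τ => ?_)) h3
    have hden : denom γ τ ^ 12 ≠ 0 := pow_ne_zero _ (denom_ne_zero _ _)
    simp only
    rw [etaScale_smul_pow hr0 hs0 hA hD h00 h10 h01 h11 τ, mul_one, zpow_neg]
    norm_cast
    field_simp

/-! ### The modular forms -/

lemma eExp_add (a b : ℂ) : eExp (a + b) = eExp a * eExp b := by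
  simp only [eExp, mul_add, Complex.exp_add]

lemma eExp_zero : eExp 0 = 1 := by simp [eExp]

lemma eExp_ne_zero (a : ℂ) : eExp a ≠ 0 := Complex.exp_ne_zero _

lemma eExp_natCast_mul (n : ℕ) (a : ℂ) : eExp (n * a) = eExp a ^ n := by
  rw [eExp, eExp, ← Complex.exp_nat_mul]; congr 1; ring

lemma eExp_intCast_mul (n : ℤ) (a : ℂ) : eExp (n * a) = eExp a ^ n := by
  rw [eExp, eExp, ← Complex.exp_int_mul]; congr 1; ring

lemma norm_eExp (a : ℂ) : ‖eExp a‖ = Real.exp (-(2 * Real.pi * a.im)) := by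
  rw [eExp, Complex.norm_exp]
  congr 1
  simp [mul_assoc]

lemma norm_eExp_lt_one {a : ℂ} (ha : 0 < a.im) : ‖eExp a‖ < 1 := by
  rw [norm_eExp, Real.exp_lt_one_iff, neg_lt_zero]
  have := Real.pi_pos
  positivity

/-- `J_m = q^{-m/24} η(mz)` for `q = e(z)`. -/
lemma qJ_eExp (m : ℕ) (z : ℂ) :
    qJ m (eExp z) = ModularForm.eta (m * z) / eExp (z / 24) ^ m := by
  have h1 : Function.Periodic.qParam 24 (m * z) = eExp (z / 24) ^ m := by
    rw [← eExp_natCast_mul, eExp, Function.Periodic.qParam]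
    congr 1; push_cast; ring
  have h2 : ∀ n, 1 - ModularForm.eta_q n (m * z) = 1 - eExp z ^ m * (eExp z ^ m) ^ n := fun n => by
    rw [ModularForm.eta_q_eq_pow, ← pow_succ', ← eExp_natCast_mul, eExp]
  rw [ModularForm.eta, h1, qJ, qPochInf, tprod_congr h2, mul_div_cancel_left₀]
  exact pow_ne_zero _ (eExp_ne_zero _)

lemma qJ_eExp_eq_etaScale (m : ℕ) (τ : ℂ) :
    qJ m (eExp τ) = etaScale m 1 τ / eExp (τ / 24) ^ m := by
  rw [qJ_eExp, etaScale, Nat.cast_one, div_one]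

lemma formOne_eq (τ : ℂ) : formOne τ = etaScale 1 1 τ ^ 2 * etaScale 4 1 τ / etaScale 2 1 τ := by
  have h : eExp (τ / 6) = eExp (τ / 24) ^ 4 := by
    rw [← eExp_natCast_mul]; congr 1; push_cast; ring
  have hu := eExp_ne_zero (τ / 24)
  rw [formOne, h]
  simp only [qJ_eExp_eq_etaScale]
  field_simp

lemma formZero_eq (τ : ℂ) :
    formZero τ = etaScale 2 1 τ ^ 2 * etaScale 3 1 τ * etaScale 12 1 τ /
      (etaScale 1 1 τ * etaScale 4 1 τ ^ 2 * etaScale 6 1 τ) := by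
  have h : eExp (τ / 6) = eExp (τ / 24) ^ 4 := by
    rw [← eExp_natCast_mul]; congr 1; push_cast; ring
  have hu := eExp_ne_zero (τ / 24)
  rw [formZero, h]
  simp only [qJ_eExp_eq_etaScale]
  field_simp

lemma etaLike_formOne : EtaLike (2 * 1) fun τ : ℍ => formOne τ := by
  have h1 := etaLike_etaScale (r := 1) (s := 1) (by norm_num) (by norm_num)
  have h2 := etaLike_etaScale (r := 2) (s := 1) (by norm_num) (by norm_num)
  have h4 := etaLike_etaScale (r := 4) (s := 1) (by norm_num) (by norm_num)
  simpa only [formOne_eq] using! ((h1.pow 2).mul h4).div h2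

lemma etaLike_formZero : EtaLike (2 * 0) fun τ : ℍ => formZero τ := by
  have h1 := etaLike_etaScale (r := 1) (s := 1) (by norm_num) (by norm_num)
  have h2 := etaLike_etaScale (r := 2) (s := 1) (by norm_num) (by norm_num)
  have h3 := etaLike_etaScale (r := 3) (s := 1) (by norm_num) (by norm_num)
  have h4 := etaLike_etaScale (r := 4) (s := 1) (by norm_num) (by norm_num)
  have h6 := etaLike_etaScale (r := 6) (s := 1) (by norm_num) (by norm_num)
  have h12 := etaLike_etaScale (r := 12) (s := 1) (by norm_num) (by norm_num)
  simpa only [formZero_eq] using! (((h2.pow 2).mul h3).mul h12).div ((h1.mul (h4.pow 2)).mul h6)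

lemma isModularForm_formOne : IsModularForm 1 fun τ : ℍ => formOne τ := by
  simpa using etaLike_formOne.isModularForm

lemma isModularForm_formZero : IsModularForm 0 fun τ : ℍ => formZero τ := by
  simpa using etaLike_formZero.isModularForm

/-- The dual Nahm sum, as a combination of two eta quotients of weight `0`. -/
lemma eExp_mul_dualValue (τ : ℂ) :
    eExp (τ / 12) * dualValue (eExp (τ / 2)) =
      1 / 3 * (etaScale 2 2 τ ^ 5 * etaScale 3 2 τ * etaScale 12 2 τ /
        (etaScale 1 2 τ ^ 3 * etaScale 4 2 τ ^ 3 * etaScale 6 2 τ)) +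
      2 / 3 * (etaScale 4 2 τ ^ 3 * etaScale 6 2 τ ^ 2 /
        (etaScale 2 2 τ ^ 4 * etaScale 12 2 τ)) := by
  have h : eExp (τ / 12) = eExp (τ / 2 / 24) ^ 4 := by
    rw [← eExp_natCast_mul]; congr 1; push_cast; ring
  have hJ : ∀ m : ℕ, qJ m (eExp (τ / 2)) = etaScale m 2 τ / eExp (τ / 2 / 24) ^ m := fun m => by
    rw [qJ_eExp, etaScale]; congr 2; push_cast; ring
  have hu := eExp_ne_zero (τ / 2 / 24)
  rw [dualValue, h]
  simp only [hJ]
  generalize eExp (τ / 2 / 24) = u at hu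
  rw [mul_add]
  congr 1 <;> field_simp

lemma isModularForm_dual (c : ℂ) :
    IsModularForm 0 fun τ : ℍ => c * (eExp (τ / 12) * dualValue (eExp (τ / 2))) := by
  have h1 := etaLike_etaScale (r := 1) (s := 2) (by norm_num) (by norm_num)
  have h2 := etaLike_etaScale (r := 2) (s := 2) (by norm_num) (by norm_num)
  have h3 := etaLike_etaScale (r := 3) (s := 2) (by norm_num) (by norm_num)
  have h4 := etaLike_etaScale (r := 4) (s := 2) (by norm_num) (by norm_num)
  have h6 := etaLike_etaScale (r := 6) (s := 2) (by norm_num) (by norm_num)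
  have h12 := etaLike_etaScale (r := 12) (s := 2) (by norm_num) (by norm_num)
  have hX := (((h2.pow 5).mul h3).mul h12).div (((h1.pow 3).mul (h4.pow 3)).mul h6)
  have hY := ((h4.pow 3).mul (h6.pow 2)).div ((h2.pow 4).mul h12)
  have h := EtaLike.isModularForm_add (by simpa using! hX) (by simpa using! hY)
    (c * (1 / 3)) (c * (2 / 3))
  convert! h using 2 with τ
  rw [eExp_mul_dualValue]
  ring

/-! ### The Nahm sums -/

/-- Triples as vectors. -/
def tripleEquiv : ℕ × ℕ × ℕ ≃ (Fin 3 → ℕ) where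
  toFun t := ![t.1, t.2.1, t.2.2]
  invFun n := (n 0, n 1, n 2)
  left_inv _ := rfl
  right_inv n := by ext i; fin_cases i <;> rfl

lemma tripleEquiv_apply_zero (t : ℕ × ℕ × ℕ) : tripleEquiv t 0 = t.1 := rfl

lemma tripleEquiv_apply_one (t : ℕ × ℕ × ℕ) : tripleEquiv t 1 = t.2.1 := rfl

lemma tripleEquiv_apply_two (t : ℕ × ℕ × ℕ) : tripleEquiv t 2 = t.2.2 := rfl

lemma nahmTerm_matA_first (C : ℝ) (τ : ℂ) (t : ℕ × ℕ × ℕ) :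
    nahmTerm matA ![1/2, 1/2, 0] C (4 * τ) (tripleEquiv t) =
      eExp (4 * C * τ) *
        (eExp τ ^ (3 * t.1 ^ 2 + 3 * t.2.1 ^ 2 + 4 * t.2.2 ^ 2 + 2 * t.1 * t.2.1 + 4 * t.1 * t.2.2
            + 4 * t.2.1 * t.2.2 + 2 * t.1 + 2 * t.2.1) /
          (qPoch (eExp τ ^ 4) (eExp τ ^ 4) t.1 * qPoch (eExp τ ^ 4) (eExp τ ^ 4) t.2.1 *
            qPoch (eExp τ ^ 4) (eExp τ ^ 4) t.2.2)) := by
  obtain ⟨i, j, k⟩ := t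
  have h4 : eExp (4 * τ) = eExp τ ^ 4 := by
    rw [← eExp_natCast_mul]; norm_num
  rw [← mul_div_assoc, ← eExp_natCast_mul, ← eExp_add, nahmTerm, h4, Fin.prod_univ_three]
  congr 2
  simp only [nahmExponent, Fin.sum_univ_three, matA, tripleEquiv_apply_zero,
    tripleEquiv_apply_one, tripleEquiv_apply_two]
  simp
  ring

lemma nahmTerm_matA_second (C : ℝ) (τ : ℂ) (t : ℕ × ℕ × ℕ) :
    nahmTerm matA ![1, 1, 1] C (4 * τ) (tripleEquiv t) =
      eExp (4 * C * τ) *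
        (eExp τ ^ (3 * t.1 ^ 2 + 3 * t.2.1 ^ 2 + 4 * t.2.2 ^ 2 + 2 * t.1 * t.2.1 + 4 * t.1 * t.2.2
            + 4 * t.2.1 * t.2.2 + 4 * t.1 + 4 * t.2.1 + 4 * t.2.2) /
          (qPoch (eExp τ ^ 4) (eExp τ ^ 4) t.1 * qPoch (eExp τ ^ 4) (eExp τ ^ 4) t.2.1 *
            qPoch (eExp τ ^ 4) (eExp τ ^ 4) t.2.2)) := by
  obtain ⟨i, j, k⟩ := t
  have h4 : eExp (4 * τ) = eExp τ ^ 4 := by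
    rw [← eExp_natCast_mul]; norm_num
  rw [← mul_div_assoc, ← eExp_natCast_mul, ← eExp_add, nahmTerm, h4, Fin.prod_univ_three]
  congr 2
  simp only [nahmExponent, Fin.sum_univ_three, matA, tripleEquiv_apply_zero,
    tripleEquiv_apply_one, tripleEquiv_apply_two]
  simp
  ring

/-- The vectors `(1/2, 1/2, -1/2)` and `(1/2, 1/2, 0)` are the cases `b = 0` and `b = 1`. -/
lemma nahmTerm_matAStar (b : ℕ) {B : Fin 3 → ℚ} (hB : B = ![1/2, 1/2, ((b : ℚ) - 1) / 2]) (τ : ℂ)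
    (t : ℕ × ℕ × ℕ) :
    nahmTerm matAStar B (1/12) τ (tripleEquiv t) =
      eExp (τ / 12) * (invPoch (eExp (τ / 2) ^ 2) t * eExp (τ / 2) ^ dualExp b t) := by
  obtain ⟨i, j, k⟩ := t
  have h2 : eExp τ = eExp (τ / 2) ^ 2 := by
    rw [← eExp_natCast_mul]; congr 1; push_cast; ring
  rw [mul_left_comm, ← eExp_intCast_mul, ← eExp_add, nahmTerm, Fin.prod_univ_three, invPoch,
    ← div_eq_inv_mul, h2]
  congr 2
  simp only [nahmExponent, Fin.sum_univ_three, matAStar, tripleEquiv_apply_zero,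
    tripleEquiv_apply_one, tripleEquiv_apply_two, hB, dualExp]
  simp
  ring

lemma nahmSum_matA_first (C : ℝ) {τ : ℂ} (hτ : 0 < τ.im) :
    nahmSum matA ![1/2, 1/2, 0] C (4 * τ) =
      eExp ((4 * C - 1 / 6) * τ) * (1 / 3 * formOne τ + 2 / 3 * formZero τ) := by
  have h := (hasSum_first (norm_eExp_lt_one hτ)).mul_left (eExp (4 * C * τ))
  simp only [← nahmTerm_matA_first C τ] at h
  have h' : HasSum (nahmTerm matA ![1/2, 1/2, 0] C (4 * τ)) _ := tripleEquiv.hasSum_iff.mp h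
  rw [nahmSum, h'.tsum_eq, formOne, formZero]
  rw [show 4 * (C : ℂ) * τ = (4 * C - 1 / 6) * τ + τ / 6 by ring, eExp_add]
  ring

lemma nahmSum_matA_second (C : ℝ) {τ : ℂ} (hτ : 0 < τ.im) :
    nahmSum matA ![1, 1, 1] C (4 * τ) =
      eExp ((4 * C - 7 / 6) * τ) * (-(1 / 3) * formOne τ + 1 / 3 * formZero τ) := by
  have h := (hasSum_second (norm_eExp_lt_one hτ) (eExp_ne_zero τ)).mul_left (eExp (4 * C * τ))
  simp only [← nahmTerm_matA_second C τ] at h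
  have h' : HasSum (nahmTerm matA ![1, 1, 1] C (4 * τ)) _ := tripleEquiv.hasSum_iff.mp h
  rw [nahmSum, h'.tsum_eq, formOne, formZero]
  rw [show 4 * (C : ℂ) * τ = (4 * C - 7 / 6) * τ + τ / 6 + τ by ring, eExp_add, eExp_add]
  have := eExp_ne_zero τ
  generalize qJ 1 (eExp τ) ^ 2 * qJ 4 (eExp τ) / qJ 2 (eExp τ) = X
  generalize qJ 2 (eExp τ) ^ 2 * qJ 3 (eExp τ) * qJ 12 (eExp τ) /
    (qJ 1 (eExp τ) * qJ 4 (eExp τ) ^ 2 * qJ 6 (eExp τ)) = Y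
  field_simp

lemma summable_nahmTerm_matAStar (b : ℕ) {B : Fin 3 → ℚ}
    (hB : B = ![1/2, 1/2, ((b : ℚ) - 1) / 2]) {τ : ℂ} (hτ : 0 < τ.im) :
    Summable (nahmTerm matAStar B (1/12) τ) := by
  have hp : 0 < (τ / 2).im := by
    rw [Complex.div_ofNat_im]; positivity
  exact tripleEquiv.summable_iff.mp
    (((summable_dual (eExp_ne_zero _) (norm_eExp_lt_one hp) b).mul_left _).congr
      fun t => (nahmTerm_matAStar b hB τ t).symm)

lemma nahmSum_matAStar (b : ℕ) {B : Fin 3 → ℚ} (hB : B = ![1/2, 1/2, ((b : ℚ) - 1) / 2]) (τ : ℂ) :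
    nahmSum matAStar B (1/12) τ = eExp (τ / 12) *
      ∑' t : ℕ × ℕ × ℕ, invPoch (eExp (τ / 2) ^ 2) t * eExp (τ / 2) ^ dualExp b t := by
  rw [nahmSum, ← tripleEquiv.tsum_eq, tsum_congr (nahmTerm_matAStar b hB τ), tsum_mul_left]

lemma isModularForm_nahmSum_matAStar_first :
    IsModularForm 0 fun τ : ℍ => nahmSum matAStar ![1/2, 1/2, -1/2] (1/12) τ := by
  convert! isModularForm_dual 2 using 2 with τ
  have hp : 0 < ((τ : ℂ) / 2).im := by
    rw [Complex.div_ofNat_im]; have := τ.im_pos; positivity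
  rw [nahmSum_matAStar 0 (by norm_num), tsum_dual_zero (eExp_ne_zero _) (norm_eExp_lt_one hp)]
  ring

lemma isModularForm_nahmSum_matAStar_second :
    IsModularForm 0 fun τ : ℍ => nahmSum matAStar ![1/2, 1/2, 0] (1/12) τ := by
  convert! isModularForm_dual 1 using 2 with τ
  have hp : 0 < ((τ : ℂ) / 2).im := by
    rw [Complex.div_ofNat_im]; have := τ.im_pos; positivity
  rw [nahmSum_matAStar 1 (by norm_num), tsum_dual_one (eExp_ne_zero _) (norm_eExp_lt_one hp)]
  ring

/-! ### Failure of modularity -/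

lemma tendsto_qJ {m : ℕ} (hm : m ≠ 0) : Tendsto (qJ m) (𝓝 0) (𝓝 1) := by
  have h := (ModularForm.differentiableOn_tprod_one_sub_pow.differentiableAt
    (Metric.ball_mem_nhds (0 : ℂ) one_pos)).continuousAt
  have h0 : ∏' n : ℕ, (1 - (0 : ℂ) ^ (n + 1)) = 1 := by simp
  rw [ContinuousAt, h0] at h
  have hp : Tendsto (fun q : ℂ => q ^ m) (𝓝 0) (𝓝 0) := by
    simpa [hm] using (continuous_pow (M := ℂ) m).tendsto 0
  refine (h.comp hp).congr fun q => ?_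
  rw [Function.comp_apply, qJ, qPochInf]
  exact tprod_congr fun k => by rw [pow_succ']

/-- The constant term of a triple sum, by dominated convergence. -/
lemma tendsto_tripleSum {N : ℕ × ℕ × ℕ → ℕ} (hN : ∀ i j k, i + j + k ≤ N (i, j, k))
    (hN0 : N (0, 0, 0) = 0) :
    Tendsto (fun q : ℂ => ∑' t : ℕ × ℕ × ℕ, q ^ N t / (qPoch (q ^ 4) (q ^ 4) t.1 *
      qPoch (q ^ 4) (q ^ 4) t.2.1 * qPoch (q ^ 4) (q ^ 4) t.2.2)) (𝓝 0) (𝓝 1) := by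
  set K : ℝ := Real.exp ((1 - 1 / 2)⁻¹ * (1 - 1 / 2)⁻¹) with hK
  have hbound : ∀ q : ℂ, ‖q‖ < 1 / 2 → ∀ n, ‖(qPoch (q ^ 4) (q ^ 4) n)⁻¹‖ ≤ K := fun q hq n => by
    refine norm_inv_qPoch_le (by norm_num) (by norm_num) ?_ n
    rw [norm_pow]
    exact (pow_le_of_le_one (norm_nonneg _) (by linarith) (by norm_num)).trans hq.le
  have hball : ∀ᶠ q : ℂ in 𝓝 0, ‖q‖ < 1 / 2 := by
    filter_upwards [Metric.ball_mem_nhds (0 : ℂ) (by norm_num : (0 : ℝ) < 1 / 2)] with q hq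
    simpa using hq
  have hsum : Summable fun t : ℕ × ℕ × ℕ => K * K * K * (1 / 2 : ℝ) ^ (t.1 + t.2.1 + t.2.2) := by
    refine Summable.mul_left _ (Summable.of_nonneg_of_le (fun t => by positivity) (fun t => ?_)
      (summable_triple_bound (r := 1 / 2) (by norm_num) (by norm_num)))
    refine le_mul_of_one_le_left (by positivity) ?_
    exact one_le_mul_of_one_le_of_one_le (by simp) (by simp)
  have hterm : ∀ q : ℂ, ‖q‖ < 1 / 2 → ∀ t : ℕ × ℕ × ℕ,
      ‖q ^ N t / (qPoch (q ^ 4) (q ^ 4) t.1 * qPoch (q ^ 4) (q ^ 4) t.2.1 *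
        qPoch (q ^ 4) (q ^ 4) t.2.2)‖ ≤ K * K * K * ‖q‖ ^ N t := fun q hq t => by
    rw [div_eq_inv_mul, mul_inv, mul_inv, norm_mul, norm_mul, norm_mul, norm_pow]
    gcongr <;> exact hbound q hq _
  have h := tendsto_tsum_of_dominated_convergence (𝓕 := 𝓝 (0 : ℂ))
    (f := fun (q : ℂ) (t : ℕ × ℕ × ℕ) => q ^ N t / (qPoch (q ^ 4) (q ^ 4) t.1 *
      qPoch (q ^ 4) (q ^ 4) t.2.1 * qPoch (q ^ 4) (q ^ 4) t.2.2))
    (g := fun t => if t = (0, 0, 0) then 1 else 0) hsum (fun t => ?_) ?_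
  · rwa [tsum_ite_eq] at h
  · split_ifs with ht
    · subst ht
      simp [hN0, qPoch]
    · have hpos : N t ≠ 0 := by
        intro h0
        obtain ⟨i, j, k⟩ := t
        have := hN i j k
        rw [h0] at this
        exact ht (by ext <;> simp <;> lia)
      refine squeeze_zero_norm' (a := fun q : ℂ => K * K * K * ‖q‖ ^ N t) ?_ ?_
      · filter_upwards [hball] with q hq using hterm q hq t
      · have : Tendsto (fun q : ℂ => K * K * K * ‖q‖ ^ N t) (𝓝 0)
            (𝓝 (K * K * K * ‖(0 : ℂ)‖ ^ N t)) :=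
          Continuous.tendsto (by fun_prop) 0
        simpa [hpos] using this
  · filter_upwards [hball] with q hq t
    refine (hterm q hq t).trans ?_
    have hK0 : 0 ≤ K * K * K := by positivity
    refine mul_le_mul_of_nonneg_left ?_ hK0
    calc ‖q‖ ^ N t ≤ (1 / 2 : ℝ) ^ N t := pow_le_pow_left₀ (norm_nonneg _) hq.le _
      _ ≤ (1 / 2 : ℝ) ^ (t.1 + t.2.1 + t.2.2) :=
        pow_le_pow_of_le_one (by norm_num) (by norm_num) (hN _ _ _)

/-- A power times an exponential of independent growth can only tend to `0`, `1` or `∞`; stated for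
the value `1/3`. -/
lemma not_tendsto_rpow_mul_exp {y J : ℕ → ℝ} (hy : Tendsto y atTop atTop)
    (hJ : Tendsto J atTop atTop) (hlog : Tendsto (fun n => Real.log (J n) / y n) atTop (𝓝 0))
    (a b : ℝ) (h : Tendsto (fun n => J n ^ a * Real.exp (b * y n)) atTop (𝓝 (1 / 3))) : False := by
  have hl : Tendsto (fun n => a * Real.log (J n) + b * y n) atTop (𝓝 (Real.log (1 / 3))) := by
    refine (h.log (by norm_num)).congr' ?_
    filter_upwards [hJ.eventually_gt_atTop 0] with n hn
    rw [Real.log_mul (Real.rpow_pos_of_pos hn a).ne' (Real.exp_pos _).ne', Real.log_rpow hn,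
      Real.log_exp]
  have hb : b = 0 := by
    have h1 : Tendsto (fun n => a * (Real.log (J n) / y n) + b) atTop (𝓝 (a * 0 + b)) :=
      (hlog.const_mul a).add_const b
    have h2 := hl.div_atTop hy
    have h3 := tendsto_nhds_unique h1 (h2.congr' ?_)
    · simpa using h3
    · filter_upwards [hy.eventually_gt_atTop 0] with n hn
      field_simp
  subst hb
  simp only [zero_mul, add_zero] at hl
  have hJl := Real.tendsto_log_atTop.comp hJ
  have ha : a = 0 := by
    have h2 := hl.div_atTop hJl
    refine tendsto_nhds_unique tendsto_const_nhds (h2.congr' ?_)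
    filter_upwards [hJl.eventually_gt_atTop 0] with n hn
    exact mul_div_cancel_right₀ _ (ne_of_gt hn)
  subst ha
  simp only [zero_mul] at hl
  have h3 := tendsto_nhds_unique hl tendsto_const_nhds
  have h4 : Real.log (1 / 3) < 0 := Real.log_neg (by norm_num) (by norm_num)
  exact h4.ne h3

/-- The unipotent matrix `(1 0; c 1)`. -/
def lowerUnipotent (c : ℤ) : SL(2, ℤ) :=
  ⟨!![1, 0; c, 1], by simp⟩

lemma coe_lowerUnipotent (c : ℤ) :
    (lowerUnipotent c : Matrix (Fin 2) (Fin 2) ℤ) = !![1, 0; c, 1] := rfl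

lemma lowerUnipotent_pow (c : ℤ) (n : ℕ) : lowerUnipotent c ^ n = lowerUnipotent (n * c) := by
  induction n with
  | zero =>
    apply Subtype.ext
    rw [pow_zero, Matrix.SpecialLinearGroup.coe_one, coe_lowerUnipotent, Matrix.one_fin_two]
    simp
  | succ n ih =>
    apply Subtype.ext
    rw [pow_succ, ih, Matrix.SpecialLinearGroup.coe_mul, coe_lowerUnipotent, coe_lowerUnipotent,
      coe_lowerUnipotent, Matrix.mul_fin_two]
    simp [add_mul]

lemma denom_lowerUnipotent (c : ℤ) (τ : ℍ) : denom (lowerUnipotent c) τ = c * τ + 1 := by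
  rw [ModularGroup.denom_apply]; simp [lowerUnipotent]

lemma coe_lowerUnipotent_smul (c : ℤ) (τ : ℍ) :
    ((lowerUnipotent c • τ : ℍ) : ℂ) = τ / (c * τ + 1) := by
  rw [coe_specialLinearGroup_apply]; simp [lowerUnipotent]

lemma lowerUnipotent_mem_Gamma {N : ℕ} {c : ℤ} (h : (N : ℤ) ∣ c) :
    lowerUnipotent c ∈ CongruenceSubgroup.Gamma N := by
  rw [CongruenceSubgroup.Gamma_mem]
  simpa [lowerUnipotent] using (ZMod.intCast_zmod_eq_zero_iff_dvd c N).mpr h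

lemma affinePoint_four_smul (c : ℤ) (τ : ℍ) :
    affinePoint 4 0 1 (by norm_num) one_pos (lowerUnipotent (4 * c) • τ) =
      lowerUnipotent c • affinePoint 4 0 1 (by norm_num) one_pos τ := by
  apply UpperHalfPlane.ext
  rw [coe_affinePoint, coe_lowerUnipotent_smul, coe_lowerUnipotent_smul, coe_affinePoint]
  push_cast
  rw [add_zero, div_one, add_zero, div_one, mul_div_assoc]
  congr 3; ring

/-- The points `(n+1)i`, which tend to `i∞`. -/
def imagPoint (n : ℕ) : ℍ :=
  ⟨((n + 1 : ℝ) : ℂ) * Complex.I, by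
    rw [Complex.im_ofReal_mul, Complex.I_im, mul_one]; positivity⟩

lemma coe_imagPoint (n : ℕ) : (imagPoint n : ℂ) = ((n + 1 : ℝ) : ℂ) * Complex.I := rfl

lemma imagPoint_im (n : ℕ) : (imagPoint n).im = n + 1 := by
  change (((n + 1 : ℝ) : ℂ) * Complex.I).im = _
  rw [Complex.im_ofReal_mul, Complex.I_im, mul_one]

lemma tendsto_im_imagPoint : Tendsto (fun n => (imagPoint n).im) atTop atTop := by
  simp only [imagPoint_im]
  exact tendsto_atTop_add_const_right _ _ tendsto_natCast_atTop_atTop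

lemma norm_denom_bounds {c : ℕ} (n : ℕ) :
    c * (imagPoint n).im ≤ ‖denom (lowerUnipotent c) (imagPoint n)‖ ∧
      ‖denom (lowerUnipotent c) (imagPoint n)‖ ≤ c * (imagPoint n).im + 1 := by
  have e : ‖((c : ℤ) : ℂ) * (imagPoint n : ℂ)‖ = c * (imagPoint n).im := by
    rw [norm_mul, imagPoint_im, coe_imagPoint, norm_mul, Complex.norm_I, mul_one, Complex.norm_real,
      Real.norm_of_nonneg (by positivity), Int.cast_natCast, Complex.norm_natCast]
  rw [denom_lowerUnipotent]
  constructor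
  · rw [imagPoint_im]
    have h := Complex.abs_im_le_norm (((c : ℤ) : ℂ) * (imagPoint n : ℂ) + 1)
    have e2 : (((c : ℤ) : ℂ) * (imagPoint n : ℂ) + 1).im = c * (n + 1) := by
      rw [coe_imagPoint, Int.cast_natCast, Complex.add_im, Complex.one_im, add_zero, ← mul_assoc]
      have : (c : ℂ) * ((n + 1 : ℝ) : ℂ) = ((c * (n + 1) : ℝ) : ℂ) := by push_cast; rfl
      rw [this, Complex.im_ofReal_mul, Complex.I_im, mul_one]
    rw [e2, abs_of_nonneg (by positivity)] at h
    exact h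
  · refine (norm_add_le _ _).trans ?_
    rw [e, norm_one]

lemma tendsto_norm_denom {c : ℕ} (hc : 0 < c) :
    Tendsto (fun n => ‖denom (lowerUnipotent c) (imagPoint n)‖) atTop atTop := by
  have hc' : (0 : ℝ) < c := by exact_mod_cast hc
  exact tendsto_atTop_mono (fun n => (norm_denom_bounds n).1)
    (tendsto_im_imagPoint.const_mul_atTop hc')

lemma tendsto_log_norm_denom_div {c : ℕ} (hc : 0 < c) :
    Tendsto (fun n => Real.log ‖denom (lowerUnipotent c) (imagPoint n)‖ / (imagPoint n).im)
      atTop (𝓝 0) := by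
  have h1 := Real.isLittleO_log_id_atTop.comp_tendsto (tendsto_norm_denom hc)
  have h2 : (id ∘ fun n => ‖denom (lowerUnipotent c) (imagPoint n)‖) =O[atTop]
      fun n => (imagPoint n).im := by
    refine IsBigO.of_bound (c + 1) (Eventually.of_forall fun n => ?_)
    have h3 := (norm_denom_bounds (c := c) n).2
    have h4 : 1 ≤ (imagPoint n).im := by rw [imagPoint_im]; simp
    rw [Function.comp_apply, id, norm_norm, Real.norm_of_nonneg (by linarith)]
    linarith
  exact (h1.trans_isBigO h2).tendsto_div_nhds_zero

lemma tendsto_im_lowerUnipotent_smul {c : ℕ} (hc : 0 < c) :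
    Tendsto (fun n => (lowerUnipotent c • imagPoint n).im) atTop (𝓝 0) := by
  have hc' : (1 : ℝ) ≤ c := by exact_mod_cast hc
  refine squeeze_zero (fun n => (im_pos _).le) (fun n => ?_)
    (tendsto_inv_atTop_zero.comp tendsto_im_imagPoint)
  have h1 : 0 < (imagPoint n).im := (imagPoint n).im_pos
  have h2 := (norm_denom_bounds (c := c) n).1
  have h3 : (imagPoint n).im ≤ ‖denom (lowerUnipotent c) (imagPoint n)‖ :=
    (le_mul_of_one_le_left h1.le hc').trans h2
  rw [ModularGroup.im_smul_eq_div_normSq, Complex.normSq_eq_norm_sq, Function.comp_apply,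
    div_le_iff₀ (pow_pos (h1.trans_le h3) 2)]
  calc (imagPoint n).im = (imagPoint n).im⁻¹ * (imagPoint n).im ^ 2 := by field_simp
    _ ≤ _ := by gcongr

lemma tendsto_eExp_imagPoint : Tendsto (fun n => eExp (imagPoint n)) atTop (𝓝 0) := by
  rw [tendsto_zero_iff_norm_tendsto_zero]
  have h : Tendsto (fun n => 2 * Real.pi * (imagPoint n).im) atTop atTop :=
    tendsto_im_imagPoint.const_mul_atTop (mul_pos two_pos Real.pi_pos)
  refine (Real.tendsto_exp_neg_atTop_nhds_zero.comp h).congr fun n => ?_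
  rw [norm_eExp]; rfl

lemma norm_eExp_ofReal_mul (x : ℝ) (τ : ℍ) :
    ‖eExp (x * τ)‖ = Real.exp (-(2 * Real.pi * x * τ.im)) := by
  rw [norm_eExp, Complex.im_ofReal_mul]
  congr 1
  change -(2 * Real.pi * (x * τ.im)) = _
  ring

/-- A combination `α g₁ + β g₀` with `|α| = 1/3`, of weights `1` and `0`, whose expansion at `i∞`
is a power of `q` times a series with constant term `1`, is not modular, even after
multiplication by a real power of `q`: near the cusps equivalent to `i∞` under a lower unipotent
matrix, the two weights produce an incompatible growth. -/
theorem not_isModularForm_of_mixed_weight {f : ℍ → ℂ} {F : ℂ → ℂ} {α β : ℂ} {a C k : ℝ}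
    (hα : ‖α‖ = 1 / 3) (hF : Tendsto F (𝓝 0) (𝓝 1))
    (h1 : ∀ τ : ℍ, f (affinePoint 4 0 1 (by norm_num) one_pos τ) =
      eExp ((4 * C : ℝ) * τ) * F (eExp τ))
    (h2 : ∀ τ : ℍ, f (affinePoint 4 0 1 (by norm_num) one_pos τ) =
      eExp (a * τ) * (α * formOne τ + β * formZero τ)) : ¬ IsModularForm k f := by
  rintro ⟨-, ⟨Γ, hΓ, N, hN, hmod⟩, -⟩
  obtain ⟨m, hm0, -, hm⟩ := Γ.exists_pow_mem_of_index_ne_zero hΓ.index_ne_zero (lowerUnipotent 24)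
  rw [lowerUnipotent_pow] at hm
  obtain ⟨ε, hε, hmod⟩ := hmod _ hm
  -- `τ ↦ 4τ` carries `(1 0; c 1)` to `(1 0; 24m 1)`; the former lies in `Γ(24)`, the latter in `Γ`
  set c : ℕ := 4 * (m * 24) with hc
  have hc0 : 0 < c := by positivity
  have hcz : (c : ℤ) = 4 * (m * 24) := by rw [hc]; push_cast; rfl
  have hmem : lowerUnipotent c ∈ CongruenceSubgroup.Gamma 24 :=
    lowerUnipotent_mem_Gamma ⟨4 * m, by rw [hcz]; push_cast; ring⟩
  set y : ℕ → ℝ := fun n => (imagPoint n).im with hy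
  set J : ℕ → ℝ := fun n => ‖denom (lowerUnipotent c) (imagPoint n)‖ with hJdef
  have hJpos : ∀ n, 0 < J n := fun n => norm_pos_iff.mpr (denom_ne_zero _ _)
  have hJ := tendsto_norm_denom hc0
  -- the growth predicted by modularity of weight `k`
  have key1 : ∀ n, ‖f (affinePoint 4 0 1 (by norm_num) one_pos (lowerUnipotent c • imagPoint n))‖ =
      J n ^ k * (Real.exp (-(8 * Real.pi * C * y n)) * ‖F (eExp (imagPoint n))‖) := fun n => by
    have hj : denom (lowerUnipotent (m * 24))
        (affinePoint 4 0 1 (by norm_num) one_pos (imagPoint n)) =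
        denom (lowerUnipotent c) (imagPoint n) := by
      rw [denom_lowerUnipotent, denom_lowerUnipotent, coe_affinePoint, hcz]
      push_cast; ring
    rw [hcz, affinePoint_four_smul, hmod, hj, h1, norm_mul, norm_mul,
      Complex.norm_eq_one_of_pow_eq_one hε hN.ne', one_mul, norm_mul, norm_eExp_ofReal_mul,
      Complex.norm_cpow_real]
    congr 3; ring
  -- the growth of the combination of forms of weights `1` and `0`
  have key2 : ∀ n, ‖f (affinePoint 4 0 1 (by norm_num) one_pos (lowerUnipotent c • imagPoint n))‖ =
      Real.exp (-(2 * Real.pi * a * (lowerUnipotent c • imagPoint n).im)) *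
        ‖α * formOne (lowerUnipotent c • imagPoint n : ℍ) +
          β * formZero (lowerUnipotent c • imagPoint n : ℍ)‖ := fun n => by
    rw [h2, norm_mul, norm_eExp_ofReal_mul]
  let h₁ : ℂ → ℂ := fun q => qJ 1 q ^ 2 * qJ 4 q / qJ 2 q
  let h₀ : ℂ → ℂ := fun q => qJ 2 q ^ 2 * qJ 3 q * qJ 12 q / (qJ 1 q * qJ 4 q ^ 2 * qJ 6 q)
  have hh₁ : Tendsto h₁ (𝓝 0) (𝓝 1) := by
    simpa using! (((tendsto_qJ one_ne_zero).pow 2).mul (tendsto_qJ (m := 4) (by norm_num))).div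
      (tendsto_qJ two_ne_zero) one_ne_zero
  have hh₀ : Tendsto h₀ (𝓝 0) (𝓝 1) := by
    simpa using! ((((tendsto_qJ two_ne_zero).pow 2).mul (tendsto_qJ (m := 3) (by norm_num))).mul
      (tendsto_qJ (m := 12) (by norm_num))).div (((tendsto_qJ one_ne_zero).mul
      ((tendsto_qJ (m := 4) (by norm_num)).pow 2)).mul (tendsto_qJ (m := 6) (by norm_num)))
      (by norm_num)
  -- the size of `g₁` at the chosen points: weight `1`, and `g₁ ~ q^{1/6}` at `i∞`
  let D : ℕ → ℝ := fun n => J n * Real.exp (-(Real.pi / 3 * y n))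
  have hD : ∀ n, 0 < D n := fun n => mul_pos (hJpos n) (Real.exp_pos _)
  have hE : ∀ n, ‖eExp ((imagPoint n : ℂ) / 6)‖ = Real.exp (-(Real.pi / 3 * y n)) := fun n => by
    rw [show (imagPoint n : ℂ) / 6 = ((1 / 6 : ℝ) : ℂ) * imagPoint n by push_cast; ring,
      norm_eExp_ofReal_mul]
    congr 1; ring
  have n1 : ∀ n, ‖α * formOne (lowerUnipotent c • imagPoint n : ℍ) / D n‖ =
      1 / 3 * ‖h₁ (eExp (imagPoint n))‖ := fun n => by
    have e := etaLike_formOne.norm_smul hmem (imagPoint n)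
    have hJn := (hJpos n).ne'
    have hx := (Real.exp_pos (-(Real.pi / 3 * y n))).ne'
    rw [norm_div, norm_mul, e, hα, zpow_one, formOne, norm_mul, hE, Complex.norm_real,
      Real.norm_of_nonneg (hD n).le]
    simp only [D, h₁]
    change 1 / 3 * (J n * _) / _ = _
    field_simp
  have n0 : ∀ n, ‖β * formZero (lowerUnipotent c • imagPoint n : ℍ) / D n‖ =
      ‖β‖ * ‖h₀ (eExp (imagPoint n))‖ / J n := fun n => by
    have e := etaLike_formZero.norm_smul hmem (imagPoint n)
    have hJn := (hJpos n).ne'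
    have hx := (Real.exp_pos (-(Real.pi / 3 * y n))).ne'
    rw [norm_div, norm_mul, e, zpow_zero, one_mul, formZero, norm_mul, hE, Complex.norm_real,
      Real.norm_of_nonneg (hD n).le]
    simp only [D, h₀]
    field_simp
  have t1 : Tendsto (fun n => ‖α * formOne (lowerUnipotent c • imagPoint n : ℍ) / D n‖) atTop
      (𝓝 (1 / 3)) := by
    simp only [n1]
    have h := ((hh₁.comp tendsto_eExp_imagPoint).norm).const_mul (1 / 3 : ℝ)
    rwa [norm_one, mul_one] at h
  have t0 : Tendsto (fun n => ‖β * formZero (lowerUnipotent c • imagPoint n : ℍ) / D n‖) atTop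
      (𝓝 0) := by
    simp only [n0]
    exact (((hh₀.comp tendsto_eExp_imagPoint).norm).const_mul ‖β‖).div_atTop hJ
  have t2 : Tendsto (fun n => ‖α * formOne (lowerUnipotent c • imagPoint n : ℍ) / D n +
      β * formZero (lowerUnipotent c • imagPoint n : ℍ) / D n‖) atTop (𝓝 (1 / 3)) := by
    have h : ∀ n, |‖α * formOne (lowerUnipotent c • imagPoint n : ℍ) / D n +
        β * formZero (lowerUnipotent c • imagPoint n : ℍ) / D n‖ -
        ‖α * formOne (lowerUnipotent c • imagPoint n : ℍ) / D n‖| ≤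
        ‖β * formZero (lowerUnipotent c • imagPoint n : ℍ) / D n‖ := fun n => by
      refine (abs_norm_sub_norm_le _ _).trans_eq ?_
      rw [add_sub_cancel_left]
    have h' := (squeeze_zero_norm h t0).add t1
    simp only [sub_add_cancel, zero_add] at h'
    exact h'
  have t3 : Tendsto (fun n => Real.exp (-(2 * Real.pi * a * (lowerUnipotent c • imagPoint n).im)))
      atTop (𝓝 1) := by
    have h := ((tendsto_im_lowerUnipotent_smul hc0).const_mul (2 * Real.pi * a)).neg
    rw [mul_zero, neg_zero] at h
    have h' := (Real.continuous_exp.tendsto 0).comp h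
    rwa [Real.exp_zero] at h'
  have t4 := t3.mul t2
  rw [one_mul] at t4
  have hFn := (hF.comp tendsto_eExp_imagPoint).norm
  rw [norm_one] at hFn
  have t5 := t4.div hFn one_ne_zero
  rw [div_one] at t5
  refine not_tendsto_rpow_mul_exp tendsto_im_imagPoint hJ (tendsto_log_norm_denom_div hc0)
    (k - 1) (Real.pi / 3 - 8 * Real.pi * C) (t5.congr' ?_)
  filter_upwards [hFn.eventually_ne one_ne_zero] with n hn
  have hDn : (D n : ℂ) ≠ 0 := by exact_mod_cast (hD n).ne'
  have e := (key2 n).symm.trans (key1 n)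
  have hn' : ‖F (eExp (imagPoint n))‖ ≠ 0 := hn
  simp only [Pi.div_apply, Function.comp_apply]
  rw [← add_div, norm_div, Complex.norm_real, Real.norm_of_nonneg (hD n).le, ← mul_div_assoc, e,
    Real.rpow_sub_one (hJpos n).ne']
  have hx := (Real.exp_pos (-(Real.pi / 3 * y n))).ne'
  have e2 : Real.exp ((Real.pi / 3 - 8 * Real.pi * C) * y n) * Real.exp (-(Real.pi / 3 * y n)) =
      Real.exp (-(8 * Real.pi * C * y n)) := by
    rw [← Real.exp_add]; congr 1; ring
  have hJn := (hJpos n).ne'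
  simp only [D]
  rw [← e2]
  change _ = J n ^ k / J n * _
  field_simp
  rfl

lemma coe_affinePoint_four (τ : ℍ) :
    (affinePoint 4 0 1 (by norm_num) one_pos τ : ℂ) = 4 * τ := by
  rw [coe_affinePoint]; push_cast; ring

theorem not_isModularForm_nahmSum_matA_first (C k : ℝ) :
    ¬ IsModularForm k fun τ : ℍ => nahmSum matA ![1/2, 1/2, 0] C τ := by
  refine not_isModularForm_of_mixed_weight (α := 1 / 3) (β := 2 / 3) (a := 4 * C - 1 / 6) (C := C)
    (by norm_num) (tendsto_tripleSum (N := fun t =>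
      3 * t.1 ^ 2 + 3 * t.2.1 ^ 2 + 4 * t.2.2 ^ 2 + 2 * t.1 * t.2.1 + 4 * t.1 * t.2.2
            + 4 * t.2.1 * t.2.2 + 2 * t.1 + 2 * t.2.1) (fun i j k => ?_) (by simp))
    (fun τ => ?_) fun τ => ?_
  · simp only
    nlinarith [Nat.le_self_pow two_ne_zero k, Nat.zero_le (i * j), Nat.zero_le (i * k),
      Nat.zero_le (j * k)]
  · rw [coe_affinePoint_four, nahmSum, ← tripleEquiv.tsum_eq, tsum_congr (nahmTerm_matA_first C τ),
      tsum_mul_left]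
    push_cast; rfl
  · rw [coe_affinePoint_four, nahmSum_matA_first C τ.im_pos]
    push_cast; rfl

theorem not_isModularForm_nahmSum_matA_second (C k : ℝ) :
    ¬ IsModularForm k fun τ : ℍ => nahmSum matA ![1, 1, 1] C τ := by
  refine not_isModularForm_of_mixed_weight (α := -(1 / 3)) (β := 1 / 3) (a := 4 * C - 7 / 6)
    (C := C) (by norm_num) (tendsto_tripleSum (N := fun t =>
      3 * t.1 ^ 2 + 3 * t.2.1 ^ 2 + 4 * t.2.2 ^ 2 + 2 * t.1 * t.2.1 + 4 * t.1 * t.2.2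
            + 4 * t.2.1 * t.2.2 + 4 * t.1 + 4 * t.2.1 + 4 * t.2.2) (fun i j k => ?_) (by simp))
    (fun τ => ?_) fun τ => ?_
  · simp only
    nlinarith [Nat.zero_le (i * j), Nat.zero_le (i * k), Nat.zero_le (j * k)]
  · rw [coe_affinePoint_four, nahmSum, ← tripleEquiv.tsum_eq,
      tsum_congr (nahmTerm_matA_second C τ), tsum_mul_left]
    push_cast; rfl
  · rw [coe_affinePoint_four, nahmSum_matA_second C τ.im_pos]
    push_cast; rfl

/-! ### The dual triples -/

lemma matAStar_inv : matAStar⁻¹ = matA := by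
  refine Matrix.inv_eq_right_inv ?_
  ext i j
  fin_cases i <;> fin_cases j <;>
    simp [matAStar, matA, Matrix.mul_apply, Fin.sum_univ_three] <;> norm_num

lemma dualVector_first : dualVector matAStar ![1/2, 1/2, -1/2] = ![1/2, 1/2, 0] := by
  rw [dualVector, matAStar_inv]
  ext i
  fin_cases i <;> simp [matA, Matrix.mulVec, dotProduct, Fin.sum_univ_three] <;> norm_num

lemma dualVector_second : dualVector matAStar ![1/2, 1/2, 0] = ![1, 1, 1] := by
  rw [dualVector, matAStar_inv]
  ext i
  fin_cases i <;> simp [matA, Matrix.mulVec, dotProduct, Fin.sum_univ_three] <;> norm_num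

lemma dualScalar_first : dualScalar matAStar ![1/2, 1/2, -1/2] (1/12) = 1/24 := by
  have h := dualVector_first
  rw [dualVector] at h
  rw [dualScalar, h]
  simp [dotProduct, Fin.sum_univ_three]
  norm_num

lemma dualScalar_second : dualScalar matAStar ![1/2, 1/2, 0] (1/12) = 7/24 := by
  have h := dualVector_second
  rw [dualVector] at h
  rw [dualScalar, h]
  simp [dotProduct, Fin.sum_univ_three]
  norm_num

lemma posDef_matAStar : (matAStar.map (fun x : ℚ => (x : ℝ))).PosDef := by
  refine Matrix.PosDef.of_dotProduct_mulVec_pos ?_ fun x hx => ?_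
  · ext i j
    fin_cases i <;> fin_cases j <;> simp [matAStar]
  · have h : star x ⬝ᵥ (matAStar.map (fun x : ℚ => (x : ℝ))).mulVec x =
        (x 0 - x 2 / 2) ^ 2 + (x 1 - x 2 / 2) ^ 2 + x 2 ^ 2 / 2 := by
      simp [matAStar, Matrix.mulVec, dotProduct, Fin.sum_univ_three]
      ring
    rw [h]
    by_contra! hn
    have h2 : x 2 = 0 := by nlinarith [sq_nonneg (x 0 - x 2 / 2), sq_nonneg (x 1 - x 2 / 2)]
    have h0 : x 0 = 0 := by nlinarith [sq_nonneg (x 0), sq_nonneg (x 1)]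
    have h1 : x 1 = 0 := by nlinarith [sq_nonneg (x 0), sq_nonneg (x 1)]
    exact hx (by ext i; fin_cases i <;> simp [h0, h1, h2])

lemma isDualityCounterexample_first :
    IsDualityCounterexample matAStar ![1/2, 1/2, -1/2] (1/12) := by
  refine ⟨posDef_matAStar, ⟨0, ?_⟩, ?_⟩
  · simpa using! isModularForm_nahmSum_matAStar_first
  · rintro ⟨k, hk⟩
    rw [matAStar_inv, dualVector_first] at hk
    exact not_isModularForm_nahmSum_matA_first _ k hk

lemma isDualityCounterexample_second :
    IsDualityCounterexample matAStar ![1/2, 1/2, 0] (1/12) := by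
  refine ⟨posDef_matAStar, ⟨0, ?_⟩, ?_⟩
  · simpa using! isModularForm_nahmSum_matAStar_second
  · rintro ⟨k, hk⟩
    rw [matAStar_inv, dualVector_second] at hk
    exact not_isModularForm_nahmSum_matA_second _ k hk

lemma not_zagierDualityConjecture : ¬ ZagierDualityConjecture := fun h =>
  isDualityCounterexample_first.2.2
    (h 3 matAStar _ _ isDualityCounterexample_first.1 isDualityCounterexample_first.2.1)
end

theorem theorem6p2 :
    -- the two identities, for every `q` in the unit disc
    (∀ q : ℂ, ‖q‖ < 1 →
      HasSum
        (fun p : ℕ × ℕ × ℕ =>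
          q ^ (3 * p.1 ^ 2 + 3 * p.2.1 ^ 2 + 4 * p.2.2 ^ 2 + 2 * p.1 * p.2.1 + 4 * p.1 * p.2.2
              + 4 * p.2.1 * p.2.2 + 2 * p.1 + 2 * p.2.1) /
            (qPoch (q ^ 4) (q ^ 4) p.1 * qPoch (q ^ 4) (q ^ 4) p.2.1 *
              qPoch (q ^ 4) (q ^ 4) p.2.2))
        (1 / 3 * (qJ 1 q ^ 2 * qJ 4 q / qJ 2 q) +
          2 / 3 * (qJ 2 q ^ 2 * qJ 3 q * qJ 12 q / (qJ 1 q * qJ 4 q ^ 2 * qJ 6 q)))) ∧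
    (∀ q : ℂ, ‖q‖ < 1 → q ≠ 0 →
      HasSum
        (fun p : ℕ × ℕ × ℕ =>
          q ^ (3 * p.1 ^ 2 + 3 * p.2.1 ^ 2 + 4 * p.2.2 ^ 2 + 2 * p.1 * p.2.1 + 4 * p.1 * p.2.2
              + 4 * p.2.1 * p.2.2 + 4 * p.1 + 4 * p.2.1 + 4 * p.2.2) /
            (qPoch (q ^ 4) (q ^ 4) p.1 * qPoch (q ^ 4) (q ^ 4) p.2.1 *
              qPoch (q ^ 4) (q ^ 4) p.2.2))
        (-(1 / 3) * q⁻¹ * (qJ 1 q ^ 2 * qJ 4 q / qJ 2 q) +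
          1 / 3 * q⁻¹ *
            (qJ 2 q ^ 2 * qJ 3 q * qJ 12 q / (qJ 1 q * qJ 4 q ^ 2 * qJ 6 q)))) ∧
    -- the Nahm sums are sums of modular forms of weights `1` and `0`
    IsModularForm 1 (fun τ : ℍ => formOne τ) ∧
    IsModularForm 0 (fun τ : ℍ => formZero τ) ∧
    (∀ τ : ℍ, nahmSum matA ![1/2, 1/2, 0] (1/24) (4 * τ) =
      1 / 3 * formOne τ + 2 / 3 * formZero τ) ∧
    (∀ τ : ℍ, nahmSum matA ![1, 1, 1] (7/24) (4 * τ) =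
      -(1 / 3) * formOne τ + 1 / 3 * formZero τ) ∧
    -- they are not modular, of any weight, for any `C`
    (∀ C k : ℝ, ¬ IsModularForm k (fun τ : ℍ => nahmSum matA ![1/2, 1/2, 0] C τ)) ∧
    (∀ C k : ℝ, ¬ IsModularForm k (fun τ : ℍ => nahmSum matA ![1, 1, 1] C τ)) ∧
    -- they are the duals of two Nahm sums that converge and are modular, of weight `0`
    (matAStar⁻¹ = matA ∧
      dualVector matAStar ![1/2, 1/2, -1/2] = ![1/2, 1/2, 0] ∧
      dualScalar matAStar ![1/2, 1/2, -1/2] (1/12) = 1/24 ∧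
      dualVector matAStar ![1/2, 1/2, 0] = ![1, 1, 1] ∧
      dualScalar matAStar ![1/2, 1/2, 0] (1/12) = 7/24) ∧
    (∀ τ : ℍ, Summable (nahmTerm matAStar ![1/2, 1/2, -1/2] (1/12) τ)) ∧
    (∀ τ : ℍ, Summable (nahmTerm matAStar ![1/2, 1/2, 0] (1/12) τ)) ∧
    IsModularForm 0 (fun τ : ℍ => nahmSum matAStar ![1/2, 1/2, -1/2] (1/12) τ) ∧
    IsModularForm 0 (fun τ : ℍ => nahmSum matAStar ![1/2, 1/2, 0] (1/12) τ) ∧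
    -- hence the two dual triples are counterexamples to the duality conjecture
    IsDualityCounterexample matAStar ![1/2, 1/2, -1/2] (1/12) ∧
    IsDualityCounterexample matAStar ![1/2, 1/2, 0] (1/12) ∧
    ¬ ZagierDualityConjecture := by
  refine ⟨fun q hq => hasSum_first hq, fun q hq hq0 => hasSum_second hq hq0,
    isModularForm_formOne, isModularForm_formZero, fun τ => ?_, fun τ => ?_,
    not_isModularForm_nahmSum_matA_first, not_isModularForm_nahmSum_matA_second,
    ⟨matAStar_inv, dualVector_first, dualScalar_first, dualVector_second, dualScalar_second⟩,
    fun τ => summable_nahmTerm_matAStar 0 (by norm_num) τ.im_pos,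
    fun τ => summable_nahmTerm_matAStar 1 (by norm_num) τ.im_pos,
    isModularForm_nahmSum_matAStar_first, isModularForm_nahmSum_matAStar_second,
    isDualityCounterexample_first, isDualityCounterexample_second, not_zagierDualityConjecture⟩
  · rw [nahmSum_matA_first _ τ.im_pos]
    norm_num [eExp_zero]
  · rw [nahmSum_matA_second _ τ.im_pos]
    norm_num [eExp_zero]
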